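/- Let $\mathbb K$ be a field of characteristic $0$. Consider letters $(a,b,c,z)$ with $a,c\in\mathbb N=\{1,2,\dots\}$, $b\in\mathbb N_0$, $z\in\mathbb K\setminus\{0\}$, $b<a$ and $\gcd(a,b)=1$; the letter $(a,b,c,z)$ has degree $c$. Let $\mathcal H$ be one of the alphabets $A_h$ (the letters $(1,0,c,1)$), $A_a$ (the letters $(1,0,c,\pm1)$), or $A_{c(M)}$ for a finite set $M\subset\mathbb N$ (the letters $(a,b,c,\pm1)$ with $a\in M$). The nested sum of a word over $\mathcal H$ is defined by $S_\epsilon(n)=1$ for the empty word $\epsilon$ and $$S_{\alpha u}(n)=\sum_{i=1}^n\frac{z^i}{(a i+b)^c}\,S_u(i),\qquad \alpha=(a,b,c,z).$$ The weight of a word (or of its sum) is the sum of the degrees of its letters. *The ring of sums.* Let $R=\mathbb K(n)[x]$ with $x^2=1$, with the automorphism $\sigma(n)=n+1$, $\sigma(x)=-x$. For a letter $\alpha=(a,b,c,z)\in\mathcal H$ put $\bar\lambda(\alpha)=x^{(z-1)/2}/(a n+b)^c\in R$ (numerator $1$ for $z=1$ and $x$ for $z=-1$). Let $\mathbb A^{\mathcal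 H}$ be the polynomial ring over $R$ with one variable $\bar S_w$ for each nonempty word $w$ over $\mathcal H$, put $\bar S_\epsilon=1$, and extend $\sigma$ to the automorphism of $\mathbb A^{\mathcal H}$ with $\sigma(\bar S_{\alpha u})=\bar S_{\alpha u}+\sigma(\bar\lambda(\alpha))\,\sigma(\bar S_u)$. *The reduced ring.* For letters $\alpha,\beta\in\mathcal H$ let $[\alpha,\beta]$ be the unique $\mathbb K$-linear combination $\sum_j r_j\gamma_j$ of letters of $\mathcal H$ with $\bar\lambda(\alpha)\bar\lambda(\beta)=\sum_j r_j\bar\lambda(\gamma_j)$. Let $R\langle\mathcal H\rangle$ be the free $R$-module on all words over $\mathcal H$, with the $R$-bilinear quasi-shuffle product given by $\epsilon*w=w*\epsilon=w$ and $\alpha u*\beta v=\alpha(u*\beta v)+\beta(\alpha u*v)-[\alpha,\beta](u*v)$. Let $L:\mathbb A^{\mathcal H}\to (R\langle\mathcal H\rangle,*)$ be the $R$-algebra homomorphism with $L(\bar S_w)=w$, let $I=\ker L$, and let $\mathbb E^{\mathcal H}=\mathbb A^{\mathcal H}/I$ with the automorphism induced by $\sigma$, again denoted by $\sigma$. *Basis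 sums.* For each $d\ge1$ order the finitely many words of weight $d$ in an arbitrary way. Form the matrix whose columns are these words in the chosen order, and whose rows are the coefficient vectors, at the words of weight $d$, of the elements $L(p)$, where $p$ runs through the products of at least two variables $\bar S_w$ with total weight $d$. The words of weight $d$ whose columns are not pivot columns of the reduced row echelon form of this matrix (over $\mathbb K$) are the irreducible words of weight $d$; their sums are the basis sums, those which cannot be reduced further by the quasi-shuffle algebra. Let $\mathcal B$ be the set of irreducible words of all weights, and write $t_w=\bar S_w+I$. *Sequences.* Let $\mathcal S(\mathbb K)$ be the ring of sequences $\langle a_0,a_1,\dots\rangle$ in $\mathbb K$, two sequences being identified if they agree from some point on, with the shift automorphism $\langle a_0,a_1,\dots\rangle\mapsto\langle a_1,a_2,\dots\rangle$. For $f=f_0+f_1x\in R$ with $f_0,f_1\in\mathbb K(n)$ let $\mathrm{ev}(f,k)=f_0(k)+(-1)^kf_1(k)$, the value of a rational function at a pole being $0$. Then, for each such $\mathcal H$ and each choice of the orders: 1. $\{f\in\mathbb E^{\mathcal H}\mid\sigma(f)=f\}=\mathbb K$. 2. There is an injective ring homomorphism $\tau:\mathbb E^{\mathcal H}\to\mathcal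 S(\mathbb K)$ that commutes with $\sigma$ and the shift, such that $\tau(f)=\langle\mathrm{ev}(f,k)\rangle_{k\ge0}$ for all $f\in R$, and $\tau(t_w)=\langle S_w(k)\rangle_{k\ge0}$ for all nonempty words $w$ over $\mathcal H$. 3. The image $\tau(\mathbb E^{\mathcal H})$ is a polynomial ring over the ring $\tau(R)$ of rational sequences adjoined with $\langle(-1)^k\rangle_{k\ge0}$, in the sequences of the basis sums: it is generated as a ring over $\tau(R)$ by the sequences $\tau(t_w)=\langle S_w(k)\rangle_{k\ge0}$, $w\in\mathcal B$, and these sequences are algebraically independent over $\tau(R)$. -/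

import Mathlib

noncomputable section
namespace HSum

open Polynomial in
/-- The automorphism of `K(n)` with `n ↦ n + 1`. -/
def ratShift (K : Type*) [Field K] : RatFunc K ≃ₐ[K] RatFunc K :=
  IsFractionRing.algEquivOfAlgEquiv (algEquivAevalXAddC (1 : K))

/-- The ring `K(n)[x]` with `x² = 1`; `⟨f, g⟩` is `f + g x`. -/
abbrev RatAlt (K : Type*) [Field K] : Type _ := QuadraticAlgebra (RatFunc K) 1 0

/-- The element `x` of `K(n)[x]`. -/
def RatAlt.x (K : Type*) [Field K] : RatAlt K := ⟨0, 1⟩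

theorem RatAlt.x_sq (K : Type*) [Field K] : RatAlt.x K ^ 2 = 1 := by
  rw [sq]
  ext <;> simp [RatAlt.x, QuadraticAlgebra.re_one, QuadraticAlgebra.im_one]

/-- The automorphism of `K(n)[x]` with `n ↦ n + 1`, `x ↦ -x`. -/
def RatAlt.shift (K : Type*) [Field K] : RatAlt K ≃+* RatAlt K where
  toFun f := ⟨ratShift K f.re, -ratShift K f.im⟩
  invFun f := ⟨(ratShift K).symm f.re, -(ratShift K).symm f.im⟩
  left_inv f := by ext <;> simp
  right_inv f := by ext <;> simp
  map_mul' f g := by ext <;> simp [add_comm]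
  map_add' f g := by ext <;> simp [add_comm]

theorem RatAlt.shift_algebraMap (K : Type*) [Field K] (k : K) :
    RatAlt.shift K (algebraMap K (RatAlt K) k) = algebraMap K (RatAlt K) k := by
  rw [IsScalarTower.algebraMap_apply K (RatFunc K) (RatAlt K)]
  ext <;> simp [RatAlt.shift, - RatFunc.algebraMap_eq_C]

theorem RatAlt.shift_symm_algebraMap (K : Type*) [Field K] (k : K) :
    ((RatAlt.shift K).symm : RatAlt K →+* RatAlt K) (algebraMap K (RatAlt K) k) =
      algebraMap K (RatAlt K) k :=
  (RingEquiv.symm_apply_eq _).2 (RatAlt.shift_algebraMap K k).symm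

theorem ratShift_X (K : Type*) [Field K] : ratShift K RatFunc.X = RatFunc.X + 1 := by
  rw [ratShift, ← RatFunc.algebraMap_X, IsFractionRing.algEquivOfAlgEquiv_algebraMap]
  simp

/-- Sequences over `K`, identified if they agree from some point on. -/
abbrev SeqRing (K : Type*) : Type _ := Filter.Germ (Filter.atTop : Filter ℕ) K

/-- The class of a sequence. -/
def toSeq {K : Type*} (s : ℕ → K) : SeqRing K := (s : Filter.Germ (Filter.atTop : Filter ℕ) K)

/-- The shift `⟨a₀, a₁, …⟩ ↦ ⟨a₁, a₂, …⟩`. -/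
def SeqRing.shift (K : Type*) [CommRing K] : SeqRing K ≃+* SeqRing K where
  toFun f := f.compTendsto (fun n => n + 1) (Filter.tendsto_add_atTop_nat 1)
  invFun f := f.compTendsto (fun n => n - 1) (Filter.tendsto_sub_atTop_nat 1)
  left_inv f := by
    induction f using Filter.Germ.inductionOn with
    | _ f =>
    refine Filter.Germ.coe_eq.2 ?_
    filter_upwards [Filter.eventually_ge_atTop 1] with n hn
    simp [Nat.sub_add_cancel hn]
  right_inv f := by
    induction f using Filter.Germ.inductionOn with
    | _ f => exact Filter.Germ.coe_eq.2 (Filter.Eventually.of_forall fun n => by simp)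
  map_mul' f g := by
    induction f using Filter.Germ.inductionOn with
    | _ f => induction g using Filter.Germ.inductionOn with
      | _ g => rfl
  map_add' f g := by
    induction f using Filter.Germ.inductionOn with
    | _ f => induction g using Filter.Germ.inductionOn with
      | _ g => rfl

theorem SeqRing.shift_toSeq {K : Type*} [CommRing K] (s : ℕ → K) :
    SeqRing.shift K (toSeq s) = toSeq fun n => s (n + 1) := rfl

/-- Evaluation at `k` of an element of `K(n)[x]`, with `x ↦ (-1)^k`; the value of a rational
function at a pole is `0`. -/
def RatAlt.ev {K : Type*} [Field K] (f : RatAlt K) (k : ℕ) : K :=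
  RatFunc.eval (RingHom.id K) (k : K) f.re + (-1) ^ k * RatFunc.eval (RingHom.id K) (k : K) f.im

theorem eventually_denom {K : Type*} [Field K] [CharZero K] (f : RatFunc K) :
    ∀ᶠ k : ℕ in Filter.atTop, Polynomial.eval₂ (RingHom.id K) (k : K) f.denom ≠ 0 := by
  have hfin : {k : ℕ | Polynomial.eval₂ (RingHom.id K) (k : K) f.denom = 0}.Finite := by
    refine ((Polynomial.finite_setOfPred_isRoot f.denom_ne_zero).preimage
      (Nat.cast_injective (R := K)).injOn).subset fun k hk => ?_
    simpa [Polynomial.IsRoot, Polynomial.eval₂_id] using hk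
  have := hfin.eventually_cofinite_notMem
  rw [Nat.cofinite_eq_atTop] at this
  simpa using this

/-- The evaluation homomorphism from `K(n)[x]` to the ring of sequences. -/
def RatAlt.toSeqHom (K : Type*) [Field K] [CharZero K] : RatAlt K →+* SeqRing K where
  toFun f := toSeq f.ev
  map_one' := Filter.Germ.coe_eq.2 <| Filter.Eventually.of_forall fun k => by
    simp [RatAlt.ev, QuadraticAlgebra.re_one, QuadraticAlgebra.im_one, RatFunc.eval_zero]
  map_zero' := Filter.Germ.coe_eq.2 <| Filter.Eventually.of_forall fun k => by
    simp [RatAlt.ev, RatFunc.eval_zero]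
  map_add' f g := Filter.Germ.coe_eq.2 <| by
    filter_upwards [eventually_denom f.re, eventually_denom f.im, eventually_denom g.re,
      eventually_denom g.im] with k h1 h2 h3 h4
    change RatFunc.eval _ _ (f.re + g.re) + _ * RatFunc.eval _ _ (f.im + g.im) = f.ev k + g.ev k
    rw [RatFunc.eval_add _ _ h1 h3, RatFunc.eval_add _ _ h2 h4, RatAlt.ev, RatAlt.ev]
    ring
  map_mul' f g := Filter.Germ.coe_eq.2 <| by
    filter_upwards [eventually_denom f.re, eventually_denom f.im, eventually_denom g.re,
      eventually_denom g.im, eventually_denom (f.re * g.re), eventually_denom (f.im * g.im),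
      eventually_denom (f.re * g.im), eventually_denom (f.im * g.re)]
      with k h1 h2 h3 h4 h5 h6 h7 h8
    have e1 : (f * g).re = f.re * g.re + f.im * g.im := by simp
    have e2 : (f * g).im = f.re * g.im + f.im * g.re := by simp
    change RatFunc.eval _ _ (f * g).re + _ * RatFunc.eval _ _ (f * g).im = f.ev k * g.ev k
    rw [e1, e2]
    rw [RatFunc.eval_add _ _ h5 h6, RatFunc.eval_add _ _ h7 h8, RatFunc.eval_mul _ _ h1 h3,
      RatFunc.eval_mul _ _ h2 h4, RatFunc.eval_mul _ _ h1 h4, RatFunc.eval_mul _ _ h2 h3,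
      RatAlt.ev, RatAlt.ev]
    have : ((-1 : K) ^ k) * (-1) ^ k = 1 := by rw [← mul_pow]; simp
    linear_combination (-(RatFunc.eval (RingHom.id K) (k : K) f.im *
      RatFunc.eval (RingHom.id K) (k : K) g.im)) * this

/-- A letter `(a, b, c, z)`. -/
structure Letter (K : Type*) where
  a : ℕ
  b : ℕ
  c : ℕ
  z : K

/-- The alphabet of all letters `(a, b, c, z)` with `a, c ≥ 1`, `0 ≤ b < a`, `gcd (a, b) = 1`,
`z ≠ 0`. -/
def fullAlphabet (K : Type*) [Field K] : Set (Letter K) :=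
  {l | 1 ≤ l.a ∧ 1 ≤ l.c ∧ l.b < l.a ∧ Nat.gcd l.a l.b = 1 ∧ l.z ≠ 0}

/-- Names for the alphabets `A_h`, `A_a` and `A_{c(M)}`, `M` finite. -/
inductive Alphabet where
  | harmonic : Alphabet
  | alternating : Alphabet
  | cyclotomic (M : Finset ℕ) : Alphabet

/-- The letters of the alphabet. -/
def Alphabet.letters (K : Type*) [Field K] : Alphabet → Set (Letter K)
  | .harmonic => {l | l ∈ fullAlphabet K ∧ l.a = 1 ∧ l.b = 0 ∧ l.z = 1}
  | .alternating => {l | l ∈ fullAlphabet K ∧ l.a = 1 ∧ l.b = 0 ∧ (l.z = 1 ∨ l.z = -1)}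
  | .cyclotomic M => {l | l ∈ fullAlphabet K ∧ l.a ∈ M ∧ (l.z = 1 ∨ l.z = -1)}

section letters

variable {K : Type*} [Field K]

theorem Alphabet.mem_full {H : Alphabet} {l : Letter K} (hl : l ∈ H.letters K) :
    l ∈ fullAlphabet K := by
  cases H <;> exact hl.1

theorem Alphabet.z_eq {H : Alphabet} {l : Letter K} (hl : l ∈ H.letters K) :
    l.z = 1 ∨ l.z = -1 := by
  cases H
  · exact .inl hl.2.2.2
  · exact hl.2.2.2
  · exact hl.2.2

theorem Alphabet.mul_mem {H : Alphabet} {l m : Letter K} (hl : l ∈ H.letters K)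
    (hm : m ∈ H.letters K) {j : ℕ} (hj : 1 ≤ j) :
    (⟨l.a, l.b, j, l.z * m.z⟩ : Letter K) ∈ H.letters K := by
  have hf : (⟨l.a, l.b, j, l.z * m.z⟩ : Letter K) ∈ fullAlphabet K := by
    obtain ⟨h1, -, h3, h4, h5⟩ := Alphabet.mem_full hl
    exact ⟨h1, hj, h3, h4, mul_ne_zero h5 (Alphabet.mem_full hm).2.2.2.2⟩
  have hz : l.z * m.z = 1 ∨ l.z * m.z = -1 := by
    rcases Alphabet.z_eq hl with h | h <;> rcases Alphabet.z_eq hm with h' | h' <;> simp [h, h']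
  cases H
  · exact ⟨hf, hl.2.1, hl.2.2.1, by simp [hl.2.2.2, hm.2.2.2]⟩
  · exact ⟨hf, hl.2.1, hl.2.2.1, hz⟩
  · exact ⟨hf, hl.2.1, hz⟩

/-- The linear form `a n + b` in `K(n)`. -/
def linForm (K : Type*) [Field K] (a b : ℕ) : RatFunc K := (a : RatFunc K) * RatFunc.X + (b : RatFunc K)

/-- The element `1` of `K(n)[x]` for `z = 1` and `x` for `z = -1`. -/
def signElem (z : K) : RatAlt K := open Classical in if z = 1 then 1 else RatAlt.x K

/-- The summand `z ^ n / (a n + b) ^ c` as an element of `K(n)[x]`, for `z = 1` or `z = -1`. -/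
def lamBar (l : Letter K) : RatAlt K :=
  signElem l.z * algebraMap (RatFunc K) (RatAlt K) ((linForm K l.a l.b ^ l.c)⁻¹)

theorem signElem_mul [CharZero K] {z w : K} (hz : z = 1 ∨ z = -1) (hw : w = 1 ∨ w = -1) :
    signElem (z * w) = signElem z * signElem w := by
  have h1 : (-1 : K) ≠ 1 := by
    intro h
    have : (2 : K) = 0 := by linear_combination -h
    exact two_ne_zero this
  have hx := RatAlt.x_sq K
  rw [sq] at hx
  rcases hz with rfl | rfl <;> rcases hw with rfl | rfl <;> simp [signElem, h1, hx]

theorem linForm_eq (a b : ℕ) :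
    linForm K a b = algebraMap (Polynomial K) (RatFunc K)
      (Polynomial.C (a : K) * Polynomial.X + Polynomial.C (b : K)) := by
  simp [linForm]

theorem linForm_ne_zero [CharZero K] {a b : ℕ} (ha : 1 ≤ a) : linForm K a b ≠ 0 := by
  rw [linForm_eq, Ne, map_eq_zero_iff _ (RatFunc.algebraMap_injective K)]
  intro h
  have := congrArg (fun p => Polynomial.coeff p 1) h
  simp at this
  omega

theorem det_ne_zero {l m : Letter K} (hl : l ∈ fullAlphabet K) (hm : m ∈ fullAlphabet K)
    (h : l.a = m.a → l.b ≠ m.b) : l.a * m.b ≠ m.a * l.b := by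
  obtain ⟨h1, -, h3, h4, -⟩ := hl
  obtain ⟨h1', -, h3', h4', -⟩ := hm
  intro e
  have d1 : l.a ∣ m.a := Nat.Coprime.dvd_of_dvd_mul_right h4 ⟨m.b, e.symm⟩
  have d2 : m.a ∣ l.a := Nat.Coprime.dvd_of_dvd_mul_right h4' ⟨l.b, e⟩
  have ha := Nat.dvd_antisymm d1 d2
  rw [ha] at e
  exact h ha (Nat.eq_of_mul_eq_mul_left h1' e).symm

theorem mul_mem_span [CharZero K] {H : Alphabet} {l m : Letter K} (hl : l ∈ H.letters K)
    (hm : m ∈ H.letters K) :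
    lamBar l * lamBar m ∈ Submodule.span K (Set.range fun h : H.letters K => lamBar h.1) := by
  have hl' := Alphabet.mem_full hl
  have hm' := Alphabet.mem_full hm
  have hu := linForm_ne_zero (K := K) (b := l.b) hl'.1
  have hv := linForm_ne_zero (K := K) (b := m.b) hm'.1
  have key : lamBar l * lamBar m = signElem (l.z * m.z) * algebraMap (RatFunc K) (RatAlt K)
      ((linForm K l.a l.b ^ l.c * linForm K m.a m.b ^ m.c)⁻¹) := by
    rw [signElem_mul (Alphabet.z_eq hl) (Alphabet.z_eq hm), mul_inv, map_mul, lamBar, lamBar]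
    ring
  rw [key]
  by_cases h : l.a = m.a → l.b ≠ m.b
  swap
  · push Not at h
    refine Submodule.subset_span ⟨⟨_, Alphabet.mul_mem hl hm (j := l.c + m.c) ?_⟩, ?_⟩
    · have := hl'.2.1
      omega
    · simp only [lamBar, ← h.1, ← h.2, pow_add]
  · have hD : (l.a : K) * m.b - m.a * l.b ≠ 0 := by
      rw [sub_ne_zero]
      exact_mod_cast det_ne_zero hl' hm' h
    set D : K := (l.a : K) * m.b - m.a * l.b with hDdef
    have rel : (algebraMap K (RatFunc K) D) =
        (l.a : RatFunc K) * linForm K m.a m.b - m.a * linForm K l.a l.b := by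
      simp only [linForm, hDdef, map_sub, map_mul, map_natCast]
      ring
    have hD' : algebraMap K (RatFunc K) D ≠ 0 := by simpa using hD
    have hc := hl'.2.1
    generalize l.c = c at hc ⊢
    generalize m.c = d
    induction hn : c + d generalizing c d with
    | zero => omega
    | succ n ih =>
    rcases Nat.eq_zero_or_pos d with rfl | hd
    · refine Submodule.subset_span ⟨⟨_, Alphabet.mul_mem hl hm hc⟩, ?_⟩
      simp [lamBar]
    obtain ⟨d, rfl⟩ : ∃ d', d = d' + 1 := ⟨d - 1, by omega⟩
    obtain ⟨c, rfl⟩ : ∃ c', c = c' + 1 := ⟨c - 1, by omega⟩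
    have e : (linForm K l.a l.b ^ (c + 1) * linForm K m.a m.b ^ (d + 1))⁻¹ =
        (D⁻¹ * l.a : K) • (linForm K l.a l.b ^ (c + 1) * linForm K m.a m.b ^ d)⁻¹
        - (D⁻¹ * m.a : K) • (linForm K l.a l.b ^ c * linForm K m.a m.b ^ (d + 1))⁻¹ := by
      rw [Algebra.smul_def, Algebra.smul_def, map_mul, map_mul, map_inv₀, map_natCast, map_natCast]
      field_simp
      rw [rel]
      ring
    have hs : ∀ (k : K) (f : RatFunc K), algebraMap (RatFunc K) (RatAlt K) (k • f) =
        k • algebraMap (RatFunc K) (RatAlt K) f := fun k f =>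
      map_smul (IsScalarTower.toAlgHom K (RatFunc K) (RatAlt K)) k f
    rw [e, map_sub, mul_sub, hs, hs, mul_smul_comm, mul_smul_comm]
    refine Submodule.sub_mem _ (Submodule.smul_mem _ _ ?_) (Submodule.smul_mem _ _ ?_)
    · exact ih (c + 1) (by omega) d (by omega)
    · rcases Nat.eq_zero_or_pos c with rfl | hc'
      · refine Submodule.subset_span ⟨⟨_, Alphabet.mul_mem hm hl (j := d + 1) (by omega)⟩, ?_⟩
        simp [lamBar, mul_comm]
      · exact ih c hc' (d + 1) (by omega)

/-- The Laurent expansion at `ρ`, on polynomials. -/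
def expandPoly (ρ : K) : Polynomial K →+* LaurentSeries K :=
  (HahnSeries.ofPowerSeries ℤ K).comp ((Polynomial.coeToPowerSeries.ringHom (R := K)).comp
    (Polynomial.algEquivAevalXAddC ρ : Polynomial K →+* Polynomial K))

theorem expandPoly_injective (ρ : K) : Function.Injective (expandPoly ρ) := by
  have h1 : Function.Injective (HahnSeries.ofPowerSeries ℤ K) := HahnSeries.ofPowerSeries_injective
  have h2 := Polynomial.coe_injective (R := K)
  have h3 := (Polynomial.algEquivAevalXAddC ρ).injective
  intro p q h
  apply h3
  apply h2
  apply h1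
  simpa [expandPoly] using h

/-- The Laurent expansion of a rational function at `ρ`. -/
def expand (ρ : K) : RatFunc K →+* LaurentSeries K :=
  RatFunc.liftRingHom (expandPoly ρ)
    (nonZeroDivisors_le_comap_nonZeroDivisors_of_injective _ (expandPoly_injective ρ))

theorem expand_poly (ρ : K) (p : Polynomial K) :
    expand ρ (algebraMap (Polynomial K) (RatFunc K) p) = expandPoly ρ p :=
  RatFunc.liftRingHom_algebraMap _ _ _

theorem expand_smul (ρ : K) (k : K) (f : RatFunc K) : expand ρ (k • f) = k • expand ρ f := by
  have h : expand ρ (RatFunc.C k) = HahnSeries.C k := by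
    rw [← RatFunc.algebraMap_C, expand_poly]
    simp [expandPoly]
  rw [RatFunc.smul_eq_C_mul, map_mul, h, HahnSeries.C_mul_eq_smul]

theorem expand_linForm (ρ : K) (a b : ℕ) : expand ρ (linForm K a b) =
    HahnSeries.ofPowerSeries ℤ K (PowerSeries.C (a : K) * PowerSeries.X
      + PowerSeries.C ((a : K) * ρ + b)) := by
  rw [linForm_eq, expand_poly]
  have h : ∀ m : ℕ, (((m : Polynomial K) : PowerSeries K)) = (m : PowerSeries K) := fun m =>
    map_natCast (Polynomial.coeToPowerSeries.ringHom (R := K)) m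
  simp [expandPoly, mul_add, add_assoc, h]

theorem expand_regular (ρ : K) {a b : ℕ} (h : (a : K) * ρ + b ≠ 0) (c : ℕ) {i : ℤ} (hi : i < 0) :
    (expand ρ (linForm K a b ^ c)⁻¹).coeff i = 0 := by
  set p : PowerSeries K := (PowerSeries.C (a : K) * PowerSeries.X
      + PowerSeries.C ((a : K) * ρ + b)) with hp
  have hc : PowerSeries.constantCoeff (p ^ c) ≠ 0 := by simp [hp, h]
  have e : expand ρ (linForm K a b ^ c)⁻¹ = HahnSeries.ofPowerSeries ℤ K (p ^ c)⁻¹ := by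
    rw [map_inv₀, map_pow, expand_linForm, ← map_pow]
    refine inv_eq_of_mul_eq_one_right ?_
    rw [← map_mul, PowerSeries.mul_inv_cancel _ hc, map_one]
  rw [e]
  exact (PowerSeries.coeff_coe _ i).trans (if_pos hi)

theorem expand_pole [CharZero K] (ρ : K) {a b : ℕ} (ha : 1 ≤ a) (h : (a : K) * ρ + b = 0)
    (c c' : ℕ) :
    (expand ρ (linForm K a b ^ c')⁻¹).coeff (-(c : ℤ)) = if c = c' then ((a : K) ^ c)⁻¹ else 0 := by
  have ha' : (a : K) ≠ 0 := by
    simp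
    omega
  have e : expand ρ (linForm K a b ^ c')⁻¹ = HahnSeries.single (-(c' : ℤ)) ((a : K) ^ c')⁻¹ := by
    rw [map_inv₀, map_pow, expand_linForm, h]
    have : HahnSeries.ofPowerSeries ℤ K (PowerSeries.C (a : K) * PowerSeries.X
      + PowerSeries.C (0 : K)) = HahnSeries.single 1 (a : K) := by
      rw [map_zero, add_zero, map_mul, HahnSeries.ofPowerSeries_C, HahnSeries.ofPowerSeries_X,
        HahnSeries.C_apply, HahnSeries.single_mul_single, zero_add, mul_one]
    rw [this]
    simp [HahnSeries.inv_single]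
  rw [e]
  rcases eq_or_ne c c' with rfl | hne
  · simp
  · rw [if_neg hne, HahnSeries.coeff_single_of_ne]
    simpa using hne

/-- The component of `1` (for `z = 1`) or of `x` (otherwise) of an element of `K(n)[x]`. -/
def signPart (z : K) : RatAlt K →ₗ[K] RatFunc K := open Classical in
  if z = 1 then (QuadraticAlgebra.reₗ 1 0 : RatAlt K →ₗ[RatFunc K] RatFunc K).restrictScalars K
  else (QuadraticAlgebra.imₗ 1 0 : RatAlt K →ₗ[RatFunc K] RatFunc K).restrictScalars K

/-- The Laurent coefficient dual to the letter `l`. -/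
def dualLetter (l : Letter K) : RatAlt K →ₗ[K] K where
  toFun f := (l.a : K) ^ l.c *
    (expand (-(l.b : K) / l.a) (signPart l.z f)).coeff (-(l.c : ℤ))
  map_add' f g := by simp [mul_add]
  map_smul' k f := by
    rw [map_smul, expand_smul, HahnSeries.coeff_smul, smul_eq_mul, smul_eq_mul, RingHom.id_apply]
    ring

theorem lamBar_linearIndependent [CharZero K] (H : Alphabet) :
    LinearIndependent K (fun h : H.letters K => lamBar h.1) := by
  have h1 : (-1 : K) ≠ 1 := by
    intro h
    have : (2 : K) = 0 := by linear_combination -h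
    exact two_ne_zero this
  classical
  have apply_eq : ∀ l m : Letter K, dualLetter l (lamBar m) = (l.a : K) ^ l.c *
      (expand (-(l.b : K) / l.a) (signPart l.z (lamBar m))).coeff (-(l.c : ℤ)) := fun _ _ => rfl
  have signs : ∀ l m : Letter K, (l.z = 1 ∨ l.z = -1) → (m.z = 1 ∨ m.z = -1) →
      signPart l.z (lamBar m) = if l.z = m.z then (linForm K m.a m.b ^ m.c)⁻¹ else 0 := by
    rintro l m (h | h) (h' | h') <;>
    simp [signPart, lamBar, signElem, h, h', h1, h1.symm, RatAlt.x,
      QuadraticAlgebra.algebraMap_eq, QuadraticAlgebra.reₗ,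
      QuadraticAlgebra.imₗ]
  refine LinearIndependent.of_pairwise_dual_eq_zero_one _ (fun h => dualLetter h.1) ?_ ?_
  · rintro ⟨l, hl⟩ ⟨m, hm⟩ hne
    change dualLetter l (lamBar m) = 0
    rw [apply_eq, signs l m (Alphabet.z_eq hl) (Alphabet.z_eq hm)]
    split_ifs with hz
    swap
    · simp
    have hl' := Alphabet.mem_full hl
    have hm' := Alphabet.mem_full hm
    have hla : (l.a : K) ≠ 0 := by
      have := hl'.1
      simp
      omega
    by_cases hab : l.a = m.a → l.b ≠ m.b
    · rw [expand_regular, mul_zero]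
      · have hd := det_ne_zero hl' hm' hab
        intro h
        field_simp at h
        apply hd
        have : (l.a : K) * m.b = m.a * l.b := by linear_combination h
        exact_mod_cast this
      · have := hl'.2.1
        omega
    · push Not at hab
      rw [expand_pole _ hm'.1, if_neg, mul_zero]
      · intro hc
        apply hne
        cases l
        cases m
        simp_all
      · rw [← hab.1, ← hab.2]
        field_simp
        simp
  · rintro ⟨l, hl⟩
    change dualLetter l (lamBar l) = 1
    have hl' := Alphabet.mem_full hl
    have hla : (l.a : K) ≠ 0 := by
      have := hl'.1
      simp
      omega
    rw [apply_eq, signs l l (Alphabet.z_eq hl) (Alphabet.z_eq hl), if_pos rfl,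
      expand_pole _ hl'.1, if_pos rfl]
    · field_simp
    · field_simp
      simp

end letters

/-- A commutative and associative bilinear product on the `K`-vector space with basis `H`, given by
the products of basis elements. -/
structure Bracket (K H : Type*) [CommRing K] where
  br : H → H → H →₀ K
  comm : ∀ a b, br a b = br b a
  assoc : ∀ a b c, Finsupp.linearCombination K (fun d => br d c) (br a b) =
    Finsupp.linearCombination K (fun d => br a d) (br b c)

/-- The free `R`-module `R⟨H⟩` on the words over `H`; below it is equipped with the quasi-shuffle
product of the bracket, not with concatenation. -/
def QSh (R : Type*) {K H : Type*} [CommRing K] [CommRing R] (_B : Bracket K H) : Type _ :=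
  List H →₀ R

namespace QSh

section basic

variable {R K H : Type*} [CommRing K] [CommRing R] {B : Bracket K H}

instance : AddCommGroup (QSh R B) := inferInstanceAs (AddCommGroup (List H →₀ R))
instance {S : Type*} [Semiring S] [Module S R] : Module S (QSh R B) :=
  inferInstanceAs (Module S (List H →₀ R))

/-- A word as an element of `R⟨H⟩`. -/
def word (R : Type*) [CommRing R] (B : Bracket K H) (u : List H) : QSh R B :=
  Finsupp.single u (1 : R)

/-- The coefficient of a word. -/
def coeff (x : QSh R B) (u : List H) : R := (show List H →₀ R from x) u

theorem hom_ext {M : Type*} [AddCommGroup M] [Module R M] {f g : QSh R B →ₗ[R] M}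
    (h : ∀ u, f (word R B u) = g (word R B u)) : f = g :=
  Finsupp.lhom_ext' (M := R) (R := R) (N := M) fun u => LinearMap.ext_ring (h u)

theorem induction {p : QSh R B → Prop} (x : QSh R B) (h0 : p 0)
    (hadd : ∀ x y, p x → p y → p (x + y))
    (hs : ∀ (r : R) (u : List H), p (r • word R B u)) : p x := by
  refine Finsupp.induction_linear (motive := p) x h0 (fun f g => hadd f g) (fun u r => ?_)
  have := hs r u
  have e : (r • word R B u : QSh R B) = (Finsupp.single u r : List H →₀ R) := by
    refine (Finsupp.smul_single r u (1 : R)).trans ?_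
    simp
  rwa [e] at this

/-- The linear map with given values on words. -/
def lift {M : Type*} [AddCommGroup M] [Module R M] (f : List H → M) : QSh R B →ₗ[R] M :=
  Finsupp.linearCombination R f

@[simp] theorem lift_word {M : Type*} [AddCommGroup M] [Module R M] (f : List H → M)
    (u : List H) : lift (B := B) f (word R B u) = f u := by
  refine (Finsupp.linearCombination_single R (1 : R) u).trans ?_
  simp

instance : One (QSh R B) := ⟨word R B []⟩

theorem one_def : (1 : QSh R B) = word R B [] := rfl

/-- The additive map with `r • word u ↦ τ r • f u`. -/
def semilift (τ : R →+* R) (f : List H → QSh R B) : QSh R B →+ QSh R B :=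
  Finsupp.liftAddHom (α := List H) (M := R) fun u =>
    ((smulAddHom R (QSh R B)).flip (f u)).comp τ.toAddMonoidHom

theorem semilift_smul_word (τ : R →+* R) (f : List H → QSh R B) (r : R) (u : List H) :
    semilift τ f (r • word R B u) = τ r • f u := by
  have e : (r • word R B u : QSh R B) = (Finsupp.single u r : List H →₀ R) := by
    refine (Finsupp.smul_single r u (1 : R)).trans ?_
    simp
  rw [e]
  exact Finsupp.liftAddHom_apply_single _ u r

theorem semilift_word (τ : R →+* R) (f : List H → QSh R B) (u : List H) :
    semilift τ f (word R B u) = f u := by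
  have := semilift_smul_word τ f 1 u
  simpa using this

theorem semilift_smul (τ : R →+* R) (f : List H → QSh R B) (r : R) (x : QSh R B) :
    semilift τ f (r • x) = τ r • semilift τ f x := by
  induction x using induction with
  | h0 => simp
  | hadd x y hx hy => simp only [smul_add, map_add, hx, hy]
  | hs s u => rw [smul_smul, semilift_smul_word, semilift_smul_word, map_mul, mul_smul]

/-- The backward shift on words: `a u ↦ a u - lam a • u`. -/
def backWord (lam : H → R) : List H → QSh R B
  | [] => word R B []
  | a :: u => word R B (a :: u) - lam a • word R B u

/-- The forward shift on words: `a u ↦ a u + σ (lam a) • σ u`. -/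
def forwWord (σ : R →+* R) (lam : H → R) : List H → QSh R B
  | [] => word R B []
  | a :: u => word R B (a :: u) + σ (lam a) • forwWord σ lam u

theorem forw_back (σ : R ≃+* R) (lam : H → R) (x : QSh R B) :
    semilift (σ : R →+* R) (forwWord (σ : R →+* R) lam)
      (semilift (σ.symm : R →+* R) (backWord lam) x) = x := by
  induction x using induction with
  | h0 => simp
  | hadd x y hx hy => simp only [map_add, hx, hy]
  | hs r u =>
    rw [semilift_smul_word, semilift_smul]
    cases u with
    | nil => simp [backWord, semilift_word, forwWord]
    | cons a u =>
      simp [backWord, semilift_word, semilift_smul, forwWord]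

variable [Algebra K R]

/-- Left concatenation with a linear combination of letters. -/
def pre (α : H →₀ K) : QSh R B →ₗ[R] QSh R B :=
  lift fun u => α.sum fun a k => algebraMap K R k • word R B (a :: u)

theorem pre_single (a : H) (k : K) (u : List H) :
    pre (Finsupp.single a k) (word R B u) = algebraMap K R k • word R B (a :: u) := by
  simp [pre, Finsupp.sum_single_index]

theorem pre_add (α β : H →₀ K) : pre (R := R) (B := B) (α + β) = pre α + pre β := by
  refine hom_ext fun u => ?_
  simp only [pre, lift_word, LinearMap.add_apply]
  exact Finsupp.sum_add_index' (by simp) (by simp [add_smul])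

theorem pre_smul (k : K) (α : H →₀ K) :
    pre (R := R) (B := B) (k • α) = algebraMap K R k • pre α := by
  refine hom_ext fun u => ?_
  simp only [pre, lift_word, LinearMap.smul_apply]
  rw [Finsupp.sum_smul_index (by simp), Finsupp.smul_sum]
  simp [mul_smul]

/-- The quasi-shuffle product of two words:
`a u * b v = a (u * b v) + b (a u * v) - [a, b] (u * v)`. -/
def mulWord (R : Type*) [CommRing R] [Algebra K R] (B : Bracket K H) :
    List H → List H → QSh R B
  | [], v => word R B v
  | a :: u, [] => word R B (a :: u)
  | a :: u, b :: v =>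
    pre (Finsupp.single a 1) (mulWord R B u (b :: v))
      + pre (Finsupp.single b 1) (mulWord R B (a :: u) v)
      - pre (B.br a b) (mulWord R B u v)
  termination_by u v => u.length + v.length

/-- The quasi-shuffle product, extended bilinearly. -/
def mul : QSh R B →ₗ[R] QSh R B →ₗ[R] QSh R B :=
  lift fun u => lift fun v => mulWord R B u v

instance : Mul (QSh R B) := ⟨fun x y => mul x y⟩

theorem mul_def (x y : QSh R B) : x * y = mul x y := rfl

theorem word_mul (u v : List H) : word R B u * word R B v = mulWord R B u v := by
  simp [mul_def, mul]

theorem word_nil_mul (v : List H) : word R B [] * word R B v = word R B v := by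
  rw [word_mul, mulWord]

theorem mulWord_nil (u : List H) : mulWord R B u [] = word R B u := by
  cases u <;> rw [mulWord]

theorem cons_mul_cons (a b : H) (u v : List H) :
    word R B (a :: u) * word R B (b :: v) =
      pre (Finsupp.single a 1) (word R B u * word R B (b :: v))
      + pre (Finsupp.single b 1) (word R B (a :: u) * word R B v)
      - pre (B.br a b) (word R B u * word R B v) := by
  simp only [word_mul]
  rw [mulWord]

theorem pre_one (a : H) (u : List H) :
    pre (Finsupp.single a 1) (word R B u) = word R B (a :: u) := by
  simp [pre_single]

theorem mulWord_comm (u v : List H) : mulWord R B u v = mulWord R B v u := by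
  induction h : u.length + v.length using Nat.strong_induction_on generalizing u v with
  | _ n ih =>
    cases u with
    | nil => rw [mulWord_nil, mulWord]
    | cons a u =>
      cases v with
      | nil => rw [mulWord_nil, mulWord]
      | cons b v =>
        simp only [List.length_cons] at h
        rw [mulWord, mulWord, ih _ (by simp; omega) u (b :: v) rfl,
          ih _ (by simp; omega) (a :: u) v rfl, ih _ (by omega) u v rfl, B.comm]
        abel

theorem mul_comm' (x y : QSh R B) : x * y = y * x := by
  have : (mul : QSh R B →ₗ[R] _) = mul.flip := by
    refine hom_ext fun u => hom_ext fun v => ?_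
    simp [mul, mulWord_comm u v]
  simp only [mul_def]
  conv_lhs => rw [this]
  rfl

theorem left_distrib' (x y z : QSh R B) : x * (y + z) = x * y + x * z := by
  simp [mul_def]

theorem smul_mul' (r : R) (x y : QSh R B) : (r • x) * y = r • (x * y) := by simp [mul_def]
theorem mul_smul' (r : R) (x y : QSh R B) : x * (r • y) = r • (x * y) := by simp [mul_def]
theorem sub_mul' (x y z : QSh R B) : (x - y) * z = x * z - y * z := by simp [mul_def]
theorem add_mul' (x y z : QSh R B) : (x + y) * z = x * z + y * z := by simp [mul_def]
theorem mul_sub' (x y z : QSh R B) : x * (y - z) = x * y - x * z := by simp [mul_def]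
theorem zero_mul' (x : QSh R B) : 0 * x = 0 := by simp [mul_def]
theorem mul_zero' (x : QSh R B) : x * 0 = 0 := by simp [mul_def]

/-- The bracket extended bilinearly. -/
def brl (B : Bracket K H) : (H →₀ K) →ₗ[K] (H →₀ K) →ₗ[K] (H →₀ K) :=
  Finsupp.linearCombination K fun a => Finsupp.linearCombination K fun b => B.br a b

theorem brl_single (a b : H) :
    brl B (Finsupp.single a 1) (Finsupp.single b 1) = B.br a b := by
  simp [brl]

theorem brl_assoc (a b c : H) :
    brl B (B.br a b) (Finsupp.single c 1) = brl B (Finsupp.single a 1) (B.br b c) := by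
  have h := B.assoc a b c
  have e : ((brl B).flip (Finsupp.single c 1)) =
      Finsupp.linearCombination K (fun d => B.br d c) := by
    refine Finsupp.lhom_ext' fun d => LinearMap.ext_ring ?_
    simp [brl]
  have e' : brl B (Finsupp.single a 1) = Finsupp.linearCombination K (fun d => B.br a d) := by
    simp [brl]
  rw [e', ← h, ← e]
  rfl

theorem pre_mul_pre (α β : H →₀ K) (x y : QSh R B) :
    pre α x * pre β y = pre α (x * pre β y) + pre β (pre α x * y) - pre (brl B α β) (x * y) := by
  induction x using induction with
  | h0 => simp [zero_mul']
  | hadd x x' h h' => simp only [map_add, add_mul', h, h']; abel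
  | hs r u =>
  simp only [map_smul, smul_mul', ← smul_add, ← smul_sub]
  congr 1
  induction y using induction with
  | h0 => simp [mul_zero']
  | hadd x x' h h' => simp only [map_add, left_distrib', h, h']; abel
  | hs r v =>
  simp only [map_smul, mul_smul', ← smul_add, ← smul_sub]
  congr 1
  induction α using Finsupp.induction_linear with
  | zero => 
    have : pre (R := R) (B := B) (0 : H →₀ K) = 0 := by
      simpa using pre_smul (R := R) (B := B) (0 : K) (0 : H →₀ K)
    simp [this, zero_mul']
  | add α α' h h' => 
    simp only [pre_add, map_add, add_mul', LinearMap.add_apply, h, h']; abel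
  | single a k =>
  rw [show Finsupp.single a k = k • Finsupp.single a (1 : K) by simp]
  simp only [pre_smul, map_smul, LinearMap.smul_apply, smul_mul', ← smul_add, ← smul_sub]
  congr 1
  induction β using Finsupp.induction_linear with
  | zero => 
    have : pre (R := R) (B := B) (0 : H →₀ K) = 0 := by
      simpa using pre_smul (R := R) (B := B) (0 : K) (0 : H →₀ K)
    simp [this, mul_zero']
  | add α α' h h' => 
    simp only [pre_add, map_add, left_distrib', LinearMap.add_apply, h, h']; abel
  | single b k =>
  rw [show Finsupp.single b k = k • Finsupp.single b (1 : K) by simp]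
  simp only [pre_smul, map_smul, LinearMap.smul_apply, mul_smul', ← smul_add, ← smul_sub]
  congr 1
  rw [brl_single, pre_one, pre_one, cons_mul_cons]

theorem one_mul' (x : QSh R B) : 1 * x = x := by
  induction x using induction with
  | h0 => exact mul_zero' _
  | hadd x x' h h' => rw [left_distrib', h, h']
  | hs r u => rw [mul_smul', one_def, word_nil_mul]

theorem assoc_step (α β γ : H →₀ K) (x y z : QSh R B)
    (h1 : x * pre β y * pre γ z = x * (pre β y * pre γ z))
    (h2 : pre α x * y * pre γ z = pre α x * (y * pre γ z))
    (h3 : pre α x * pre β y * z = pre α x * (pre β y * z))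
    (h4 : x * y * pre γ z = x * (y * pre γ z))
    (h5 : x * pre β y * z = x * (pre β y * z))
    (h6 : pre α x * y * z = pre α x * (y * z))
    (h7 : x * y * z = x * (y * z))
    (hb : brl B (brl B α β) γ = brl B α (brl B β γ)) :
    pre α x * pre β y * pre γ z = pre α x * (pre β y * pre γ z) := by
  have l : pre α x * pre β y * pre γ z =
      pre α (x * pre β y * pre γ z) + pre β (pre α x * y * pre γ z)
        - pre (brl B α β) (x * y * pre γ z) + pre γ (pre α x * pre β y * z)
        - pre (brl B α γ) (x * pre β y * z) - pre (brl B β γ) (pre α x * y * z)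
        + pre (brl B (brl B α β) γ) (x * y * z) := by
    rw [pre_mul_pre α β x y, sub_mul', add_mul', pre_mul_pre α γ (x * pre β y) z,
      pre_mul_pre β γ (pre α x * y) z, pre_mul_pre (brl B α β) γ (x * y) z,
      sub_mul', add_mul', map_sub, map_add]
    abel
  have r : pre α x * (pre β y * pre γ z) =
      pre α (x * (pre β y * pre γ z)) + pre β (pre α x * (y * pre γ z))
        + pre γ (pre α x * (pre β y * z)) - pre (brl B β γ) (pre α x * (y * z))
        - pre (brl B α β) (x * (y * pre γ z)) - pre (brl B α γ) (x * (pre β y * z))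
        + pre (brl B α (brl B β γ)) (x * (y * z)) := by
    rw [pre_mul_pre β γ y z, mul_sub', left_distrib', pre_mul_pre α β x (y * pre γ z),
      pre_mul_pre α γ x (pre β y * z), pre_mul_pre α (brl B β γ) x (y * z),
      mul_sub', left_distrib', map_sub, map_add]
    abel
  rw [l, r, h1, h2, h3, h4, h5, h6, h7, hb]
  abel

theorem word_assoc (u v w : List H) :
    word R B u * word R B v * word R B w = word R B u * (word R B v * word R B w) := by
  induction h : u.length + v.length + w.length using Nat.strong_induction_on
    generalizing u v w with
  | _ n ih =>
  cases u with
  | nil => rw [← one_def, one_mul', one_mul']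
  | cons a u =>
  cases v with
  | nil => rw [← one_def, one_mul', mul_comm' _ 1, one_mul']
  | cons b v =>
  cases w with
  | nil => rw [← one_def, mul_comm' _ 1, one_mul', mul_comm' _ 1, one_mul']
  | cons c w =>
  simp only [List.length_cons] at h
  have h1 := ih _ (by simp only [List.length_cons]; omega) u (b :: v) (c :: w) rfl
  have h2 := ih _ (by simp only [List.length_cons]; omega) (a :: u) v (c :: w) rfl
  have h3 := ih _ (by simp only [List.length_cons]; omega) (a :: u) (b :: v) w rfl
  have h4 := ih _ (by simp only [List.length_cons]; omega) u v (c :: w) rfl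
  have h5 := ih _ (by simp only [List.length_cons]; omega) u (b :: v) w rfl
  have h6 := ih _ (by simp only [List.length_cons]; omega) (a :: u) v w rfl
  have h7 := ih _ (by omega) u v w rfl
  simp only [← pre_one] at *
  exact assoc_step _ _ _ _ _ _ h1 h2 h3 h4 h5 h6 h7
    (by rw [brl_single, brl_single, brl_assoc])

theorem mul_assoc' (x y z : QSh R B) : x * y * z = x * (y * z) := by
  induction x using induction with
  | h0 => simp only [zero_mul']
  | hadd x x' h h' => simp only [add_mul', h, h']
  | hs r u =>
  simp only [smul_mul']
  congr 1
  induction y using induction with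
  | h0 => simp only [zero_mul', mul_zero']
  | hadd x x' h h' => simp only [add_mul', left_distrib', h, h']
  | hs r v =>
  simp only [smul_mul', mul_smul']
  congr 1
  induction z using induction with
  | h0 => simp only [mul_zero']
  | hadd x x' h h' => simp only [left_distrib', h, h']
  | hs r w => simp only [mul_smul', word_assoc]

instance : CommRing (QSh R B) where
  __ := (inferInstance : AddCommGroup (QSh R B))
  mul := (· * ·)
  one := 1
  mul_assoc := mul_assoc'
  one_mul := one_mul'
  mul_one x := by rw [mul_comm', one_mul']
  left_distrib := left_distrib'
  right_distrib := add_mul'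
  zero_mul := zero_mul'
  mul_zero := mul_zero'
  mul_comm := mul_comm'

instance : Algebra R (QSh R B) := Algebra.ofModule smul_mul' mul_smul'

theorem algebraMap_eq (r : R) : algebraMap R (QSh R B) r = r • word R B [] :=
  Algebra.algebraMap_eq_smul_one r

section back

variable (τ : R →+* R)

theorem coeffwise_pre
    (hτ : ∀ k : K, τ (algebraMap K R k) = algebraMap K R k)
    (α : H →₀ K) (x : QSh R B) :
    semilift τ (word R B) (pre α x) = pre α (semilift τ (word R B) x) := by
  induction x using induction with
  | h0 => simp
  | hadd x y hx hy => simp only [map_add, hx, hy]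
  | hs r u =>
    rw [map_smul, semilift_smul, semilift_smul, map_smul, semilift_word]
    congr 1
    simp only [pre, lift_word, Finsupp.sum, map_sum, semilift_smul_word, hτ]

theorem coeffwise_mulWord
    (hτ : ∀ k : K, τ (algebraMap K R k) = algebraMap K R k)
    (u v : List H) :
    semilift τ (word R B) (mulWord R B u v) = mulWord R B u v := by
  induction h : u.length + v.length using Nat.strong_induction_on generalizing u v with
  | _ n ih =>
    cases u with
    | nil => rw [mulWord, semilift_word]
    | cons a u =>
      cases v with
      | nil => rw [mulWord, semilift_word]
      | cons b v =>
        simp only [List.length_cons] at h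
        rw [mulWord, map_sub, map_add, coeffwise_pre τ hτ, coeffwise_pre τ hτ,
          coeffwise_pre τ hτ, ih _ (by simp; omega) u (b :: v) rfl,
          ih _ (by simp; omega) (a :: u) v rfl, ih _ (by omega) u v rfl]

theorem back_pre (hτ : ∀ k : K, τ (algebraMap K R k) = algebraMap K R k)
    (lam : H → R) (α : H →₀ K) (x : QSh R B) :
    semilift τ (backWord lam) (pre α x) = pre α (semilift τ (word R B) x)
      - (α.sum fun d k => algebraMap K R k * lam d) • semilift τ (word R B) x := by
  induction x using induction with
  | h0 => simp
  | hadd x y hx hy => simp only [map_add, hx, hy, smul_add]; abel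
  | hs r u =>
    rw [map_smul, semilift_smul, semilift_smul, map_smul, semilift_word, smul_comm _ (τ r),
      ← smul_sub]
    congr 1
    simp only [pre, lift_word, Finsupp.sum, map_sum, semilift_smul_word, hτ, backWord,
      smul_sub, Finset.sum_sub_distrib, Finset.sum_smul, mul_smul]

theorem back_mulWord (hτ : ∀ k : K, τ (algebraMap K R k) = algebraMap K R k)
    (lam : H → R)
    (hlam : ∀ a b, lam a * lam b = (B.br a b).sum fun d k => algebraMap K R k * lam d)
    (u v : List H) :
    semilift τ (backWord lam) (mulWord R B u v) =
      backWord (B := B) lam u * backWord lam v := by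
  cases u with
  | nil => rw [mulWord, semilift_word, backWord, ← one_def, one_mul]
  | cons a u =>
    cases v with
    | nil => rw [mulWord, semilift_word, backWord, backWord, ← one_def, mul_one]
    | cons b v =>
      rw [mulWord, map_sub, map_add, back_pre τ hτ, back_pre τ hτ, back_pre τ hτ,
        coeffwise_mulWord τ hτ, coeffwise_mulWord τ hτ, coeffwise_mulWord τ hτ, ← hlam,
        backWord, backWord, mul_sub, sub_mul, sub_mul, mul_smul', smul_mul', mul_smul',
        smul_mul', cons_mul_cons]
      simp only [word_mul, smul_smul, mul_comm (lam b), Finsupp.sum_single_index, map_zero,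
        zero_mul, map_one, one_mul]
      abel

/-- The backward shift of the quasi-shuffle algebra. -/
def back (hτ : ∀ k : K, τ (algebraMap K R k) = algebraMap K R k)
    (lam : H → R)
    (hlam : ∀ a b, lam a * lam b = (B.br a b).sum fun d k => algebraMap K R k * lam d) :
    QSh R B →+* QSh R B where
  __ := semilift τ (backWord lam)
  map_one' := by
    change semilift τ (backWord lam) 1 = 1
    rw [one_def, semilift_word, backWord]
  map_mul' x y := by
    change semilift τ (backWord lam) (x * y) =
      semilift τ (backWord lam) x * semilift τ (backWord lam) y
    induction x using induction with
    | h0 => simp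
    | hadd x x' h h' => simp only [add_mul, map_add, h, h']
    | hs r u =>
    rw [smul_mul', semilift_smul, semilift_smul, smul_mul']
    congr 1
    induction y using induction with
    | h0 => simp
    | hadd x x' h h' => simp only [mul_add, map_add, h, h']
    | hs r v =>
    rw [mul_smul', semilift_smul, semilift_smul, mul_smul']
    congr 1
    rw [word_mul, back_mulWord τ hτ lam hlam, semilift_word, semilift_word]

theorem back_apply (hτ : ∀ k : K, τ (algebraMap K R k) = algebraMap K R k)
    (lam : H → R)
    (hlam : ∀ a b, lam a * lam b = (B.br a b).sum fun d k => algebraMap K R k * lam d)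
    (x : QSh R B) :
    back τ hτ lam hlam x = semilift τ (backWord lam) x := rfl

end back

theorem back_injective (σ : R ≃+* R)
    (hτ : ∀ k : K, (σ.symm : R →+* R) (algebraMap K R k) = algebraMap K R k) (lam : H → R)
    (hlam : ∀ a b, lam a * lam b = (B.br a b).sum fun d k => algebraMap K R k * lam d) :
    Function.Injective (back (σ.symm : R →+* R) hτ lam hlam) := by
  intro x y h
  rw [back_apply, back_apply] at h
  rw [← forw_back σ lam x, h, forw_back]

end basic
end QSh
section construction

set_option linter.unusedSectionVars false

variable (K : Type*) [Field K] [CharZero K] (H : Alphabet)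

theorem exists_bracket (a b : H.letters K) : ∃ r : H.letters K →₀ K,
    Finsupp.linearCombination K (fun h : H.letters K => lamBar h.1) r =
      lamBar a.1 * lamBar b.1 :=
  (Finsupp.mem_span_range_iff_exists_finsupp).1 (mul_mem_span a.2 b.2)

/-- The bracket `[a, b]`: the unique `K`-linear combination of letters that corresponds to the
product of the summands of the letters `a` and `b`. -/
def letterBracket : Bracket K (H.letters K) where
  br a b := (exists_bracket K H a b).choose
  comm a b := by
    refine lamBar_linearIndependent H ?_
    rw [(exists_bracket K H a b).choose_spec, (exists_bracket K H b a).choose_spec, mul_comm]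
  assoc a b c := by
    refine lamBar_linearIndependent H ?_
    have h1 : ∀ r : H.letters K →₀ K, Finsupp.linearCombination K (fun h => lamBar h.1)
        (Finsupp.linearCombination K (fun d => (exists_bracket K H d c).choose) r) =
        Finsupp.linearCombination K (fun h => lamBar h.1) r * lamBar c.1 := by
      intro r
      induction r using Finsupp.induction_linear with
      | zero => simp
      | add x y hx hy => simp only [map_add, hx, hy, add_mul]
      | single d k =>
        simp only [Finsupp.linearCombination_single, map_smul,
          (exists_bracket K H d c).choose_spec, smul_mul_assoc]
    have h2 : ∀ r : H.letters K →₀ K, Finsupp.linearCombination K (fun h => lamBar h.1)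
        (Finsupp.linearCombination K (fun d => (exists_bracket K H a d).choose) r) =
        lamBar a.1 * Finsupp.linearCombination K (fun h => lamBar h.1) r := by
      intro r
      induction r using Finsupp.induction_linear with
      | zero => simp
      | add x y hx hy => simp only [map_add, hx, hy, mul_add]
      | single d k =>
        simp only [Finsupp.linearCombination_single, map_smul,
          (exists_bracket K H a d).choose_spec, mul_smul_comm]
    rw [h1, h2, (exists_bracket K H a b).choose_spec, (exists_bracket K H b c).choose_spec,
      mul_assoc]

theorem letterBracket_spec (a b : H.letters K) :
    lamBar a.1 * lamBar b.1 =
      ((letterBracket K H).br a b).sum fun d k => algebraMap K (RatAlt K) k * lamBar d.1 := by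
  rw [← (exists_bracket K H a b).choose_spec, Finsupp.linearCombination_apply]
  simp only [Algebra.smul_def]
  rfl

/-- The quasi-shuffle algebra `K(n)[x]⟨H⟩`. -/
abbrev QShAlg : Type _ := QSh (RatAlt K) (letterBracket K H)

/-- Nonempty words over the alphabet. -/
abbrev Word : Type _ := {w : List (H.letters K) // w ≠ []}

/-- The polynomial ring over `K(n)[x]` with one variable for each nested sum. -/
abbrev SumRing : Type _ := MvPolynomial (Word K H) (RatAlt K)

variable {K H}

/-- The element that stands for the nested sum of a word; it is `1` for the empty word. -/
def sumVar : List (H.letters K) → SumRing K H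
  | [] => 1
  | a :: u => MvPolynomial.X ⟨a :: u, List.cons_ne_nil a u⟩

/-- The shifted variables: `σ S_{a u} = S_{a u} + σ (lamBar a) σ S_u`. -/
def forwVar : List (H.letters K) → SumRing K H
  | [] => 1
  | a :: u => sumVar (a :: u) + MvPolynomial.C (RatAlt.shift K (lamBar a.1)) * forwVar u

/-- The backward shifted variables: `σ⁻¹ S_{a u} = S_{a u} - lamBar a S_u`. -/
def backVar : List (H.letters K) → SumRing K H
  | [] => 1
  | a :: u => sumVar (a :: u) - MvPolynomial.C (lamBar a.1) * sumVar u

variable (K H)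

/-- The forward shift on the ring of sums, as an endomorphism. -/
def SumRing.forw : SumRing K H →+* SumRing K H :=
  MvPolynomial.eval₂Hom (MvPolynomial.C.comp (RatAlt.shift K : RatAlt K →+* RatAlt K))
    fun w => forwVar w.1

/-- The backward shift on the ring of sums, as an endomorphism. -/
def SumRing.back : SumRing K H →+* SumRing K H :=
  MvPolynomial.eval₂Hom (MvPolynomial.C.comp ((RatAlt.shift K).symm : RatAlt K →+* RatAlt K))
    fun w => backVar w.1

theorem SumRing.forw_sumVar (u : List (H.letters K)) :
    SumRing.forw K H (sumVar u) = forwVar u := by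
  cases u <;> simp [sumVar, forwVar, SumRing.forw]

theorem SumRing.back_sumVar (u : List (H.letters K)) :
    SumRing.back K H (sumVar u) = backVar u := by
  cases u <;> simp [sumVar, backVar, SumRing.back]

theorem SumRing.forw_C (r : RatAlt K) :
    SumRing.forw K H (MvPolynomial.C r) = MvPolynomial.C (RatAlt.shift K r) := by
  simp [SumRing.forw]

theorem SumRing.back_C (r : RatAlt K) :
    SumRing.back K H (MvPolynomial.C r) = MvPolynomial.C ((RatAlt.shift K).symm r) := by
  simp [SumRing.back]

theorem SumRing.back_forwVar (u : List (H.letters K)) :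
    SumRing.back K H (forwVar u) = sumVar u := by
  induction u with
  | nil => simp [forwVar, sumVar]
  | cons a u ih => 
    rw [forwVar, map_add, map_mul, ih, back_sumVar, back_C, backVar, RingEquiv.symm_apply_apply]
    ring

theorem X_eq_sumVar (w : Word K H) : (MvPolynomial.X w : SumRing K H) = sumVar w.1 := by
  obtain ⟨w, hw⟩ := w
  cases w with
  | nil => exact absurd rfl hw
  | cons a u => rfl

theorem SumRing.back_comp_forw :
    (SumRing.back K H).comp (SumRing.forw K H) = RingHom.id _ := by
  refine MvPolynomial.ringHom_ext (fun r => ?_) (fun w => ?_)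
  · simp [forw_C, back_C]
  · simp [X_eq_sumVar, forw_sumVar, back_forwVar]

theorem SumRing.forw_comp_back :
    (SumRing.forw K H).comp (SumRing.back K H) = RingHom.id _ := by
  refine MvPolynomial.ringHom_ext (fun r => ?_) (fun w => ?_)
  · simp [forw_C, back_C]
  · obtain ⟨w, hw⟩ := w
    cases w with
    | nil => exact absurd rfl hw
    | cons a u =>
      simp [X_eq_sumVar, forw_sumVar, back_sumVar, backVar, forwVar, forw_C]

/-- The automorphism `σ` of the ring of sums. -/
def SumRing.shift : SumRing K H ≃+* SumRing K H :=
  RingEquiv.ofRingHom (SumRing.forw K H) (SumRing.back K H) (SumRing.forw_comp_back K H)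
    (SumRing.back_comp_forw K H)

/-- The linearization `L`: a product of sums is sent to the quasi-shuffle product of their words. -/
def linearize : SumRing K H →ₐ[RatAlt K] QShAlg K H :=
  MvPolynomial.aeval fun w => QSh.word (RatAlt K) (letterBracket K H) w.1

theorem linearize_sumVar (u : List (H.letters K)) :
    linearize K H (sumVar u) = QSh.word (RatAlt K) (letterBracket K H) u := by
  cases u <;> simp [sumVar, linearize, QSh.one_def]

/-- The backward shift of the quasi-shuffle algebra. -/
def QShAlg.back : QShAlg K H →+* QShAlg K H :=
  QSh.back ((RatAlt.shift K).symm : RatAlt K →+* RatAlt K)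
    (RatAlt.shift_symm_algebraMap K)
    (fun a => lamBar a.1) (letterBracket_spec K H)

theorem QShAlg.back_injective : Function.Injective (QShAlg.back K H) :=
  QSh.back_injective (RatAlt.shift K) _ _ _

theorem linearize_back (f : SumRing K H) :
    linearize K H (SumRing.back K H f) = QShAlg.back K H (linearize K H f) := by
  have h : ((linearize K H : SumRing K H →+* QShAlg K H)).comp (SumRing.back K H) =
      (QShAlg.back K H).comp (linearize K H : SumRing K H →+* QShAlg K H) := by
    refine MvPolynomial.ringHom_ext (fun r => ?_) (fun w => ?_)
    · have h1 : ∀ r : RatAlt K, linearize K H (MvPolynomial.C r) =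
          r • QSh.word (RatAlt K) (letterBracket K H) [] := fun r => by
        rw [linearize, MvPolynomial.aeval_C, QSh.algebraMap_eq]
      simp only [RingHom.comp_apply, RingHom.coe_coe, SumRing.back_C, h1]
      rw [QShAlg.back, QSh.back_apply, QSh.semilift_smul_word]
      rfl
    · simp only [RingHom.comp_apply, RingHom.coe_coe, X_eq_sumVar, linearize_sumVar,
        SumRing.back_sumVar]
      rw [QShAlg.back, QSh.back_apply, QSh.semilift_word]
      obtain ⟨w, hw⟩ := w
      cases w with
      | nil => exact absurd rfl hw
      | cons a u =>
        rw [backVar, map_sub, map_mul, linearize_sumVar, linearize_sumVar, linearize,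
          MvPolynomial.aeval_C, ← Algebra.smul_def]
        rfl
  exact congrArg (fun g : SumRing K H →+* QShAlg K H => g f) h

/-- The ideal of the relations induced by the quasi-shuffle algebra: the kernel of `L`. -/
def relIdeal : Ideal (SumRing K H) := RingHom.ker (linearize K H)

theorem relIdeal_map : relIdeal K H = (relIdeal K H).map (SumRing.shift K H) := by
  have h : ∀ f, SumRing.back K H f ∈ relIdeal K H ↔ f ∈ relIdeal K H := fun f => by
    rw [relIdeal, RingHom.mem_ker, RingHom.mem_ker, linearize_back,
      map_eq_zero_iff _ (QShAlg.back_injective K H)]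
  ext f
  rw [Ideal.mem_map_of_equiv]
  constructor
  · exact fun hf => ⟨SumRing.back K H f, (h f).2 hf, (SumRing.shift K H).apply_symm_apply f⟩
  · rintro ⟨x, hx, rfl⟩
    rw [← h]
    have : SumRing.back K H (SumRing.shift K H x) = x := (SumRing.shift K H).symm_apply_apply x
    rwa [this]

/-- The reduced difference ring: the ring of sums modulo the quasi-shuffle relations. -/
abbrev RedRing : Type _ := SumRing K H ⧸ relIdeal K H

/-- The automorphism `σ` of the reduced difference ring, induced by that of the ring of sums. -/
def RedRing.shift : RedRing K H ≃+* RedRing K H :=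
  Ideal.quotientEquiv (relIdeal K H) (relIdeal K H) (SumRing.shift K H) (relIdeal_map K H)

theorem RedRing.shift_mk (f : SumRing K H) :
    RedRing.shift K H (Ideal.Quotient.mk _ f) = Ideal.Quotient.mk _ (SumRing.shift K H f) := rfl

end construction

/-- The constants of a difference ring. -/
def constants {A : Type*} [Ring A] (σ : A ≃+* A) : Subring A :=
  RingHom.eqLocus (σ : A →+* A) (RingHom.id A)

section sums

variable {K : Type*} [Field K]

/-- The summand `z ^ i / (a i + b) ^ c`. -/
def lam (l : Letter K) (i : ℕ) : K := l.z ^ i / ((l.a : K) * i + l.b) ^ l.c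

/-- The nested sum `S_{a₁, …, a_k}(n)`; it is `1` for the empty word. -/
def nestedSum {H : Alphabet} : List (H.letters K) → ℕ → K
  | [], _ => 1
  | a :: u, n => ∑ i ∈ Finset.Icc 1 n, lam a.1 i * nestedSum u i

/-- The weight of a word, the sum of the degrees of its letters. -/
def weight {H : Alphabet} (w : List (H.letters K)) : ℕ := (w.map fun a => a.1.c).sum

end sums

section basis

variable (K : Type*) [Field K] [CharZero K] (H : Alphabet)

/-- The `K`-linear combinations of the left-hand sides `L p` of the relations `L p = p` of
weight `d`. Here `p` runs through the products of at least two sums, of total weight `d`; for a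
single sum the relation is trivial. -/
def rowSpace (d : ℕ) : Submodule K (QShAlg K H) :=
  Submodule.span K {v | ∃ m : Multiset (Word K H), 2 ≤ m.card ∧
    (m.map fun w => weight w.1).sum = d ∧
    v = linearize K H (m.map fun w => MvPolynomial.X w).prod}

variable {K H}

/-- Order the sums of each weight `d`, as the columns of the matrix of the coefficients of the
weight `d` sums in the relations. A sum is a corner element of the reduced row echelon form if it
is the leading column of a vector of the row space. -/
def IsCorner (ord : LinearOrder (Word K H)) (w : Word K H) : Prop :=
  ∃ v ∈ rowSpace K H (weight w.1), QSh.coeff v w.1 ≠ 0 ∧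
    ∀ u : Word K H, weight u.1 = weight w.1 → ord.lt u w → QSh.coeff v u.1 = 0

/-- The sums that cannot be reduced by the quasi-shuffle algebra, for a given order of the sums:
those that are not corner elements. -/
def basisSums (ord : LinearOrder (Word K H)) : Set (Word K H) := {w | ¬ IsCorner ord w}

/-- The class in the reduced ring of the variable attached to a nested sum. -/
def RedRing.sum (w : Word K H) : RedRing K H :=
  Ideal.Quotient.mk (relIdeal K H) (MvPolynomial.X w)

end basis

end HSum

end

/-! By construction, `linearize` embeds the reduced ring into the quasi-shuffle algebra `R⟨H⟩`, in
which the words form an `R`-basis. It turns `σ⁻¹` into `QShAlg.back`, which applies `σ⁻¹` to the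
coefficients and sends a word `a u` to `a u - λ̄(a) u`. Working with `σ⁻¹` is convenient because it
removes at most one letter. Two independent arguments take place in `R⟨H⟩`.

Embedding into sequences. Sending `r • w` to the sequence of `r` times `S_w` is a ring homomorphism,
because nested sums obey the quasi-shuffle product at every `n`, and it respects the shifts. Its
kernel is stable under `σ⁻¹` and meets `R` in `0`. The algebra is difference simple
(`eq_bot_of_back_stable`), so the kernel vanishes. Simplicity is proved by taking an element of
minimal length with as few words of that length as possible. Since `R` itself is difference simple,
a leading coefficient can be made `1`; minimality then makes the element invariant, and invariance
yields a nontrivial relation `∑ k_b λ̄(b) = σ(g) - g` with constants `k_b`. This is impossible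
(`eq_zero_of_telescoping`): the poles `-b/a` of the summands lie in `(-1, 0]`, so no pole is an
integer translate of another one, whereas `σ(g) - g` must spread its poles along such translates.
The constants come for free: an invariant element has an eventually constant sequence.

Polynomial structure. The irreducible words generate, since a corner word can be solved for, modulo
products of words of smaller weight, words of smaller weight, and later words of the same weight
(`word_mem_adjoin`). For independence, each irreducible word of weight `d` has a dual functional `e`
that kills words of weight below `d` and decomposables of weight `d` (`exists_dual`).
Deconcatenation is multiplicative for the quasi-shuffle product (`der_mul`), so contracting its left
factor with `e` gives a map `der e` that is a derivation modulo terms of smaller weight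
(`IsPrimitive.leibniz`). On polynomials in words of weight at most `d` it acts as the partial
derivative in the chosen word, so a relation can be differentiated down to nothing in characteristic
`0` (`eq_zero_of_aeval_mem_below`). The weight is only a filtration, because partial fractions of
products of cyclotomic summands produce letters of lower degree; hence the repeated "modulo lower
weight". -/

noncomputable section
namespace HSum

set_option linter.unusedSectionVars false

namespace QSh

/-! ### Coefficients of words, and the filtration by an additive weight (later the degree, and also
the length). -/

section coefficients

variable {R K H : Type*} [CommRing K] [CommRing R] {B : Bracket K H}

theorem coeff_zero (u : List H) : coeff (0 : QSh R B) u = 0 := rfl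

theorem coeff_add (x y : QSh R B) (u : List H) : coeff (x + y) u = coeff x u + coeff y u := rfl

theorem coeff_sub (x y : QSh R B) (u : List H) : coeff (x - y) u = coeff x u - coeff y u := rfl

theorem coeff_smul (r : R) (x : QSh R B) (u : List H) : coeff (r • x) u = r * coeff x u := rfl

theorem coeff_word [DecidableEq (List H)] (u v : List H) :
    coeff (word R B u) v = if u = v then 1 else 0 :=
  Finsupp.single_apply

theorem coeff_word_self (u : List H) : coeff (word R B u) u = 1 := by
  classical simp [coeff_word]

theorem coeff_word_of_ne {u v : List H} (h : u ≠ v) : coeff (word R B u) v = 0 := by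
  classical simp [coeff_word, h]

theorem coeff_ext {x y : QSh R B} (h : ∀ u, coeff x u = coeff y u) : x = y :=
  Finsupp.ext (f := x) (g := y) h

/-- The words that occur in an element. -/
def support (x : QSh R B) : Finset (List H) := Finsupp.support (show List H →₀ R from x)

theorem mem_support {x : QSh R B} {u : List H} : u ∈ support x ↔ coeff x u ≠ 0 :=
  Finsupp.mem_support_iff

theorem sum_coeff_smul_word (x : QSh R B) : ∑ u ∈ support x, coeff x u • word R B u = x := by
  have h := Finsupp.sum_single (show List H →₀ R from x)
  rw [Finsupp.sum] at h
  refine Eq.trans (Finset.sum_congr rfl fun u _ => ?_) h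
  exact (Finsupp.smul_single (coeff x u) u (1 : R)).trans (by simp [coeff])

theorem mem_of_word_mem {x : QSh R B} {N : Submodule R (QSh R B)}
    (h : ∀ u, coeff x u ≠ 0 → word R B u ∈ N) : x ∈ N := by
  rw [← sum_coeff_smul_word x]
  exact N.sum_mem fun u hu => N.smul_mem _ (h u (mem_support.1 hu))

/-- The elements all of whose words have weight less than `N`. -/
def below (R : Type*) [CommRing R] (B : Bracket K H) (wt : H → ℕ) (N : ℕ) :
    Submodule R (QSh R B) :=
  Submodule.span R (word R B '' {u | (u.map wt).sum < N})

variable {wt : H → ℕ}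

theorem word_mem_below {u : List H} {N : ℕ} (h : (u.map wt).sum < N) :
    word R B u ∈ below R B wt N :=
  Submodule.subset_span ⟨u, h, rfl⟩

theorem below_mono {M N : ℕ} (h : M ≤ N) : below R B wt M ≤ below R B wt N :=
  Submodule.span_mono (Set.image_mono fun _ hu => lt_of_lt_of_le hu h)

theorem below_zero : below R B wt 0 = ⊥ := by
  simp [below]

theorem below_le {N : ℕ} {P : Submodule R (QSh R B)}
    (h : ∀ u : List H, (u.map wt).sum < N → word R B u ∈ P) : below R B wt N ≤ P :=
  Submodule.span_le.2 (by rintro _ ⟨u, hu, rfl⟩; exact h u hu)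

theorem coeff_eq_zero_of_mem_below {x : QSh R B} {N : ℕ} (hx : x ∈ below R B wt N) {u : List H}
    (hu : N ≤ (u.map wt).sum) : coeff x u = 0 := by
  have : below R B wt N ≤ LinearMap.ker (Finsupp.lapply u : (List H →₀ R) →ₗ[R] R) :=
    below_le fun v hv => coeff_word_of_ne (R := R) (B := B) (u := v) (by rintro rfl; omega)
  exact this hx

end coefficients

/-! ### Extension of scalars, and compatibility of the product with the weight filtration. -/

section algebra

variable {R K H : Type*} [CommRing K] [CommRing R] [Algebra K R] {B : Bracket K H}

instance : IsScalarTower K R (QSh R B) := inferInstanceAs (IsScalarTower K R (List H →₀ R))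

/-- Extension of scalars, coefficientwise. -/
def extend (R : Type*) [CommRing R] [Algebra K R] : QSh K B →ₗ[K] QSh R B := lift fun u => word R B u

theorem extend_word (u : List H) : extend R (word K B u) = word R B u := lift_word _ u

theorem extend_pre (α : H →₀ K) (x : QSh K B) :
    extend R (pre α x) = pre α (extend R x) := by
  induction x using induction with
  | h0 => simp
  | hadd x y hx hy => simp only [map_add, hx, hy]
  | hs k u =>
    have hr : ∀ y : QSh R B, pre α (k • y) = k • pre α y := fun y => by
      rw [← algebraMap_smul R k y, map_smul, algebraMap_smul]
    rw [map_smul, map_smul, map_smul, hr]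
    congr 1
    simp only [pre, extend_word, lift_word, Finsupp.sum, map_sum, Algebra.algebraMap_self,
      RingHom.id_apply, map_smul, algebraMap_smul]

/-- The structure constants of the quasi-shuffle product lie in `K`. This is what later allows pivot
coefficients to be inverted, although `R` has zero divisors. -/
theorem extend_mulWord (u v : List H) : extend R (mulWord K B u v) = mulWord R B u v := by
  induction h : u.length + v.length using Nat.strong_induction_on generalizing u v with
  | _ n ih =>
    cases u with
    | nil => rw [mulWord, mulWord, extend_word]
    | cons a u =>
      cases v with
      | nil => rw [mulWord, mulWord, extend_word]
      | cons b v =>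
        simp only [List.length_cons] at h
        rw [mulWord, mulWord, map_sub, map_add, extend_pre, extend_pre, extend_pre,
          ih _ (by simp; omega) u (b :: v) rfl, ih _ (by simp; omega) (a :: u) v rfl,
          ih _ (by omega) u v rfl]

theorem smul_mul_smul_scalar (k l : K) (x y : QSh R B) : (k • x) * (l • y) = (k * l) • (x * y) := by
  rw [← algebraMap_smul R k x, ← algebraMap_smul R l y, smul_mul', mul_smul', smul_smul,
    ← map_mul, algebraMap_smul]

theorem extend_mul (x y : QSh K B) : extend R (x * y) = extend R x * extend R y := by
  induction x using induction with
  | h0 => simp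
  | hadd x x' h h' => simp only [add_mul, map_add, h, h']
  | hs k u =>
    induction y using induction with
    | h0 => simp
    | hadd x x' h h' => simp only [mul_add, map_add, h, h']
    | hs l v =>
      rw [smul_mul', mul_smul', smul_smul, map_smul, map_smul, map_smul, smul_mul_smul_scalar,
        word_mul, extend_word, extend_word, word_mul, extend_mulWord]

theorem coeff_extend (x : QSh K B) (u : List H) :
    coeff (extend R x) u = algebraMap K R (coeff x u) := by
  induction x using induction with
  | h0 => simp [coeff_zero]
  | hadd x y hx hy => simp only [map_add, coeff_add, hx, hy]
  | hs k v =>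
    classical
    rw [map_smul, extend_word, ← algebraMap_smul R k, coeff_smul, coeff_smul, coeff_word,
      coeff_word]
    split_ifs <;> simp

variable {wt : H → ℕ}

/-- The bracket does not increase the weight. -/
def Filtered (B : Bracket K H) (wt : H → ℕ) : Prop :=
  ∀ a b d, B.br a b d ≠ 0 → wt d ≤ wt a + wt b

theorem pre_mem_below {α : H →₀ K} {c N : ℕ} (hα : ∀ d, α d ≠ 0 → wt d ≤ c) {x : QSh R B}
    (hx : x ∈ below R B wt N) : pre α x ∈ below R B wt (c + N) := by
  have : below R B wt N ≤ (below R B wt (c + N)).comap (pre α) := below_le fun u hu => by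
    rw [Submodule.mem_comap, pre, lift_word]
    refine Submodule.sum_mem _ fun a ha => Submodule.smul_mem _ _ (word_mem_below ?_)
    have := hα a (Finsupp.mem_support_iff.1 ha)
    simp only [List.map_cons, List.sum_cons]
    omega
  exact this hx

theorem pre_single_mem_below {a : H} {N : ℕ} {x : QSh R B}
    (hx : x ∈ below R B wt N) : pre (Finsupp.single a 1) x ∈ below R B wt (wt a + N) := by
  refine pre_mem_below (fun d hd => ?_) hx
  have : a = d := by
    by_contra h
    exact hd (Finsupp.single_eq_of_ne' h)
  rw [this]

theorem word_mul_word_mem_below (hB : Filtered B wt) (u v : List H) :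
    word R B u * word R B v ∈ below R B wt ((u.map wt).sum + (v.map wt).sum + 1) := by
  induction h : u.length + v.length using Nat.strong_induction_on generalizing u v with
  | _ n ih =>
    cases u with
    | nil =>
      rw [word_nil_mul]
      exact word_mem_below (by simp)
    | cons a u =>
      cases v with
      | nil =>
        rw [word_mul, mulWord_nil]
        exact word_mem_below (by simp)
      | cons b v =>
        simp only [List.length_cons] at h
        have h1 := ih _ (by simp only [List.length_cons]; omega) u (b :: v) rfl
        have h2 := ih _ (by simp only [List.length_cons]; omega) (a :: u) v rfl
        have h3 := ih _ (by omega) u v rfl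
        rw [cons_mul_cons]
        simp only [List.map_cons, List.sum_cons] at h1 h2 ⊢
        refine Submodule.sub_mem _ (Submodule.add_mem _ ?_ ?_) ?_
        · exact below_mono (by omega) (pre_single_mem_below h1)
        · exact below_mono (by omega) (pre_single_mem_below h2)
        · exact below_mono (by omega) (pre_mem_below (hB a b) h3)

/-- The bounds are strict, so the `+ 1` on one factor says "weight at most `M`"; this keeps the sum
of the bounds sharp. -/
theorem mul_mem_below (hB : Filtered B wt) {M N : ℕ} {x y : QSh R B}
    (hx : x ∈ below R B wt (M + 1)) (hy : y ∈ below R B wt N) :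
    x * y ∈ below R B wt (M + N) := by
  have h1 : below R B wt (M + 1) ≤ (below R B wt (M + N)).comap (mul.flip y) :=
    below_le fun u hu => by
      have h2 : below R B wt N ≤ (below R B wt (M + N)).comap (mul (word R B u)) :=
        below_le fun v hv => below_mono (by omega) (word_mul_word_mem_below hB u v)
      exact h2 hy
  exact h1 hx

/-! ### Deconcatenation, and derivations modulo lower weight. -/

/-- The sum of `f p q` over all factorizations `u = p ++ q`. -/
def splitSum {M : Type*} [AddCommGroup M] : (List H → List H → M) → List H → M
  | f, [] => f [] []
  | f, a :: u => f [] (a :: u) + splitSum (fun p q => f (a :: p) q) u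

section splitSum

variable {M : Type*} [AddCommGroup M]

theorem splitSum_add (f g : List H → List H → M) (u : List H) :
    splitSum (fun p q => f p q + g p q) u = splitSum f u + splitSum g u := by
  induction u generalizing f g with
  | nil => rfl
  | cons a u ih => simp only [splitSum, ih]; abel

theorem splitSum_sub (f g : List H → List H → M) (u : List H) :
    splitSum (fun p q => f p q - g p q) u = splitSum f u - splitSum g u := by
  induction u generalizing f g with
  | nil => rfl
  | cons a u ih => simp only [splitSum, ih]; abel

/-- Isolates the factorization with empty prefix, which is the only one that contributes modulo `N`.
-/
theorem splitSum_sub_mem {f : List H → List H → M} {u : List H} {N : AddSubgroup M}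
    (h : ∀ p q, p ++ q = u → p ≠ [] → f p q ∈ N) : splitSum f u - f [] u ∈ N := by
  induction u generalizing f with
  | nil => simp [splitSum, N.zero_mem]
  | cons a u ih =>
    have h1 : splitSum (fun p q => f (a :: p) q) u - f [a] u ∈ N :=
      ih fun p q hpq _ => h (a :: p) q (by simp [hpq]) (by simp)
    have h2 := N.add_mem h1 (h [a] u rfl (by simp))
    simpa [splitSum] using h2

theorem map_splitSum {M' F : Type*} [AddCommGroup M'] [FunLike F M M'] [AddMonoidHomClass F M M']
    (φ : F) (f : List H → List H → M) (u : List H) :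
    φ (splitSum f u) = splitSum (fun p q => φ (f p q)) u := by
  induction u generalizing f with
  | nil => rfl
  | cons a u ih => simp only [splitSum, map_add, ih]

end splitSum

/-- The map `w ↦ ∑ e(p) q` over the factorizations `w = p q`. -/
def der (e : QSh R B →ₗ[R] R) : QSh R B →ₗ[R] QSh R B :=
  lift fun u => splitSum (fun p q => e (word R B p) • word R B q) u

theorem der_word (e : QSh R B →ₗ[R] R) (u : List H) :
    der e (word R B u) = splitSum (fun p q => e (word R B p) • word R B q) u := lift_word _ u

theorem der_cons (e : QSh R B →ₗ[R] R) (a : H) (u : List H) :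
    der e (word R B (a :: u)) = e (word R B []) • word R B (a :: u) +
      der (e ∘ₗ pre (Finsupp.single a 1)) (word R B u) := by
  simp only [der_word, splitSum, LinearMap.comp_apply, pre_one]

theorem der_add (e e' : QSh R B →ₗ[R] R) : der (e + e') = der e + der e' := by
  refine hom_ext fun u => ?_
  simp only [der_word, LinearMap.add_apply, add_smul, splitSum_add]

theorem der_smul (r : R) (e : QSh R B →ₗ[R] R) : der (r • e) = r • der e := by
  refine hom_ext fun u => ?_
  have := map_splitSum (DistribSMul.toAddMonoidHom (QSh R B) r)
    (fun p q => e (word R B p) • word R B q) u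
  simp only [DistribSMul.toAddMonoidHom_apply] at this
  simp only [der_word, LinearMap.smul_apply, this, smul_eq_mul, mul_smul]

/-- This is the recursion `Δ(α x) = 1 ⊗ α x + (α ⊗ 1) Δ(x)` of deconcatenation, contracted with `e`
on the left. -/
theorem der_pre (e : QSh R B →ₗ[R] R) (α : H →₀ K) (x : QSh R B) :
    der e (pre α x) = e (word R B []) • pre α x + der (e ∘ₗ pre α) x := by
  induction α using Finsupp.induction_linear with
  | zero =>
    have h0 : pre (R := R) (B := B) (0 : H →₀ K) = 0 := by
      simpa using pre_smul (R := R) (B := B) (0 : K) (0 : H →₀ K)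
    have h1 : der (0 : QSh R B →ₗ[R] R) = 0 := by
      simpa using der_smul (0 : R) (0 : QSh R B →ₗ[R] R)
    simp [h0, h1]
  | add α β hα hβ =>
    simp only [pre_add, LinearMap.add_apply, map_add, hα, hβ, LinearMap.comp_add, der_add,
      smul_add]
    abel
  | single a k =>
    rw [show Finsupp.single a k = k • Finsupp.single a (1 : K) by simp, pre_smul,
      LinearMap.comp_smul, der_smul, LinearMap.smul_apply, LinearMap.smul_apply, map_smul,
      smul_comm (e _), ← smul_add]
    congr 1
    induction x using induction with
    | h0 => simp
    | hadd x y hx hy => simp only [map_add, hx, hy, smul_add]; abel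
    | hs r u =>
      rw [map_smul, map_smul, map_smul, smul_comm (e _), ← smul_add, pre_one, der_cons]

/-- Deconcatenation is an algebra homomorphism for the quasi-shuffle product: `Δ(u * v) = Δ(u) *
Δ(v)`, contracted with `e`. The induction must let `e` vary, since removing a first letter replaces
`e` by `e ∘ pre`. -/
theorem der_mul (e : QSh R B →ₗ[R] R) (u v : List H) :
    der e (word R B u * word R B v) = splitSum (fun p q => splitSum (fun p' q' =>
      e (word R B p * word R B p') • (word R B q * word R B q')) v) u := by
  induction h : u.length + v.length using Nat.strong_induction_on generalizing u v e with
  | _ n ih =>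
    cases u with
    | nil => simp only [splitSum, word_nil_mul, der_word]
    | cons a u =>
      cases v with
      | nil => simp only [splitSum, word_mul, mulWord_nil, der_word]
      | cons b v =>
        simp only [List.length_cons] at h
        rw [cons_mul_cons, map_sub, map_add, der_pre, der_pre, der_pre,
          ih _ (by simp only [List.length_cons]; omega) _ u (b :: v) rfl,
          ih _ (by simp only [List.length_cons]; omega) _ (a :: u) v rfl,
          ih _ (by omega) _ u v rfl]
        simp only [splitSum, splitSum_add, LinearMap.comp_apply, word_nil_mul, cons_mul_cons,
          map_add, map_sub, add_smul, sub_smul, splitSum_sub, smul_add, smul_sub, pre_one]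
        simp only [word_mul, mulWord_nil, pre_one]
        abel

/-- A prefix that survives `e` has weight at least `d`, so the remaining suffix has lost at least
that much. For `N ≤ d` the truncated bound `0` says that nothing survives. -/
theorem der_mem_below {e : QSh R B →ₗ[R] R} {d : ℕ}
    (he : ∀ w : List H, (w.map wt).sum < d → e (word R B w) = 0) {N : ℕ} {x : QSh R B}
    (hx : x ∈ below R B wt N) : der e x ∈ below R B wt (N - d) := by
  have hs : ∀ p q : List H, ((p ++ q).map wt).sum < N →
      e (word R B p) • word R B q ∈ (below R B wt (N - d)).toAddSubgroup := fun p q hpq => by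
    by_cases hp : (p.map wt).sum < d
    · rw [he p hp, zero_smul]
      exact zero_mem _
    · refine Submodule.smul_mem _ _ (word_mem_below ?_)
      simp only [List.map_append, List.sum_append] at hpq
      omega
  have : below R B wt N ≤ (below R B wt (N - d)).comap (der e) := below_le fun u hu => by
    rw [Submodule.mem_comap, der_word]
    have h1 := splitSum_sub_mem (f := fun p q => e (word R B p) • word R B q) (u := u)
      fun p q hpq _ => hs p q (by rwa [hpq])
    have h2 := AddSubgroup.add_mem _ h1 (hs [] u (by simpa using hu))
    rwa [sub_add_cancel] at h2
  exact this hx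

/-- A functional of weight `d` that vanishes on the decomposable elements, up to lower weight. -/
structure IsPrimitive (wt : H → ℕ) (d : ℕ) (e : QSh R B →ₗ[R] R) : Prop where
  pos : 0 < d
  word_eq_zero : ∀ w : List H, (w.map wt).sum < d → e (word R B w) = 0
  mul_eq_zero : ∀ p q : List H, p ≠ [] → q ≠ [] → (p.map wt).sum + (q.map wt).sum = d →
    e (word R B p * word R B q) = 0

theorem IsPrimitive.eq_zero_of_mem_below {d : ℕ} {e : QSh R B →ₗ[R] R} (he : IsPrimitive wt d e)
    {x : QSh R B} (hx : x ∈ below R B wt d) : e x = 0 := by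
  have : below R B wt d ≤ LinearMap.ker e := below_le fun u hu => he.word_eq_zero u hu
  exact this hx

/-- In `Δ(u) * Δ(v)` the terms with one empty prefix are the two terms of the Leibniz rule. When
both prefixes are nonempty, `e` sees a decomposable element: it vanishes if the prefixes have total
weight at most `d`, and otherwise the suffixes are light. -/
theorem IsPrimitive.leibniz_word (hB : Filtered B wt) {d : ℕ} {e : QSh R B →ₗ[R] R}
    (he : IsPrimitive wt d e) (u v : List H) :
    der e (word R B u * word R B v) - (word R B u * der e (word R B v)
      + der e (word R B u) * word R B v) ∈
      below R B wt ((u.map wt).sum + (v.map wt).sum - d) := by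
  set N := (below R B wt ((u.map wt).sum + (v.map wt).sum - d)).toAddSubgroup
  have e1 : e (word R B []) = 0 := he.word_eq_zero [] (by simpa using he.pos)
  set G : List H → List H → List H → List H → QSh R B := fun p q p' q' =>
    e (word R B p * word R B p') • (word R B q * word R B q') with hG
  have a1 : word R B u * der e (word R B v) = splitSum (fun p' q' => G [] u p' q') v := by
    rw [der_word, ← LinearMap.mulLeft_apply (R := R), map_splitSum]
    simp only [LinearMap.mulLeft_apply, hG, word_nil_mul, mul_smul']
  have a2 : der e (word R B u) * word R B v = splitSum (fun p q => G p q [] v) u := by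
    rw [der_word, ← LinearMap.mulRight_apply (R := R), map_splitSum]
    simp only [LinearMap.mulRight_apply, hG, smul_mul']
    simp only [word_mul _ [], mulWord_nil]
  have key := splitSum_sub_mem (N := N) (u := u)
    (f := fun p q => splitSum (fun p' q' => G p q p' q') v - G p q [] v) fun p q hpq hp => by
      refine splitSum_sub_mem fun p' q' hpq' hp' => ?_
      -- Prefixes of total weight above `d` leave suffixes of total weight strictly below the total
      -- minus `d`, which is the claimed strict bound.
      by_cases h : (p.map wt).sum + (p'.map wt).sum ≤ d
      · have : e (word R B p * word R B p') = 0 := by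
          rcases h.eq_or_lt with h | h
          · exact he.mul_eq_zero p p' hp hp' h
          · exact he.eq_zero_of_mem_below (below_mono h (word_mul_word_mem_below hB p p'))
        simp only [hG, this, zero_smul]
        exact zero_mem _
      · refine Submodule.smul_mem _ _ (below_mono ?_ (word_mul_word_mem_below hB q q'))
        rw [← hpq, ← hpq']
        simp only [List.map_append, List.sum_append]
        omega
  rw [splitSum_sub] at key
  -- The term with both prefixes empty is counted in both halves of the Leibniz rule, but it
  -- vanishes because `e` kills the empty word.
  have e2 : G [] u [] v = 0 := by simp [hG, word_nil_mul, e1]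
  rw [der_mul, a1, a2]
  rw [e2, sub_zero] at key
  have e3 : ∀ x y z : QSh R B, x - (y + z) = x - z - y := fun x y z => by abel
  rw [e3]
  exact key

theorem IsPrimitive.leibniz (hB : Filtered B wt) {d : ℕ} {e : QSh R B →ₗ[R] R}
    (he : IsPrimitive wt d e) {M N : ℕ} {x y : QSh R B} (hx : x ∈ below R B wt (M + 1))
    (hy : y ∈ below R B wt (N + 1)) :
    der e (x * y) - (x * der e y + der e x * y) ∈ below R B wt (M + N - d) := by
  have h2 : ∀ u : List H, (u.map wt).sum < M + 1 → der e (word R B u * y) -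
      (word R B u * der e y + der e (word R B u) * y) ∈ below R B wt (M + N - d) := by
    intro u hu
    induction hy using Submodule.span_induction with
    | mem y hy =>
      obtain ⟨v, hv, rfl⟩ := hy
      rw [Set.mem_ofPred_eq] at hv
      exact below_mono (by omega) (he.leibniz_word hB u v)
    | zero => simp
    | add y z _ _ hy hz =>
      convert add_mem hy hz using 1
      simp only [mul_add, map_add]
      abel
    | smul r y _ hy =>
      convert Submodule.smul_mem _ r hy using 1
      simp only [mul_smul', map_smul, smul_sub, smul_add]
  induction hx using Submodule.span_induction with
  | mem x hx =>
    obtain ⟨u, hu, rfl⟩ := hx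
    exact h2 u hu
  | zero => simp
  | add y z _ _ hy hz =>
    convert add_mem hy hz using 1
    simp only [add_mul, map_add]
    abel
  | smul r y _ hy =>
    convert Submodule.smul_mem _ r hy using 1
    simp only [smul_mul', map_smul, smul_sub, smul_add]

end algebra

/-! ### Algebraic independence of words that have dual primitive functionals. -/

section independence

variable {R K H : Type*} [Field K] [CommRing R] [Algebra K R] {B : Bracket K H} {wt : H → ℕ}

theorem splitSum_eq_last {M : Type*} [AddCommGroup M] {f : List H → List H → M} {u : List H}
    (h : ∀ p q, p ++ q = u → q ≠ [] → f p q = 0) : splitSum f u = f u [] := by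
  induction u generalizing f with
  | nil => rfl
  | cons a u ih =>
    rw [splitSum, ih fun p q hpq hq => h (a :: p) q (by simp [hpq]) hq,
      h [] (a :: u) rfl (by simp), zero_add]

/-- Letters have positive weight, so every proper prefix of `w` has weight below `d` and is killed
by `e`; only the full word remains. -/
theorem IsPrimitive.der_word_eq (hwt : ∀ a, 0 < wt a) {d : ℕ} {e : QSh R B →ₗ[R] R}
    (he : IsPrimitive wt d e) {w : List H} (hw : (w.map wt).sum ≤ d) :
    der e (word R B w) = e (word R B w) • 1 := by
  rw [der_word, splitSum_eq_last, one_def]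
  intro p q hpq hq
  rw [he.word_eq_zero, zero_smul]
  obtain ⟨b, q, rfl⟩ := List.exists_cons_of_ne_nil hq
  have := hwt b
  rw [← hpq] at hw
  simp only [List.map_append, List.sum_append, List.map_cons, List.sum_cons] at hw
  omega

open MvPolynomial

variable {ι : Type*} (x : ι → List H)

/-- The total weight of a monomial in words. -/
abbrev monWeight (wt : H → ℕ) (x : ι → List H) (m : ι →₀ ℕ) : ℕ :=
  Finsupp.weight (fun i => ((x i).map wt).sum) m

theorem aeval_monomial_mem_below (hB : Filtered B wt) (m : ι →₀ ℕ) :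
    aeval (fun i => word R B (x i)) (monomial m (1 : R)) ∈
      below R B wt (monWeight wt x m + 1) := by
  have hone : (1 : QSh R B) ∈ below R B wt (0 + 1) := by
    rw [one_def]
    exact word_mem_below (by simp)
  induction m using Finsupp.induction_linear with
  | zero => simpa using hone
  | add m n hm hn =>
    rw [← mul_one (1 : R), ← monomial_mul, map_mul, monWeight, map_add, add_assoc]
    exact mul_mem_below hB hm hn
  | single i n =>
    induction n with
    | zero => simpa using hone
    | succ n ih =>
      rw [Finsupp.single_add, ← mul_one (1 : R), ← monomial_mul, map_mul, monWeight, map_add,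
        add_assoc]
      refine mul_mem_below hB ih ?_
      rw [← X, aeval_X]
      exact word_mem_below (by simp [Finsupp.weight_apply])

theorem aeval_mem_below (hB : Filtered B wt) {N : ℕ} {P : MvPolynomial ι R}
    (hP : ∀ m ∈ P.support, monWeight wt x m < N) :
    aeval (fun i => word R B (x i)) P ∈ below R B wt N := by
  rw [P.as_sum, map_sum]
  refine Submodule.sum_mem _ fun m hm => ?_
  rw [← mul_one (MvPolynomial.coeff m P), ← smul_eq_mul, ← smul_monomial, map_smul]
  exact Submodule.smul_mem _ _ (below_mono (hP m hm) (aeval_monomial_mem_below x hB m))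

variable {x}

/-- Covers the truncated case of the subtraction: for `N ≤ d` the second factor is already `0`. -/
theorem mul_mem_below_sub (hB : Filtered B wt) {M N d : ℕ} {y z : QSh R B}
    (hy : y ∈ below R B wt (M + 1)) (hz : z ∈ below R B wt (N - d)) :
    y * z ∈ below R B wt (M + N - d) := by
  rcases le_total d N with h | h
  · rw [Nat.add_sub_assoc h]
    exact mul_mem_below hB hy hz
  · rw [Nat.sub_eq_zero_of_le h, below_zero, Submodule.mem_bot] at hz
    rw [hz, mul_zero]
    exact zero_mem _

theorem der_aeval_mul (hB : Filtered B wt) {d : ℕ} {e : QSh R B →ₗ[R] R}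
    (he : IsPrimitive wt d e) {j : ι} {m n : ι →₀ ℕ}
    (hm : der e (aeval (fun i => word R B (x i)) (monomial m (1 : R))) -
      aeval (fun i => word R B (x i)) (pderiv j (monomial m (1 : R))) ∈
      below R B wt (monWeight wt x m - d))
    (hn : der e (aeval (fun i => word R B (x i)) (monomial n (1 : R))) -
      aeval (fun i => word R B (x i)) (pderiv j (monomial n (1 : R))) ∈
      below R B wt (monWeight wt x n - d)) :
    der e (aeval (fun i => word R B (x i)) (monomial (m + n) (1 : R))) -
      aeval (fun i => word R B (x i)) (pderiv j (monomial (m + n) (1 : R))) ∈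
      below R B wt (monWeight wt x (m + n) - d) := by
  have h1 := aeval_monomial_mem_below (R := R) x hB m
  have h2 := aeval_monomial_mem_below (R := R) x hB n
  have h3 := he.leibniz hB h1 h2
  have h4 := mul_mem_below_sub hB h1 hn
  have h5 := mul_mem_below_sub hB h2 hm
  rw [add_comm (monWeight wt x n)] at h5
  have h6 : (monomial (m + n) (1 : R)) = monomial m 1 * monomial n 1 := by
    rw [monomial_mul, mul_one]
  rw [h6, pderiv_mul, map_mul (aeval _), map_add, map_mul (aeval _), map_mul (aeval _), monWeight,
    map_add]
  convert add_mem (add_mem h3 h4) h5 using 1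
  ring

/-- Both `der e` and the formal partial derivative obey the Leibniz rule modulo lower weight, so
agreement on the variables that occur propagates to monomials. -/
theorem der_aeval_monomial (hB : Filtered B wt) {d : ℕ} {e : QSh R B →ₗ[R] R}
    (he : IsPrimitive wt d e) {j : ι} {m : ι →₀ ℕ}
    (hx : ∀ i ∈ m.support, der e (word R B (x i)) =
      aeval (fun i => word R B (x i)) (pderiv j (X i : MvPolynomial ι R))) :
    der e (aeval (fun i => word R B (x i)) (monomial m (1 : R))) -
      aeval (fun i => word R B (x i)) (pderiv j (monomial m (1 : R))) ∈
      below R B wt (monWeight wt x m - d) := by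
  -- Stated through `m = 0` so as to serve both the zero exponent and the exponent `single i 0`.
  have h0 : ∀ m : ι →₀ ℕ, m = 0 →
      der e (aeval (fun i => word R B (x i)) (monomial m (1 : R))) -
      aeval (fun i => word R B (x i)) (pderiv j (monomial m (1 : R))) ∈
      below R B wt (monWeight wt x m - d) := by
    rintro _ rfl
    have : der e (1 : QSh R B) = 0 := by
      rw [one_def, der_word, splitSum, he.word_eq_zero [] (by simpa using he.pos), zero_smul]
    simp [this]
  induction m using Finsupp.induction_linear with
  | zero => exact h0 0 rfl
  | add m n hm hn =>
    refine der_aeval_mul hB he (hm fun i hi => hx i ?_) (hn fun i hi => hx i ?_) <;>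
    · simp only [Finsupp.mem_support_iff, Finsupp.add_apply] at hi ⊢
      omega
  | single i n =>
    induction n with
    | zero => exact h0 _ (by simp)
    | succ n ih =>
      have hi := hx i (by simp)
      rw [Finsupp.single_add]
      refine der_aeval_mul hB he (ih fun k hk => ?_) ?_
      · have : k = i := by
          by_contra hne
          simp [Finsupp.single_eq_of_ne hne] at hk
        rwa [this]
      · rw [← X, aeval_X, hi, sub_self]
        exact zero_mem _

/-- Differentiate the relation with respect to a heaviest variable `j`. The map `der (e j)` lowers
the weight by `d` and acts as `∂/∂j` on the leading part, so `∂P/∂j` satisfies the same hypothesis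
at `N - d` and vanishes by induction. In characteristic `0` this contradicts the occurrence of `j`
in `P`. -/
theorem eq_zero_of_aeval_mem_below [CharZero K] (hB : Filtered B wt) (hwt : ∀ a, 0 < wt a)
    (e : ι → QSh R B →ₗ[R] R)
    (he : ∀ i, IsPrimitive wt ((x i).map wt).sum (e i))
    (hself : ∀ i, e i (word R B (x i)) = 1)
    (hne : ∀ i j, i ≠ j → ((x i).map wt).sum = ((x j).map wt).sum → e i (word R B (x j)) = 0)
    (N : ℕ) (P : MvPolynomial ι R) (hP : ∀ m ∈ P.support, monWeight wt x m = N)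
    (hmem : aeval (fun i => word R B (x i)) P ∈ below R B wt N) : P = 0 := by
  classical
  induction N using Nat.strong_induction_on generalizing P with
  | _ N ih =>
  by_contra hP0
  rcases P.vars.eq_empty_or_nonempty with hv | hv
  · rw [vars_eq_empty_iff_eq_C] at hv
    have hc : P.coeff 0 ≠ 0 := fun h => hP0 (by rw [hv, h, map_zero])
    have hN : N = 0 := by
      rw [← hP 0 (mem_support_iff.2 hc)]
      simp [monWeight]
    rw [hN, below_zero, Submodule.mem_bot, hv, aeval_C, algebraMap_eq] at hmem
    have := congrArg (fun y => QSh.coeff y ([] : List H)) hmem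
    simp only [coeff_smul, coeff_word_self, mul_one, coeff_zero] at this
    exact hc this
  -- Maximality of the weight matters: `der (e j)` sends a word of weight at most `d` to a scalar,
  -- as a partial derivative must, but this fails for heavier words.
  · obtain ⟨j, hj, hmax⟩ := P.vars.exists_max_image (fun i => ((x i).map wt).sum) hv
    set d := ((x j).map wt).sum with hd
    have hder : ∀ i ∈ P.vars, der (e j) (word R B (x i)) =
        aeval (fun i => word R B (x i)) (pderiv j (X i : MvPolynomial ι R)) := by
      intro i hi
      rw [(he j).der_word_eq hwt (hmax i hi)]
      rcases eq_or_ne i j with rfl | hij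
      · rw [hself, pderiv_X_self, map_one, one_smul]
      · rw [pderiv_X_of_ne hij, map_zero]
        rcases (hmax i hi).eq_or_lt with h | h
        · rw [hne j i hij.symm h.symm, zero_smul]
        · rw [(he j).word_eq_zero _ h, zero_smul]
    have hdiff : der (e j) (aeval (fun i => word R B (x i)) P) -
        aeval (fun i => word R B (x i)) (pderiv j P) ∈ below R B wt (N - d) := by
      conv =>
        enter [2]
        rw [P.as_sum]
      simp only [map_sum]
      rw [← Finset.sum_sub_distrib]
      refine Submodule.sum_mem _ fun m hm => ?_
      rw [← mul_one (MvPolynomial.coeff m P), ← smul_eq_mul, ← smul_monomial, map_smul, map_smul,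
        Derivation.map_smul, map_smul, ← smul_sub, ← hP m hm]
      exact Submodule.smul_mem _ _ (der_aeval_monomial hB (he j) fun i hi =>
        hder i ((mem_vars_iff_mem_support i).2 ⟨m, hm, hi⟩))
    have hpd : aeval (fun i => word R B (x i)) (pderiv j P) ∈ below R B wt (N - d) := by
      have := Submodule.sub_mem _ (der_mem_below (he j).word_eq_zero hmem) hdiff
      rwa [sub_sub_cancel] at this
    obtain ⟨m, hm, hmj⟩ := (mem_vars_iff_mem_support j).1 hj
    have hle : Finsupp.single j 1 ≤ m := by
      rw [Finsupp.single_le_iff]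
      exact Nat.one_le_iff_ne_zero.2 (Finsupp.mem_support_iff.1 hmj)
    have hweight : ∀ n : ι →₀ ℕ, monWeight wt x (n + Finsupp.single j 1) =
        monWeight wt x n + d := fun n => by
      rw [monWeight, map_add, Finsupp.weight_single, one_smul]
    have hdN : d ≤ N := by
      rw [← hP m hm, ← tsub_add_cancel_of_le hle, hweight]
      omega
    have hzero : pderiv j P = 0 := by
      refine ih (N - d) ?_ _ (fun n hn => ?_) hpd
      · have := (he j).pos
        omega
      · rw [mem_support_iff, coeff_pderiv] at hn
        have := hP _ (mem_support_iff.2 (left_ne_zero_of_mul hn))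
        rw [hweight] at this
        omega
    have hc := coeff_pderiv (i := j) P (m - Finsupp.single j 1)
    rw [hzero, MvPolynomial.coeff_zero, tsub_add_cancel_of_le hle] at hc
    -- `R` may have zero divisors, so being nonzero would not suffice; the exponent is a nonzero
    -- element of the field `K`, hence a unit of `R`.
    have hu : IsUnit (((m - Finsupp.single j 1 : ι →₀ ℕ) j : R) + 1) := by
      have h1 : ((((m - Finsupp.single j 1 : ι →₀ ℕ) j : ℕ) : K) + 1) ≠ 0 :=
        Nat.cast_add_one_ne_zero _
      have := (IsUnit.mk0 _ h1).map (algebraMap K R)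
      simpa using this
    exact mem_support_iff.1 hm ((hu.mul_left_eq_zero).1 hc.symm)

/-- The part `Q` of top weight of a relation evaluates into lower weight, since it cancels against
the rest of the relation; so it falls under the homogeneous case. -/
theorem algebraicIndependent_word [CharZero K] (hB : Filtered B wt) (hwt : ∀ a, 0 < wt a)
    (e : ι → QSh R B →ₗ[R] R)
    (he : ∀ i, IsPrimitive wt ((x i).map wt).sum (e i))
    (hself : ∀ i, e i (word R B (x i)) = 1)
    (hne : ∀ i j, i ≠ j → ((x i).map wt).sum = ((x j).map wt).sum →
      e i (word R B (x j)) = 0) :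
    AlgebraicIndependent R fun i => word R B (x i) := by
  classical
  rw [algebraicIndependent_iff]
  intro P hP
  by_contra hP0
  obtain ⟨m, hm, hmax⟩ := P.support.exists_max_image (monWeight wt x) (support_nonempty.2 hP0)
  set N := monWeight wt x m
  set Q := weightedHomogeneousComponent (fun i => ((x i).map wt).sum) N P with hQ
  have hcoeff : ∀ n, MvPolynomial.coeff n Q =
      if monWeight wt x n = N then MvPolynomial.coeff n P else 0 := fun n => by
    rw [hQ, coeff_weightedHomogeneousComponent]
  have hlow : aeval (fun i => word R B (x i)) (P - Q) ∈ below R B wt N := by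
    refine aeval_mem_below x hB fun n hn => ?_
    rw [mem_support_iff, MvPolynomial.coeff_sub, hcoeff] at hn
    split_ifs at hn with h
    · simp at hn
    · rw [sub_zero] at hn
      exact lt_of_le_of_ne (hmax n (mem_support_iff.2 hn)) h
  rw [map_sub, hP, zero_sub, neg_mem_iff] at hlow
  have hQ0 : Q = 0 := by
    refine eq_zero_of_aeval_mem_below hB hwt e he hself hne N Q (fun n hn => ?_) hlow
    by_contra h
    rw [mem_support_iff, hcoeff, if_neg h] at hn
    exact hn rfl
  have := hcoeff m
  rw [if_pos rfl, hQ0, MvPolynomial.coeff_zero] at this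
  exact mem_support_iff.1 hm this.symm

end independence
end QSh

/-! ### The degree filtration of the alphabet, and finiteness in each weight. -/

section filtration

variable {K : Type*} [Field K] [CharZero K] {H : Alphabet}

/-- Partial fraction decomposition never raises the total order of the poles. For distinct linear
forms it strictly lowers it, so only the bound `≤` holds and not a grading. -/
theorem lamBar_mul_mem_span {l m : Letter K} (hl : l ∈ H.letters K) (hm : m ∈ H.letters K) :
    lamBar l * lamBar m ∈ Submodule.span K
      ((fun h : H.letters K => lamBar h.1) '' {h | h.1.c ≤ l.c + m.c}) := by
  have hl' := Alphabet.mem_full hl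
  have hm' := Alphabet.mem_full hm
  have hu := linForm_ne_zero (K := K) (b := l.b) hl'.1
  have hv := linForm_ne_zero (K := K) (b := m.b) hm'.1
  have key : lamBar l * lamBar m = signElem (l.z * m.z) * algebraMap (RatFunc K) (RatAlt K)
      ((linForm K l.a l.b ^ l.c * linForm K m.a m.b ^ m.c)⁻¹) := by
    rw [signElem_mul (Alphabet.z_eq hl) (Alphabet.z_eq hm), mul_inv, map_mul, lamBar, lamBar]
    ring
  rw [key]
  by_cases h : l.a = m.a → l.b ≠ m.b
  swap
  · push Not at h
    refine Submodule.subset_span ⟨⟨_, Alphabet.mul_mem hl hm (j := l.c + m.c) ?_⟩, by simp, ?_⟩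
    · have := hl'.2.1
      omega
    · simp only [lamBar, ← h.1, ← h.2, pow_add]
  · have hD : (l.a : K) * m.b - m.a * l.b ≠ 0 := by
      rw [sub_ne_zero]
      exact_mod_cast det_ne_zero hl' hm' h
    set D : K := (l.a : K) * m.b - m.a * l.b with hDdef
    have rel : (algebraMap K (RatFunc K) D) =
        (l.a : RatFunc K) * linForm K m.a m.b - m.a * linForm K l.a l.b := by
      simp only [linForm, hDdef, map_sub, map_mul, map_natCast]
      ring
    have hD' : algebraMap K (RatFunc K) D ≠ 0 := by simpa using hD
    have hc := hl'.2.1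
    -- The degree bound is detached from the exponents, so that it stays fixed while these decrease
    -- in the induction.
    obtain ⟨N, hNe⟩ : ∃ N, N = l.c + m.c := ⟨_, rfl⟩
    rw [← hNe]
    have hN := hNe.ge
    clear hNe
    generalize l.c = c at hc hN ⊢
    generalize m.c = d at hN ⊢
    induction hn : c + d generalizing c d with
    | zero => omega
    | succ n ih =>
    rcases Nat.eq_zero_or_pos d with rfl | hd
    · refine Submodule.subset_span ⟨⟨_, Alphabet.mul_mem hl hm hc⟩, Set.mem_ofPred_eq ▸ hN, ?_⟩
      simp [lamBar]
    obtain ⟨d, rfl⟩ : ∃ d', d = d' + 1 := ⟨d - 1, by omega⟩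
    obtain ⟨c, rfl⟩ : ∃ c', c = c' + 1 := ⟨c - 1, by omega⟩
    -- With `u`, `v` the two linear forms, `D = a_l v - a_m u` is a nonzero constant; dividing by `D
    -- u^(c+1) v^(d+1)` lowers one exponent in each term.
    have e : (linForm K l.a l.b ^ (c + 1) * linForm K m.a m.b ^ (d + 1))⁻¹ =
        (D⁻¹ * l.a : K) • (linForm K l.a l.b ^ (c + 1) * linForm K m.a m.b ^ d)⁻¹
        - (D⁻¹ * m.a : K) • (linForm K l.a l.b ^ c * linForm K m.a m.b ^ (d + 1))⁻¹ := by
      rw [Algebra.smul_def, Algebra.smul_def, map_mul, map_mul, map_inv₀, map_natCast, map_natCast]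
      field_simp
      rw [rel]
      ring
    have hs : ∀ (k : K) (f : RatFunc K), algebraMap (RatFunc K) (RatAlt K) (k • f) =
        k • algebraMap (RatFunc K) (RatAlt K) f := fun k f =>
      map_smul (IsScalarTower.toAlgHom K (RatFunc K) (RatAlt K)) k f
    rw [e, map_sub, mul_sub, hs, hs, mul_smul_comm, mul_smul_comm]
    refine Submodule.sub_mem _ (Submodule.smul_mem _ _ ?_) (Submodule.smul_mem _ _ ?_)
    · exact ih (c + 1) (by omega) d (by omega) (by omega)
    · rcases Nat.eq_zero_or_pos c with rfl | hc'
      · refine Submodule.subset_span ⟨⟨_, Alphabet.mul_mem hm hl (j := d + 1) (by omega)⟩, ?_, ?_⟩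
        · simp only [Set.mem_ofPred_eq]
          omega
        · simp [lamBar, mul_comm]
      · exact ih c hc' (d + 1) (by omega) (by omega)

/-- The degree of a letter of the alphabet. -/
abbrev degree (a : H.letters K) : ℕ := a.1.c

theorem degree_pos (a : H.letters K) : 0 < degree a := (Alphabet.mem_full a.2).2.1

variable (K H) in
theorem letterBracket_filtered : QSh.Filtered (letterBracket K H) degree := by
  intro a b d hd
  obtain ⟨r, hr, hr'⟩ := (Finsupp.mem_span_image_iff_linearCombination K).1
    (lamBar_mul_mem_span a.2 b.2)
  -- The bracket is obtained by choice, so its support is known only through uniqueness of the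
  -- expansion.
  have : (letterBracket K H).br a b = r := by
    refine lamBar_linearIndependent H ?_
    rw [hr']
    exact (exists_bracket K H a b).choose_spec
  rw [this] at hd
  exact (Finsupp.mem_supported K r).1 hr (Finsupp.mem_support_iff.2 hd)

theorem weight_eq (w : List (H.letters K)) : weight w = (w.map degree).sum := rfl

theorem weight_pos (w : Word K H) : 0 < weight w.1 := by
  obtain ⟨w, hw⟩ := w
  obtain ⟨a, u, rfl⟩ := List.exists_cons_of_ne_nil hw
  have := degree_pos a
  rw [weight_eq]
  simp only [List.map_cons, List.sum_cons]
  omega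

/-- Finiteness of `M` bounds `a`, then `b < a` bounds `b`, and `z` is a sign. -/
theorem finite_letters (H : Alphabet) (d : ℕ) : {a : H.letters K | degree a ≤ d}.Finite := by
  obtain ⟨N, hN⟩ : ∃ N, ∀ a ∈ H.letters K, a.a ≤ N := by
    cases H with
    | harmonic => exact ⟨1, fun a ha => ha.2.1.le⟩
    | alternating => exact ⟨1, fun a ha => ha.2.1.le⟩
    | cyclotomic M => exact ⟨M.sup id, fun a ha => Finset.le_sup (f := id) ha.2.1⟩
  refine Set.Finite.of_finite_image (f := fun a => (a.1.a, a.1.b, a.1.c, a.1.z)) ?_ ?_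
  · refine ((Set.finite_Iic N).prod ((Set.finite_Iic N).prod ((Set.finite_Iic d).prod
      (Set.toFinite {1, -1})))).subset ?_
    rintro _ ⟨a, ha, rfl⟩
    have h1 := hN _ a.2
    have h2 := (Alphabet.mem_full a.2).2.2.1
    have h3 := Alphabet.z_eq a.2
    exact ⟨h1, (h2.le.trans h1 : _), ha, h3⟩
  · rintro ⟨⟨a, b, c, z⟩, ha⟩ - ⟨⟨a', b', c', z'⟩, ha'⟩ - h
    simpa using h

theorem finite_words_of_weight (H : Alphabet) (d : ℕ) :
    {w : List (H.letters K) | weight w ≤ d}.Finite := by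
  induction d using Nat.strong_induction_on with
  | _ d ih =>
  have h1 : (⋃ a ∈ {a : H.letters K | degree a ≤ d}, (List.cons a) ''
      {w : List (H.letters K) | weight w ≤ d - degree a ∧ 0 < d}).Finite := by
    refine (finite_letters H d).biUnion fun a _ => Set.Finite.image _ ?_
    rcases Nat.eq_zero_or_pos d with rfl | hd
    · simp
    · have := degree_pos a
      exact (ih (d - degree a) (by omega)).subset fun w hw => hw.1
  refine (h1.insert []).subset fun w hw => ?_
  cases w with
  | nil => exact Set.mem_insert _ _
  | cons a u =>
    have := degree_pos a
    simp only [weight, List.map_cons, List.sum_cons, Set.mem_ofPred_eq] at hw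
    change degree a + _ ≤ d at hw
    refine Set.mem_insert_of_mem _ (Set.mem_biUnion (x := a) ?_ ⟨u, ⟨?_, ?_⟩, rfl⟩)
    · simp only [Set.mem_ofPred_eq]
      omega
    · simp only [weight]
      omega
    · omega

end filtration

/-! ### The irreducible words generate the quasi-shuffle algebra freely. -/

section basis

open QSh

variable {K : Type*} [Field K] [CharZero K] {H : Alphabet}

theorem linearize_X (w : Word K H) :
    linearize K H (MvPolynomial.X w) = word (RatAlt K) (letterBracket K H) w.1 := by
  rw [X_eq_sumVar, linearize_sumVar]

theorem linearize_prod_mem_range (m : Multiset (Word K H)) :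
    linearize K H (m.map fun w => MvPolynomial.X w).prod ∈
      LinearMap.range (extend (RatAlt K) : QSh K (letterBracket K H) →ₗ[K] QShAlg K H) := by
  induction m using Multiset.induction with
  | empty => exact ⟨1, by simp [one_def, extend_word]⟩
  | cons w m ih =>
    obtain ⟨y, hy⟩ := ih
    refine ⟨word K _ w.1 * y, ?_⟩
    rw [extend_mul, hy, extend_word, Multiset.map_cons, Multiset.prod_cons, map_mul, linearize_X]

theorem linearize_prod_mem_below (m : Multiset (Word K H)) :
    linearize K H (m.map fun w => MvPolynomial.X w).prod ∈
      below (RatAlt K) (letterBracket K H) degree ((m.map fun w => weight w.1).sum + 1) := by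
  induction m using Multiset.induction with
  | empty =>
    simp only [Multiset.map_zero, Multiset.prod_zero, map_one, one_def]
    exact word_mem_below (by simp)
  | cons w m ih =>
    simp only [Multiset.map_cons, Multiset.prod_cons, Multiset.sum_cons]
    rw [map_mul, linearize_X, add_assoc]
    exact mul_mem_below (letterBracket_filtered K H)
      (word_mem_below (by rw [← weight_eq]; omega)) ih

theorem exists_extend_eq_of_mem_rowSpace {d : ℕ} {v : QShAlg K H} (hv : v ∈ rowSpace K H d) :
    ∃ y : QSh K (letterBracket K H), extend (RatAlt K) y = v := by
  have : rowSpace K H d ≤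
      LinearMap.range (extend (RatAlt K) : QSh K (letterBracket K H) →ₗ[K] QShAlg K H) := by
    refine Submodule.span_le.2 ?_
    rintro _ ⟨m, -, -, rfl⟩
    exact linearize_prod_mem_range m
  exact this hv

theorem mem_below_of_mem_rowSpace {d : ℕ} {v : QShAlg K H} (hv : v ∈ rowSpace K H d) :
    v ∈ below (RatAlt K) (letterBracket K H) degree (d + 1) := by
  have : rowSpace K H d ≤
      (below (RatAlt K) (letterBracket K H) degree (d + 1)).restrictScalars K := by
    refine Submodule.span_le.2 ?_
    rintro _ ⟨m, -, rfl, rfl⟩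
    exact linearize_prod_mem_below m
  exact this hv

theorem word_mul_word_mem_rowSpace (p q : Word K H) :
    word (RatAlt K) (letterBracket K H) p.1 * word (RatAlt K) (letterBracket K H) q.1 ∈
      rowSpace K H (weight p.1 + weight q.1) :=
  Submodule.subset_span ⟨{p, q}, by simp, by simp, by simp [linearize_X]⟩

/-- The combinations of words over `K` that are relations of weight `d` up to words of other
weights. -/
def relationSpace (K : Type*) [Field K] [CharZero K] (H : Alphabet) (d : ℕ) :
    Submodule K (QSh K (letterBracket K H)) :=
  (rowSpace K H d).comap (extend (RatAlt K)) ⊔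
    Submodule.span K (word K (letterBracket K H) '' {w | weight w ≠ d})

/-- If a nontrivial combination of irreducible words of weight `d` agreed with a relation at the
words of weight `d`, its least word would be a leading column, that is, a corner. -/
theorem basisSums_linearIndependent (ord : LinearOrder (Word K H)) (d : ℕ) :
    LinearIndependent K fun w : {w : Word K H // w ∈ basisSums ord ∧ weight w.1 = d} =>
      (relationSpace K H d).mkQ (word K (letterBracket K H) w.1.1) := by
  classical
  rw [linearIndependent_iff]
  intro l hl
  by_contra hl0
  obtain ⟨w, hw, hmin⟩ := l.support.exists_min_image (fun w => w.1)
    (Finsupp.support_nonempty_iff.2 hl0)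
  have hl' : (relationSpace K H d).mkQ
      (Finsupp.linearCombination K (fun w : {w : Word K H // w ∈ basisSums ord ∧
        weight w.1 = d} => word K (letterBracket K H) w.1.1) l) = 0 := by
    rw [← hl, Finsupp.apply_linearCombination]
    rfl
  set s := Finsupp.linearCombination K (fun w : {w : Word K H // w ∈ basisSums ord ∧
        weight w.1 = d} => word K (letterBracket K H) w.1.1) l with hs
  have hcoeff : ∀ u, coeff s u = ∑ i ∈ l.support, l i * coeff (word K (letterBracket K H) i.1.1) u :=
    fun u => by
      rw [hs, Finsupp.linearCombination_apply, Finsupp.sum]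
      exact Finsupp.finsetSum_apply _ _ u
  rw [Submodule.mkQ_apply, Submodule.Quotient.mk_eq_zero, relationSpace,
    Submodule.mem_sup] at hl'
  obtain ⟨y, hy, z, hz, hyz⟩ := hl'
  have hz0 : ∀ u : List (H.letters K), weight u = d → coeff z u = 0 := by
    intro u hu
    have : Submodule.span K (word K (letterBracket K H) '' {w | weight w ≠ d}) ≤
        LinearMap.ker (Finsupp.lapply u : (List (H.letters K) →₀ K) →ₗ[K] K) := by
      refine Submodule.span_le.2 ?_
      rintro _ ⟨v, hv, rfl⟩
      exact coeff_word_of_ne (R := K) (B := letterBracket K H) (u := v)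
        (by rintro rfl; exact hv hu)
    exact this hz
  have hyc : ∀ u : List (H.letters K), weight u = d →
      coeff (extend (RatAlt K) y) u = algebraMap K (RatAlt K) (coeff s u) := by
    intro u hu
    rw [coeff_extend, ← hyz, coeff_add, hz0 u hu, add_zero]
  refine w.2.1 ⟨extend (RatAlt K) y, ?_, ?_, ?_⟩
  · rw [w.2.2]
    exact hy
  · rw [hyc _ w.2.2, hcoeff, Finset.sum_eq_single w]
    · rw [coeff_word_self, mul_one]
      exact fun h => Finsupp.mem_support_iff.1 hw
        ((algebraMap K (RatAlt K)).injective (h.trans (map_zero _).symm))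
    · intro i _ hi
      rw [coeff_word_of_ne (R := K) (B := letterBracket K H) (u := i.1.1) (v := w.1.1)
        fun h => hi (Subtype.ext (Subtype.ext h)), mul_zero]
    · exact fun h => absurd hw h
  · intro u hu huw
    rw [w.2.2] at hu
    rw [hyc _ hu, hcoeff, Finset.sum_eq_zero, map_zero]
    intro i hi
    rw [coeff_word_of_ne, mul_zero]
    intro h
    have h1 : i.1 = u := Subtype.ext h
    exact not_lt_of_ge (hmin i hi) (h1 ▸ huw)

/-- The coordinate functional of `w` on the span of the irreducible classes extends to the whole
quotient by `relationSpace`. Factoring through that quotient makes it kill products of weight `d`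
and words of every other weight. The construction is done over the field `K` and then extended to
`R`. -/
theorem exists_dual (ord : LinearOrder (Word K H)) (w : basisSums ord) :
    ∃ e : QShAlg K H →ₗ[RatAlt K] RatAlt K, IsPrimitive degree (weight w.1.1) e ∧
      e (word _ _ w.1.1) = 1 ∧
      ∀ w' : basisSums ord, w ≠ w' → weight w.1.1 = weight w'.1.1 → e (word _ _ w'.1.1) = 0 := by
  classical
  set d := weight w.1.1 with hd
  have hli := basisSums_linearIndependent ord d
  obtain ⟨g, hg⟩ := LinearMap.exists_extend ((Finsupp.lapply (R := K) (M := K)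
    (⟨w.1, w.2, rfl⟩ : {w : Word K H // w ∈ basisSums ord ∧ weight w.1 = d})) ∘ₗ hli.repr)
  have hgv : ∀ i : {w : Word K H // w ∈ basisSums ord ∧ weight w.1 = d},
      g ((relationSpace K H d).mkQ (word K (letterBracket K H) i.1.1)) =
        Finsupp.single i (1 : K) ⟨w.1, w.2, rfl⟩ := fun i => by
    have h1 := LinearMap.congr_fun hg
      ⟨(relationSpace K H d).mkQ (word K (letterBracket K H) i.1.1),
        Submodule.subset_span ⟨i, rfl⟩⟩
    rw [LinearMap.comp_apply, LinearMap.comp_apply,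
      hli.repr_eq_single i _ rfl] at h1
    exact h1
  set e₀ : QSh K (letterBracket K H) →ₗ[K] K := g ∘ₗ (relationSpace K H d).mkQ with he₀
  have hker : ∀ y ∈ relationSpace K H d, e₀ y = 0 := fun y hy => by
    rw [he₀, LinearMap.comp_apply, Submodule.mkQ_apply,
      (Submodule.Quotient.mk_eq_zero _).2 hy, map_zero]
  set e : QShAlg K H →ₗ[RatAlt K] RatAlt K :=
    lift fun u => algebraMap K (RatAlt K) (e₀ (word K _ u)) with he
  have hext : ∀ y, e (extend (RatAlt K) y) = algebraMap K (RatAlt K) (e₀ y) := fun y => by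
    induction y using QSh.induction with
    | h0 => simp
    | hadd x y hx hy => simp only [map_add, hx, hy]
    | hs k u =>
      rw [map_smul, extend_word, ← algebraMap_smul (RatAlt K) k, map_smul, he, lift_word,
        map_smul, smul_eq_mul, smul_eq_mul, map_mul]
  have hword : ∀ u, e (word _ _ u) = algebraMap K (RatAlt K) (e₀ (word K _ u)) := fun u => by
    rw [← hext, extend_word]
  refine ⟨e, ⟨weight_pos _, ?_, ?_⟩, ?_, ?_⟩
  · intro u hu
    rw [hword, hker, map_zero]
    exact Submodule.mem_sup_right (Submodule.subset_span ⟨u, hu.ne, rfl⟩)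
  · intro p q hp hq hpq
    have : word (RatAlt K) (letterBracket K H) p * word (RatAlt K) (letterBracket K H) q =
        extend (RatAlt K) (word K _ p * word K _ q) := by
      rw [extend_mul, extend_word, extend_word]
    rw [this, hext, hker, map_zero]
    refine Submodule.mem_sup_left ?_
    rw [Submodule.mem_comap, ← this, ← hpq]
    exact word_mul_word_mem_rowSpace ⟨p, hp⟩ ⟨q, hq⟩
  · rw [hword, he₀, LinearMap.comp_apply, hgv ⟨w.1, w.2, rfl⟩, Finsupp.single_eq_same, map_one]
  · intro w' hne hw'
    rw [hword, he₀, LinearMap.comp_apply, hgv ⟨w'.1, w'.2, hw'.symm⟩, Finsupp.single_eq_of_ne,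
      map_zero]
    exact fun h => hne (Subtype.ext (Subtype.mk.inj h))

theorem basisSums_algebraicIndependent (ord : LinearOrder (Word K H)) :
    AlgebraicIndependent (RatAlt K)
      fun w : basisSums ord => word (RatAlt K) (letterBracket K H) w.1.1 := by
  choose e he hself hne using exists_dual ord
  exact algebraicIndependent_word (letterBracket_filtered K H) degree_pos e he hself hne

/-- Gaussian elimination: a relation with leading word `w` expresses `w` through products of lighter
words, lighter words, and later words of the same weight. The induction runs on the weight, and
inside a weight downwards along the order. -/
theorem word_mem_adjoin (ord : LinearOrder (Word K H)) (u : List (H.letters K)) :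
    word (RatAlt K) (letterBracket K H) u ∈ Algebra.adjoin (RatAlt K)
      (Set.range fun w : basisSums ord => word (RatAlt K) (letterBracket K H) w.1.1) := by
  set A := Algebra.adjoin (RatAlt K)
      (Set.range fun w : basisSums ord => word (RatAlt K) (letterBracket K H) w.1.1)
  induction hd : weight u using Nat.strong_induction_on generalizing u with
  | _ d ih =>
  rcases eq_or_ne u [] with rfl | hu
  · exact A.one_mem
  have hrow : ∀ v ∈ rowSpace K H d, v ∈ A := by
    have : rowSpace K H d ≤ (Subalgebra.toSubmodule A).restrictScalars K := by
      refine Submodule.span_le.2 ?_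
      rintro _ ⟨m, hm2, hmd, rfl⟩
      rw [map_multiset_prod, Multiset.map_map]
      refine Subalgebra.multiset_prod_mem A fun y hy => ?_
      obtain ⟨w, hw, rfl⟩ := Multiset.mem_map.1 hy
      rw [Function.comp_apply, linearize_X]
      refine ih _ ?_ w.1 rfl
      -- Each factor of a product with at least two factors is strictly lighter than `d`, since the
      -- other factors have positive weight.
      obtain ⟨m', rfl⟩ := Multiset.exists_cons_of_mem hw
      obtain ⟨w', hw'⟩ : ∃ w', w' ∈ m' := by
        refine Multiset.exists_mem_of_ne_zero ?_
        rintro rfl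
        simp at hm2
      obtain ⟨m'', rfl⟩ := Multiset.exists_cons_of_mem hw'
      have := weight_pos w'
      simp only [Multiset.map_cons, Multiset.sum_cons] at hmd
      omega
    exact fun v hv => this hv
  have hfin : {w : Word K H | weight w.1 = d}.Finite :=
    Set.Finite.of_finite_image
      ((finite_words_of_weight (K := K) H d).subset (by rintro _ ⟨w, hw, rfl⟩; exact le_of_eq hw))
      Subtype.val_injective.injOn
  suffices h : ∀ w : Word K H, weight w.1 = d → word (RatAlt K) (letterBracket K H) w.1 ∈ A from
    h ⟨u, hu⟩ hd
  have : Finite {w : Word K H // weight w.1 = d} := hfin.to_subtype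
  intro w hw
  -- The order is arbitrary; the reversed order is well founded because there are finitely many
  -- words of weight `d`.
  have hind := (Finite.wellFounded_of_trans_of_irrefl
    (fun x y : {w : Word K H // weight w.1 = d} => ord.lt y.1 x.1)).induction
    (C := fun w => word (RatAlt K) (letterBracket K H) w.1.1 ∈ A) ⟨w, hw⟩
  refine hind ?_
  clear hind hw w
  rintro ⟨w, hw⟩ hlt
  by_cases hcorner : IsCorner ord w
  swap
  · exact Algebra.subset_adjoin ⟨⟨w, hcorner⟩, rfl⟩
  obtain ⟨v, hv, hvw, hvlt⟩ := hcorner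
  rw [hw] at hv
  obtain ⟨y, rfl⟩ := exists_extend_eq_of_mem_rowSpace hv
  have hbelow := mem_below_of_mem_rowSpace hv
  have hrest : extend (RatAlt K) y - coeff (extend (RatAlt K) y) w.1 •
      word (RatAlt K) (letterBracket K H) w.1 ∈ Subalgebra.toSubmodule A := by
    refine mem_of_word_mem fun u hu => ?_
    rw [Subalgebra.mem_toSubmodule]
    rw [coeff_sub, coeff_smul] at hu
    by_cases huw : u = w.1
    · rw [huw, coeff_word_self, mul_one, sub_self] at hu
      exact absurd rfl hu
    rw [coeff_word_of_ne (Ne.symm huw), mul_zero, sub_zero] at hu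
    rcases lt_trichotomy (weight u) d with h | h | h
    · exact ih _ h u rfl
    · have hu0 : u ≠ [] := by
        rintro rfl
        have := weight_pos w
        simp [weight] at h
        omega
      refine hlt ⟨⟨u, hu0⟩, h⟩ ?_
      rcases lt_trichotomy w ⟨u, hu0⟩ with h' | h' | h'
      · exact h'
      · exact absurd (congrArg Subtype.val h').symm huw
      · exact absurd (hvlt ⟨u, hu0⟩ (h.trans hw.symm) h') hu
    · exact absurd (coeff_eq_zero_of_mem_below hbelow h) hu
  have hmem := A.sub_mem (hrow _ hv) hrest
  rw [sub_sub_cancel, coeff_extend] at hmem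
  rw [coeff_extend] at hvw
  -- The leading coefficient lies in `K`, so it can be inverted.
  have hk : coeff y w.1 ≠ 0 := fun h => hvw (by rw [h, map_zero])
  have := A.smul_mem hmem (algebraMap K (RatAlt K) (coeff y w.1)⁻¹)
  rwa [smul_smul, ← map_mul, inv_mul_cancel₀ hk, map_one, one_smul] at this

theorem adjoin_basisSums (ord : LinearOrder (Word K H)) :
    Algebra.adjoin (RatAlt K)
      (Set.range fun w : basisSums ord => word (RatAlt K) (letterBracket K H) w.1.1) = ⊤ := by
  refine top_unique fun x _ => ?_
  rw [← Subalgebra.mem_toSubmodule]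
  exact mem_of_word_mem fun u _ => word_mem_adjoin ord u

end basis

/-! ### The coefficient ring `K(n)[x]`: difference simplicity, evaluation and constants. -/

section ratAlt

variable {K : Type*} [Field K] [CharZero K]

/-- `K(n)[x]` is a product of two fields, cut out by the idempotents `(1 ± x)/2`, and the shift
exchanges them. A nonzero ideal contains `1 + x` or `1 - x`; stability yields the other one, and
their sum is `2`. -/
theorem RatAlt.one_mem_of_stable (I : Ideal (RatAlt K))
    (hI : ∀ f ∈ I, (RatAlt.shift K).symm f ∈ I) {f : RatAlt K} (hf : f ∈ I) (h0 : f ≠ 0) :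
    (1 : RatAlt K) ∈ I := by
  have h2 : (2 : RatFunc K) ≠ 0 := two_ne_zero
  have s1 : (RatAlt.shift K).symm ⟨1, 1⟩ = ⟨1, -1⟩ := by
    rw [RingEquiv.symm_apply_eq]
    ext <;> simp [RatAlt.shift]
  have s2 : (RatAlt.shift K).symm ⟨1, -1⟩ = ⟨1, 1⟩ := by
    rw [RingEquiv.symm_apply_eq]
    ext <;> simp [RatAlt.shift]
  have both : (⟨1, 1⟩ : RatAlt K) ∈ I → (⟨1, -1⟩ : RatAlt K) ∈ I → (1 : RatAlt K) ∈ I := by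
    intro h h'
    have := I.mul_mem_left (⟨2⁻¹, 0⟩ : RatAlt K) (I.add_mem h h')
    convert this using 1
    ext
    · simp [QuadraticAlgebra.re_one]
      field_simp
      norm_num
    · simp [QuadraticAlgebra.im_one]
  by_cases h : f.re + f.im = 0
  · have h' : f.re - f.im ≠ 0 := by
      intro h'
      apply h0
      have e1 : (2 : RatFunc K) * f.re = 0 := by linear_combination h + h'
      have e2 : (2 : RatFunc K) * f.im = 0 := by linear_combination h - h'
      ext
      · simpa [h2] using e1
      · simpa [h2] using e2
    have hm : (⟨1, -1⟩ : RatAlt K) ∈ I := by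
      -- Uses `(1 - x) (f₀ + f₁ x) = (f₀ - f₁) (1 - x)`; the other case uses the analogue for `1 +
      -- x`.
      have := I.mul_mem_left (⟨(f.re - f.im)⁻¹, -(f.re - f.im)⁻¹⟩ : RatAlt K) hf
      convert this using 1
      ext
      · simp
        field_simp
        ring
      · simp
        field_simp
        ring
    have hm' := hI _ hm
    rw [s2] at hm'
    exact both hm' hm
  · have hm : (⟨1, 1⟩ : RatAlt K) ∈ I := by
      have := I.mul_mem_left (⟨(f.re + f.im)⁻¹, (f.re + f.im)⁻¹⟩ : RatAlt K) hf
      convert this using 1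
      ext
      · simp
        field_simp
      · simp
        field_simp
        ring
    have hm' := hI _ hm
    rw [s1] at hm'
    exact both hm hm'

theorem toSeq_add (s t : ℕ → K) : toSeq (fun n => s n + t n) = toSeq s + toSeq t := rfl

theorem toSeq_mul (s t : ℕ → K) : toSeq (fun n => s n * t n) = toSeq s * toSeq t := rfl

theorem RatAlt.toSeqHom_apply (f : RatAlt K) : RatAlt.toSeqHom K f = toSeq f.ev := rfl

theorem RatAlt.toSeqHom_x : RatAlt.toSeqHom K (RatAlt.x K) = toSeq fun k => (-1) ^ k := by
  rw [toSeqHom_apply]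
  congr 1
  funext k
  simp [RatAlt.ev, RatAlt.x, RatFunc.eval_zero]

theorem RatAlt.toSeqHom_algebraMap_X :
    RatAlt.toSeqHom K (algebraMap (RatFunc K) (RatAlt K) RatFunc.X) = toSeq fun k => (k : K) := by
  rw [toSeqHom_apply]
  congr 1
  funext k
  simp [RatAlt.ev, QuadraticAlgebra.algebraMap_eq, RatFunc.eval_zero]

theorem RatAlt.toSeqHom_algebraMap (c : K) :
    RatAlt.toSeqHom K (algebraMap K (RatAlt K) c) = toSeq fun _ => c := by
  rw [toSeqHom_apply, IsScalarTower.algebraMap_apply K (RatFunc K) (RatAlt K)]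
  congr 1
  funext k
  simp [RatAlt.ev, QuadraticAlgebra.algebraMap_eq, RatFunc.eval_zero]

theorem RatAlt.eq_algebraMap_add (f : RatAlt K) : f = algebraMap (RatFunc K) (RatAlt K) f.re +
    algebraMap (RatFunc K) (RatAlt K) f.im * RatAlt.x K := by
  ext <;> simp [RatAlt.x, QuadraticAlgebra.algebraMap_eq]

theorem RatAlt.shift_algebraMap_ratFunc (f : RatFunc K) :
    RatAlt.shift K (algebraMap (RatFunc K) (RatAlt K) f) =
      algebraMap (RatFunc K) (RatAlt K) (ratShift K f) := by
  ext <;> simp [RatAlt.shift, QuadraticAlgebra.algebraMap_eq]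

theorem RatAlt.shift_x : RatAlt.shift K (RatAlt.x K) = -RatAlt.x K := by
  ext <;> simp [RatAlt.shift, RatAlt.x]

/-- A ring homomorphism out of `K(n)[x]` is determined by its values on `K`, `n` and `x`, where the
claim is immediate. -/
theorem RatAlt.toSeqHom_shift (f : RatAlt K) :
    RatAlt.toSeqHom K (RatAlt.shift K f) = SeqRing.shift K (RatAlt.toSeqHom K f) := by
  have h : ((RatAlt.toSeqHom K).comp (algebraMap (RatFunc K) (RatAlt K))).comp
      (ratShift K : RatFunc K →+* RatFunc K) =
      (SeqRing.shift K : SeqRing K →+* SeqRing K).comp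
        ((RatAlt.toSeqHom K).comp (algebraMap (RatFunc K) (RatAlt K))) := by
    refine IsLocalization.ringHom_ext (nonZeroDivisors (Polynomial K)) ?_
    refine Polynomial.ringHom_ext (fun c => ?_) ?_
    · have e : algebraMap (Polynomial K) (RatFunc K) (Polynomial.C c) = algebraMap K _ c := by
        simp
      simp only [RingHom.comp_apply, e, RingHom.coe_coe, AlgEquiv.commutes,
        ← IsScalarTower.algebraMap_apply K (RatFunc K) (RatAlt K), RatAlt.toSeqHom_algebraMap]
      rfl
    · simp only [RingHom.comp_apply, RatFunc.algebraMap_X, RingHom.coe_coe, ratShift_X, map_add,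
        map_one, RatAlt.toSeqHom_algebraMap_X]
      rw [SeqRing.shift_toSeq]
      simp only [Nat.cast_add, Nat.cast_one, toSeq_add]
      rfl
  have h' : ∀ g : RatFunc K, RatAlt.toSeqHom K (algebraMap (RatFunc K) (RatAlt K) (ratShift K g)) =
      SeqRing.shift K (RatAlt.toSeqHom K (algebraMap (RatFunc K) (RatAlt K) g)) := fun g =>
    congrArg (fun φ : RatFunc K →+* SeqRing K => φ g) h
  rw [f.eq_algebraMap_add]
  simp only [map_add, map_mul, RatAlt.shift_algebraMap_ratFunc, RatAlt.shift_x, h', map_neg]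
  congr 2
  rw [RatAlt.toSeqHom_x, SeqRing.shift_toSeq]
  refine Filter.Germ.coe_eq.2 (Filter.Eventually.of_forall fun k => ?_)
  simp [pow_succ]

/-- The kernel is a proper ideal stable under the inverse shift, hence zero by difference
simplicity. -/
theorem RatAlt.toSeqHom_injective : Function.Injective (RatAlt.toSeqHom K) := by
  rw [injective_iff_map_eq_zero]
  intro f hf
  by_contra h0
  have := RatAlt.one_mem_of_stable (RingHom.ker (RatAlt.toSeqHom K)) (fun g hg => ?_) hf h0
  · rw [RingHom.mem_ker, map_one] at this
    exact one_ne_zero this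
  · rw [RingHom.mem_ker] at hg ⊢
    apply (SeqRing.shift K).injective
    rw [← RatAlt.toSeqHom_shift, RingEquiv.apply_symm_apply, hg, map_zero]

theorem SeqRing.eq_const_of_shift_eq {s : SeqRing K} (h : SeqRing.shift K s = s) :
    ∃ c : K, s = toSeq fun _ => c := by
  induction s using Filter.Germ.inductionOn with
  | _ f =>
  have h' : ∀ᶠ n in Filter.atTop, f (n + 1) = f n := Filter.Germ.coe_eq.1 h
  obtain ⟨N, hN⟩ := Filter.eventually_atTop.1 h'
  refine ⟨f N, Filter.Germ.coe_eq.2 ?_⟩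
  filter_upwards [Filter.eventually_ge_atTop N] with n hn
  induction n, hn using Nat.le_induction with
  | base => rfl
  | succ n hn ih => rw [hN n hn, ih]

/-- Read off from sequences: an invariant element evaluates to an eventually constant sequence, and
evaluation is injective. -/
theorem RatAlt.exists_algebraMap_of_shift_eq {f : RatAlt K} (h : RatAlt.shift K f = f) :
    ∃ c : K, f = algebraMap K (RatAlt K) c := by
  have h1 := RatAlt.toSeqHom_shift f
  rw [h] at h1
  obtain ⟨c, hc⟩ := SeqRing.eq_const_of_shift_eq h1.symm
  exact ⟨c, RatAlt.toSeqHom_injective (by rw [hc, RatAlt.toSeqHom_algebraMap])⟩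

end ratAlt

/-! ### Independence of the summands modulo telescoping differences, by comparing poles. -/

section telescoping

variable {K : Type*} [Field K] [CharZero K]

theorem expand_ratShift (ρ : K) (f : RatFunc K) : expand ρ (ratShift K f) = expand (ρ + 1) f := by
  have h : (expand ρ).comp (ratShift K : RatFunc K →+* RatFunc K) = expand (ρ + 1) := by
    refine IsLocalization.ringHom_ext (nonZeroDivisors (Polynomial K)) ?_
    have e : ∀ p : Polynomial K, ratShift K (algebraMap (Polynomial K) (RatFunc K) p) =
        algebraMap (Polynomial K) (RatFunc K) (Polynomial.algEquivAevalXAddC (1 : K) p) :=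
      fun p => by rw [ratShift, IsFractionRing.algEquivOfAlgEquiv_algebraMap]
    refine Polynomial.ringHom_ext (fun c => ?_) ?_
    · simp only [RingHom.comp_apply, RingHom.coe_coe, e, expand_poly]
      simp [expandPoly]
    · simp only [RingHom.comp_apply, RingHom.coe_coe, e, expand_poly]
      simp [expandPoly]
      ring
  exact congrArg (fun φ : RatFunc K →+* LaurentSeries K => φ f) h

theorem expand_coeff_of_denom_ne_zero {ρ : K} {f : RatFunc K} (h : f.denom.eval ρ ≠ 0) {i : ℤ}
    (hi : i < 0) : (expand ρ f).coeff i = 0 := by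
  have hP : ∀ p : Polynomial K, ∃ q : PowerSeries K, expandPoly ρ p =
      HahnSeries.ofPowerSeries ℤ K q ∧ PowerSeries.constantCoeff q = p.eval ρ := fun p =>
    ⟨_, rfl, by
      simp [Polynomial.coeff_zero_eq_eval_zero, ← Polynomial.comp_eq_aeval, Polynomial.eval_comp]⟩
  obtain ⟨q, hq, hq0⟩ := hP f.denom
  obtain ⟨p, hp, -⟩ := hP f.num
  have hc : PowerSeries.constantCoeff q ≠ 0 := by rwa [hq0]
  have e : expand ρ f = HahnSeries.ofPowerSeries ℤ K (p * q⁻¹) := by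
    have h1 : f * algebraMap (Polynomial K) (RatFunc K) f.denom =
        algebraMap (Polynomial K) (RatFunc K) f.num := by
      have := div_mul_cancel₀ (algebraMap (Polynomial K) (RatFunc K) f.num)
        (RatFunc.algebraMap_ne_zero f.denom_ne_zero)
      rwa [f.num_div_denom] at this
    have h2 := congrArg (expand ρ) h1
    rw [map_mul, expand_poly, expand_poly, hp, hq] at h2
    have h3 : HahnSeries.ofPowerSeries ℤ K q * HahnSeries.ofPowerSeries ℤ K q⁻¹ = 1 := by
      rw [← map_mul, PowerSeries.mul_inv_cancel _ hc, map_one]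
    rw [map_mul, ← h2, mul_assoc, h3, mul_one]
  rw [e]
  exact (PowerSeries.coeff_coe _ i).trans (if_pos hi)

/-- A rational function has finitely many poles, so it is regular somewhere along any injective
sequence of points. -/
theorem exists_expand_coeff_eq_zero (f : RatFunc K) (g : ℕ → K) (hg : Function.Injective g)
    {i : ℤ} (hi : i < 0) : ∃ n, (expand (g n) f).coeff i = 0 := by
  have hfin : (g ⁻¹' {ρ | f.denom.IsRoot ρ}).Finite :=
    (Polynomial.finite_setOfPred_isRoot f.denom_ne_zero).preimage hg.injOn
  obtain ⟨n, hn⟩ := hfin.exists_notMem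
  exact ⟨n, expand_coeff_of_denom_ne_zero hn hi⟩

theorem signPart_shift {z : K} (hz : z = 1 ∨ z = -1) (g : RatAlt K) :
    signPart z (RatAlt.shift K g) = z • ratShift K (signPart z g) := by
  have h1 : (-1 : K) ≠ 1 := by
    intro h
    have : (2 : K) = 0 := by linear_combination -h
    exact two_ne_zero this
  rcases hz with rfl | rfl
  · simp [signPart, RatAlt.shift, QuadraticAlgebra.reₗ]
  · simp [signPart, RatAlt.shift, h1, QuadraticAlgebra.imₗ]

theorem signPart_lamBar {l m : Letter K} (hl : l.z = 1 ∨ l.z = -1) (hm : m.z = 1 ∨ m.z = -1)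
    [Decidable (l.z = m.z)] :
    signPart l.z (lamBar m) = if l.z = m.z then (linForm K m.a m.b ^ m.c)⁻¹ else 0 := by
  have h1 : (-1 : K) ≠ 1 := by
    intro h
    have : (2 : K) = 0 := by linear_combination -h
    exact two_ne_zero this
  rcases hl with h | h <;> rcases hm with h' | h' <;>
  simp [signPart, lamBar, signElem, h, h', h1, h1.symm, RatAlt.x,
    QuadraticAlgebra.algebraMap_eq, QuadraticAlgebra.reₗ, QuadraticAlgebra.imₗ]

/-- The roots `-b/a` lie in `(-1, 0]` because `0 ≤ b < a`, so an integer difference of two of them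
is `0`; coprimality then recovers `a` and `b` from the root. -/
theorem linForm_root_eq {l m : Letter K} (hl : l ∈ fullAlphabet K) (hm : m ∈ fullAlphabet K)
    {k : ℤ} (h : (m.a : K) * (-(l.b : K) / l.a + k) + m.b = 0) :
    k = 0 ∧ l.a = m.a ∧ l.b = m.b := by
  have hla : (l.a : K) ≠ 0 := by
    have := hl.1
    simp
    omega
  field_simp at h
  have h' : (m.a : ℤ) * (-(l.b : ℤ) + l.a * k) + m.b * l.a = 0 := by
    have : (((m.a : ℤ) * (-(l.b : ℤ) + l.a * k) + m.b * l.a : ℤ) : K) = 0 := by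
      push_cast
      linear_combination h
    exact_mod_cast this
  have hlb : (l.b : ℤ) < l.a := by exact_mod_cast hl.2.2.1
  have hmb : (m.b : ℤ) < m.a := by exact_mod_cast hm.2.2.1
  have hla' : (0 : ℤ) < l.a := by exact_mod_cast hl.1
  have hma' : (0 : ℤ) < m.a := by exact_mod_cast hm.1
  have hlb0 : (0 : ℤ) ≤ l.b := Int.natCast_nonneg _
  have hmb0 : (0 : ℤ) ≤ m.b := Int.natCast_nonneg _
  have hpos := mul_pos hma' hla'
  have hk : k = 0 := by
    have h1 : (m.a : ℤ) * l.a * k = m.a * l.b - m.b * l.a := by linear_combination h'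
    have h2 : (m.a : ℤ) * l.a * k < m.a * l.a * 1 := by
      rw [h1]
      nlinarith [mul_lt_mul_of_pos_left hlb hma', mul_nonneg hmb0 hla'.le]
    have h3 : (m.a : ℤ) * l.a * (-1) < m.a * l.a * k := by
      rw [h1]
      nlinarith [mul_lt_mul_of_pos_right hmb hla', mul_nonneg hma'.le hlb0]
    have h4 := lt_of_mul_lt_mul_left h2 hpos.le
    have h5 := lt_of_mul_lt_mul_left h3 hpos.le
    omega
  refine ⟨hk, ?_⟩
  by_contra hne
  refine det_ne_zero hl hm (fun h1 h2 => hne ⟨h1, h2⟩) ?_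
  rw [hk] at h'
  have : (l.a : ℤ) * m.b = m.a * l.b := by linear_combination h'
  exact_mod_cast this

theorem expand_lamBar_coeff {H : Alphabet} {l m : Letter K} (hl : l ∈ H.letters K)
    (hm : m ∈ H.letters K) (k : ℤ) (hne : k ≠ 0 ∨ l ≠ m) :
    (expand (-(l.b : K) / l.a + k) (signPart l.z (lamBar m))).coeff (-(l.c : ℤ)) = 0 := by
  classical
  rw [signPart_lamBar (Alphabet.z_eq hl) (Alphabet.z_eq hm)]
  split_ifs with hz
  swap
  · simp
  have hl' := Alphabet.mem_full hl
  have hm' := Alphabet.mem_full hm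
  by_cases hp : (m.a : K) * (-(l.b : K) / l.a + k) + m.b = 0
  · obtain ⟨hk, ha, hb⟩ := linForm_root_eq hl' hm' hp
    rw [expand_pole _ hm'.1 hp, if_neg]
    intro hc
    refine hne.elim (fun h => h hk) (fun h => h ?_)
    cases l
    cases m
    simp_all
  · refine expand_regular _ hp _ ?_
    have := hl'.2.1
    omega

theorem expand_lamBar_coeff_self {H : Alphabet} {l : Letter K} (hl : l ∈ H.letters K) :
    (expand (-(l.b : K) / l.a) (signPart l.z (lamBar l))).coeff (-(l.c : ℤ)) ≠ 0 := by
  classical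
  have hl' := Alphabet.mem_full hl
  have hla : (l.a : K) ≠ 0 := by
    have := hl'.1
    simp
    omega
  rw [signPart_lamBar (Alphabet.z_eq hl) (Alphabet.z_eq hl), if_pos rfl,
    expand_pole _ hl'.1 (by field_simp; simp), if_pos rfl]
  exact inv_ne_zero (pow_ne_zero _ hla)

/-- Away from `0` the equation reads `G m = z * G (m + 1)`. Vanishing of `G` at one point on each
side of the gap therefore propagates to `G 1` and `G 0`, which determine `F 0`. -/
theorem eq_zero_of_sparse_difference {z : K} (hz : z = 1 ∨ z = -1) {F G : ℤ → K}
    (hFG : ∀ m, F m = z * G (m + 1) - G m) (hF : ∀ m, m ≠ 0 → F m = 0)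
    (hpos : ∃ n : ℕ, G (1 + n) = 0) (hneg : ∃ n : ℕ, G (-n) = 0) : F 0 = 0 := by
  have hz0 : z ≠ 0 := by
    rcases hz with rfl | rfl <;> simp
  have h1 : ∀ n : ℕ, G 1 = z ^ n * G (1 + n) := by
    intro n
    induction n with
    | zero => simp
    | succ n ih =>
      have := hFG (1 + n)
      rw [hF _ (by omega)] at this
      rw [ih]
      push_cast
      rw [pow_succ, ← add_assoc]
      linear_combination (z ^ n) * this
  have h2 : ∀ n : ℕ, G (-n) = z ^ n * G 0 := by
    intro n
    induction n with
    | zero => simp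
    | succ n ih =>
      have := hFG (-((n + 1 : ℕ) : ℤ))
      rw [hF _ (by omega), show -((n + 1 : ℕ) : ℤ) + 1 = -n by push_cast; ring, ih] at this
      rw [pow_succ]
      linear_combination this
  obtain ⟨n, hn⟩ := hpos
  obtain ⟨n', hn'⟩ := hneg
  have g1 : G 1 = 0 := by rw [h1 n, hn, mul_zero]
  have g0 : G 0 = 0 := by
    rw [h2 n'] at hn'
    exact (mul_eq_zero.1 hn').resolve_left (pow_ne_zero _ hz0)
  rw [hFG, zero_add, g1, g0, mul_zero, sub_zero]

/-- For a letter `d`, follow the Laurent coefficient of order `-c` of the component of sign `z`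
along the points `ρ + m`, `m ∈ ℤ`, where `ρ = -b/a`. On the left only `m = 0` and the letter `d`
contribute; on the right it is a twisted difference of a function that vanishes far out in both
directions. -/
theorem eq_zero_of_telescoping {H : Alphabet} (l : H.letters K →₀ K) (g : RatAlt K)
    (h : Finsupp.linearCombination K (fun a : H.letters K => lamBar a.1) l =
      RatAlt.shift K g - g) : l = 0 := by
  ext d
  set ρ : K := -(d.1.b : K) / d.1.a
  have hz := Alphabet.z_eq d.2
  have hc : -(d.1.c : ℤ) < 0 := by
    have := (Alphabet.mem_full d.2).2.1
    omega
  let φ : ℤ → RatAlt K → K := fun m f =>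
    (expand (ρ + m) (signPart d.1.z f)).coeff (-(d.1.c : ℤ))
  have hφs : ∀ m (s : Finset (H.letters K)),
      φ m (∑ a ∈ s, l a • lamBar a.1) = ∑ a ∈ s, l a * φ m (lamBar a.1) := fun m s => by
    simp only [φ, map_sum, map_smul, expand_smul, HahnSeries.coeff_sum, HahnSeries.coeff_smul,
      smul_eq_mul]
  have key := eq_zero_of_sparse_difference hz (F := fun m => φ m (RatAlt.shift K g - g))
    (G := fun m => φ m g) ?_ ?_ ?_ ?_
  · change φ 0 _ = 0 at key
    rw [← h, Finsupp.linearCombination_apply, Finsupp.sum, hφs] at key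
    by_contra hd
    rw [Finset.sum_eq_single d] at key
    · have hs := expand_lamBar_coeff_self d.2
      rcases mul_eq_zero.1 key with h1 | h1
      · exact hd h1
      · apply hs
        simpa [φ] using h1
    · intro a _ had
      have := expand_lamBar_coeff d.2 a.2 0 (Or.inr fun h => had (Subtype.ext h.symm))
      rw [show φ 0 (lamBar a.1) = 0 from this, mul_zero]
    · intro hd'
      rw [Finsupp.notMem_support_iff.1 hd', zero_mul]
  · intro m
    simp only [φ, map_sub, signPart_shift hz, expand_smul, expand_ratShift, HahnSeries.coeff_sub,
      HahnSeries.coeff_smul, smul_eq_mul, Int.cast_add, Int.cast_one, add_assoc]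
  · intro m hm
    rw [← h, Finsupp.linearCombination_apply, Finsupp.sum, hφs]
    refine Finset.sum_eq_zero fun a _ => ?_
    have := expand_lamBar_coeff d.2 a.2 m (Or.inl hm)
    rw [show φ m (lamBar a.1) = 0 from this, mul_zero]
  · refine exists_expand_coeff_eq_zero _ (fun n : ℕ => ρ + ((1 + n : ℤ) : K)) (fun m n h => ?_) hc
    simpa using h
  · refine exists_expand_coeff_eq_zero _ (fun n : ℕ => ρ + ((-n : ℤ) : K)) (fun m n h => ?_) hc
    simpa using h

end telescoping

/-! ### Difference simplicity of the quasi-shuffle algebra. -/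

section simple

open QSh

variable {K : Type*} [Field K] [CharZero K] {H : Alphabet}

/-- The coefficients of the words `a u`, as a function of the letter `a`. -/
def tailCoeff (x : QShAlg K H) (u : List (H.letters K)) : H.letters K →₀ RatAlt K :=
  Finsupp.comapDomain (fun a => a :: u) (show List (H.letters K) →₀ RatAlt K from x)
    (fun _ _ _ _ h => (List.cons.inj h).1)

theorem tailCoeff_apply (x : QShAlg K H) (u : List (H.letters K)) (a : H.letters K) :
    tailCoeff x u a = coeff x (a :: u) := rfl

theorem back_smul_word (r : RatAlt K) (u : List (H.letters K)) :
    QShAlg.back K H (r • word _ _ u) =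
      (RatAlt.shift K).symm r • backWord (fun a : H.letters K => lamBar a.1) u :=
  semilift_smul_word _ _ r u

theorem coeff_back (x : QShAlg K H) (u : List (H.letters K)) :
    coeff (QShAlg.back K H x) u = (RatAlt.shift K).symm (coeff x u) -
      (tailCoeff x u).sum fun a r => (RatAlt.shift K).symm r * lamBar a.1 := by
  induction x using QSh.induction with
  | h0 =>
    have : tailCoeff (0 : QShAlg K H) u = 0 := by
      ext1 a
      rfl
    simp [coeff_zero, this]
  | hadd x y hx hy =>
    have : tailCoeff (x + y) u = tailCoeff x u + tailCoeff y u := by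
      ext1 a
      rfl
    rw [map_add, coeff_add, hx, hy, this, Finsupp.sum_add_index' (by simp)
      (by simp [add_mul]), coeff_add, map_add]
    abel
  | hs r v =>
    classical
    rw [back_smul_word, coeff_smul, coeff_smul, coeff_word]
    cases v with
    | nil =>
      have : tailCoeff (r • word _ _ [] : QShAlg K H) u = 0 := by
        ext1 a
        rw [tailCoeff_apply, coeff_smul, coeff_word_of_ne (by simp), mul_zero]
        rfl
      rw [this, Finsupp.sum_zero_index, backWord, coeff_word]
      split_ifs <;> simp
    | cons b v =>
      have h1 : tailCoeff (r • word _ _ (b :: v) : QShAlg K H) u =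
          if v = u then Finsupp.single b r else 0 := by
        ext1 a
        rw [tailCoeff_apply, coeff_smul, coeff_word]
        by_cases hv : v = u
        · by_cases hb : b = a
          · simp [hv, hb]
          · simp [hv, hb]
        · simp [hv]
      rw [h1, backWord, coeff_sub, coeff_smul, coeff_word, coeff_word]
      by_cases hv : v = u
      · rw [if_pos hv, if_pos hv, Finsupp.sum_single_index (by simp)]
        split_ifs <;> simp [mul_sub]
      · rw [if_neg hv, if_neg hv, Finsupp.sum_zero_index]
        split_ifs <;> simp

/-- The elements all of whose words have length less than `N`. -/
abbrev lengthBelow (K : Type*) [Field K] [CharZero K] (H : Alphabet) (N : ℕ) :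
    Submodule (RatAlt K) (QShAlg K H) :=
  below (RatAlt K) (letterBracket K H) (fun _ => 1) N

theorem mem_lengthBelow {x : QShAlg K H} {N : ℕ} :
    x ∈ lengthBelow K H N ↔ ∀ u, N ≤ u.length → coeff x u = 0 := by
  refine ⟨fun h u hu => coeff_eq_zero_of_mem_below h (by simpa using hu), fun h => ?_⟩
  refine mem_of_word_mem fun u hu => word_mem_below ?_
  by_contra hlt
  exact hu (h u (by simpa using hlt))

theorem tailCoeff_eq_zero {x : QShAlg K H} {N : ℕ} (hx : x ∈ lengthBelow K H (N + 1))
    {u : List (H.letters K)} (hu : N ≤ u.length) : tailCoeff x u = 0 := by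
  ext1 a
  rw [tailCoeff_apply, mem_lengthBelow.1 hx _ (by simpa using hu)]
  rfl

theorem coeff_back_of_le {x : QShAlg K H} {N : ℕ} (hx : x ∈ lengthBelow K H (N + 1))
    {u : List (H.letters K)} (hu : N ≤ u.length) :
    coeff (QShAlg.back K H x) u = (RatAlt.shift K).symm (coeff x u) := by
  rw [coeff_back, tailCoeff_eq_zero hx hu, Finsupp.sum_zero_index, sub_zero]

theorem back_mem_lengthBelow {x : QShAlg K H} {N : ℕ} (hx : x ∈ lengthBelow K H (N + 1)) :
    QShAlg.back K H x ∈ lengthBelow K H (N + 1) :=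
  mem_lengthBelow.2 fun u hu => by
    rw [coeff_back_of_le hx (by omega), mem_lengthBelow.1 hx u hu, map_zero]

/-- Invariance makes the coefficients of the longest words constants in `K`. At the word `u`, one
letter shorter, it then says that a `K`-combination of summands telescopes, so this combination is
trivial. -/
theorem coeff_eq_zero_of_back_eq {x : QShAlg K H} {a : H.letters K} {u : List (H.letters K)}
    (hx : x ∈ lengthBelow K H (u.length + 2)) (h : QShAlg.back K H x = x) :
    coeff x (a :: u) = 0 := by
  have hconst : ∀ b, ∃ k : K, coeff x (b :: u) = algebraMap K (RatAlt K) k := fun b => by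
    refine RatAlt.exists_algebraMap_of_shift_eq ?_
    have := coeff_back_of_le (u := b :: u) hx (by simp)
    rw [h] at this
    exact ((RingEquiv.eq_symm_apply _).1 this)
  choose k hk using hconst
  have hk0 : ∀ b, k b ≠ 0 → b ∈ (tailCoeff x u).support := fun b hb => by
    rw [Finsupp.mem_support_iff, tailCoeff_apply, hk]
    exact fun h0 => hb ((algebraMap K (RatAlt K)).injective (h0.trans (map_zero _).symm))
  have hsum := coeff_back x u
  rw [h] at hsum
  -- With `c` the coefficient of `u`, invariance reads `∑ k_b λ̄(b) = σ⁻¹(c) - c`, which is `σ(g) -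
  -- g` for `g = -σ⁻¹(c)`.
  have key := eq_zero_of_telescoping (Finsupp.onFinset (tailCoeff x u).support k hk0)
    (-(RatAlt.shift K).symm (coeff x u)) (by
      rw [map_neg, RingEquiv.apply_symm_apply, Finsupp.linearCombination_apply,
        Finsupp.onFinset_sum _ (by simp)]
      have e : (tailCoeff x u).sum (fun a r => (RatAlt.shift K).symm r * lamBar a.1) =
          ∑ b ∈ (tailCoeff x u).support, k b • lamBar b.1 := by
        refine Finset.sum_congr rfl fun b _ => ?_
        have h1 := RatAlt.shift_symm_algebraMap K (k b)
        rw [tailCoeff_apply, hk, Algebra.smul_def]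
        exact congrArg (· * lamBar b.1) h1
      rw [← e]
      linear_combination hsum)
  have := DFunLike.congr_fun key a
  rw [Finsupp.onFinset_apply, Finsupp.zero_apply] at this
  rw [hk, this, map_zero]

/-- The quasi-shuffle algebra is difference simple over `K(n)[x]`. -/
theorem eq_bot_of_back_stable (M : Submodule (RatAlt K) (QShAlg K H))
    (hM : ∀ x ∈ M, QShAlg.back K H x ∈ M) (h0 : ∀ r : RatAlt K, r • (1 : QShAlg K H) ∈ M → r = 0) :
    M = ⊥ := by
  classical
  rw [Submodule.eq_bot_iff]
  by_contra! hne
  have hex : ∃ N, ∃ x ∈ M, x ≠ 0 ∧ x ∈ lengthBelow K H (N + 1) := by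
    obtain ⟨x, hx, hx0⟩ := hne
    refine ⟨(support x).sup List.length, x, hx, hx0, mem_lengthBelow.2 fun u hu => ?_⟩
    by_contra h
    have := Finset.le_sup (f := List.length) (mem_support.2 h)
    omega
  -- `N` is the least possible maximal word length of a nonzero element of `M`; then `x` is chosen
  -- with the fewest words of length `N`.
  obtain ⟨N, hN, hNmin⟩ : ∃ N, (∃ x ∈ M, x ≠ 0 ∧ x ∈ lengthBelow K H (N + 1)) ∧
      ∀ x ∈ M, x ∈ lengthBelow K H N → x = 0 := by
    refine ⟨Nat.find hex, Nat.find_spec hex, fun x hx hxN => ?_⟩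
    by_contra hx0
    rcases Nat.eq_zero_or_pos (Nat.find hex) with h | h
    · rw [h] at hxN
      exact hx0 (coeff_ext fun u => mem_lengthBelow.1 hxN u (Nat.zero_le _))
    · exact Nat.find_min hex (Nat.sub_lt h one_pos) ⟨x, hx, hx0, by rwa [Nat.sub_add_cancel (Nat.one_le_iff_ne_zero.2 h.ne')]⟩
  let top : QShAlg K H → Finset (List (H.letters K)) := fun x =>
    (support x).filter fun u => u.length = N
  have htop : ∀ x u, u ∈ top x ↔ coeff x u ≠ 0 ∧ u.length = N := fun x u => by
    simp [top, mem_support]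
  obtain ⟨x, ⟨hxM, hx0, hxN⟩, hmin⟩ : ∃ x, (x ∈ M ∧ x ≠ 0 ∧ x ∈ lengthBelow K H (N + 1)) ∧
      ∀ y, (y ∈ M ∧ y ≠ 0 ∧ y ∈ lengthBelow K H (N + 1)) → (top x).card ≤ (top y).card := by
    obtain ⟨x, hx, hmin⟩ := (measure fun x : QShAlg K H => (top x).card).wf.has_min
      {x | x ∈ M ∧ x ≠ 0 ∧ x ∈ lengthBelow K H (N + 1)} hN
    exact ⟨x, hx, fun y hy => not_lt.1 (hmin y hy)⟩
  obtain ⟨w, hw⟩ : ∃ w, w ∈ top x := by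
    by_contra! h
    refine hx0 (hNmin x hxM (mem_lengthBelow.2 fun u hu => ?_))
    rcases hu.eq_or_lt with hu | hu
    · by_contra hc
      exact h u ((htop x u).2 ⟨hc, hu.symm⟩)
    · exact mem_lengthBelow.1 hxN u hu
  obtain ⟨hw0, hwN⟩ := (htop x w).1 hw
  -- The elements of `M` whose words of length `N` are among those of `x`. The backward shift
  -- preserves this, since on the longest words it only acts on coefficients; so the coefficients at
  -- `w` form a stable ideal of `R`.
  let P : Submodule (RatAlt K) (QShAlg K H) :=
    { carrier := {y | y ∈ M ∧ y ∈ lengthBelow K H (N + 1) ∧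
        ∀ u, u.length = N → coeff x u = 0 → coeff y u = 0}
      zero_mem' := ⟨M.zero_mem, Submodule.zero_mem _, fun _ _ _ => rfl⟩
      add_mem' := fun {y z} hy hz => ⟨M.add_mem hy.1 hz.1, Submodule.add_mem _ hy.2.1 hz.2.1,
        fun u hu h => by rw [coeff_add, hy.2.2 u hu h, hz.2.2 u hu h, add_zero]⟩
      smul_mem' := fun r y hy => ⟨M.smul_mem r hy.1, Submodule.smul_mem _ r hy.2.1,
        fun u hu h => by rw [coeff_smul, hy.2.2 u hu h, mul_zero]⟩ }
  have hPback : ∀ y ∈ P, QShAlg.back K H y ∈ P := fun y hy =>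
    ⟨hM y hy.1, back_mem_lengthBelow hy.2.1, fun u hu h => by
      rw [coeff_back_of_le hy.2.1 hu.ge, hy.2.2 u hu h, map_zero]⟩
  obtain ⟨y, hyP, hy1⟩ : ∃ y ∈ P, coeff y w = 1 := by
    let c : QShAlg K H →ₗ[RatAlt K] RatAlt K :=
      (Finsupp.lapply w : (List (H.letters K) →₀ RatAlt K) →ₗ[RatAlt K] RatAlt K)
    have := RatAlt.one_mem_of_stable (P.map c) (fun f hf => ?_) (f := coeff x w)
      ⟨x, ⟨hxM, hxN, fun _ _ h => h⟩, rfl⟩ hw0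
    · obtain ⟨y, hy, hy1⟩ := this
      exact ⟨y, hy, hy1⟩
    · obtain ⟨y, hy, rfl⟩ := hf
      exact ⟨_, hPback y hy, coeff_back_of_le hy.2.1 hwN.ge⟩
  -- The difference `σ⁻¹(y) - y` has lost the word `w`, as the coefficient `1` is invariant; by
  -- minimality it is zero.
  have hfix : QShAlg.back K H y = y := by
    by_contra hne
    have hzP := P.sub_mem (hPback y hyP) hyP
    have hle := hmin _ ⟨hzP.1, sub_ne_zero.2 hne, hzP.2.1⟩
    refine absurd hle (not_le.2 (Finset.card_lt_card ?_))
    refine (Finset.ssubset_iff_of_subset fun u hu => ?_).2 ⟨w, hw, fun h => ?_⟩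
    · rw [htop] at hu ⊢
      exact ⟨fun h => hu.1 (hzP.2.2 u hu.2 h), hu.2⟩
    · refine ((htop _ _).1 h).1 ?_
      rw [coeff_sub, coeff_back_of_le hyP.2.1 hwN.ge, hy1, map_one, sub_self]
  cases w with
  | nil =>
    have hN0 : N = 0 := hwN.symm
    have hy : y = coeff y [] • (1 : QShAlg K H) := by
      refine coeff_ext fun u => ?_
      rw [coeff_smul, one_def]
      cases u with
      | nil => rw [coeff_word_self, mul_one]
      | cons a u =>
        rw [coeff_word_of_ne (by simp), mul_zero]
        exact mem_lengthBelow.1 hyP.2.1 _ (by simp [hN0])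
    have := h0 (coeff y []) (by rw [← hy]; exact hyP.1)
    rw [hy1] at this
    exact one_ne_zero this
  | cons a u =>
    have hlen : N = u.length + 1 := hwN.symm
    have := coeff_eq_zero_of_back_eq (a := a) (u := u) (x := y)
      (by have := hyP.2.1; rwa [hlen] at this) hfix
    rw [hy1] at this
    exact one_ne_zero this

end simple

/-! ### Values of the summands at single points and as sequences. -/

section evaluation

variable {K : Type*} [Field K] [CharZero K]

/-- `f` is regular at `k`, with value `r`. -/
def HasValue (k : ℕ) (f : RatAlt K) (r : K) : Prop :=
  ∃ s p q : Polynomial K, s.eval (k : K) ≠ 0 ∧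
    algebraMap (Polynomial K) (RatFunc K) s * f.re = algebraMap _ _ p ∧
    algebraMap (Polynomial K) (RatFunc K) s * f.im = algebraMap _ _ q ∧
    s.eval (k : K) * r = p.eval (k : K) + (-1) ^ k * q.eval (k : K)

namespace HasValue

variable {k : ℕ} {f g : RatAlt K} {r t : K}

/-- Independence of the chosen denominator, which lets an identity in `K(n)[x]` be read as an
identity of values at the given `k`. -/
theorem unique (hf : HasValue k f r) (hf' : HasValue k f t) : r = t := by
  obtain ⟨s, p, q, hs, hp, hq, hr⟩ := hf
  obtain ⟨s', p', q', hs', hp', hq', hr'⟩ := hf'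
  have h1 : s' * p = s * p' := RatFunc.algebraMap_injective K (by
    rw [map_mul, map_mul, ← hp, ← hp']
    ring)
  have h2 : s' * q = s * q' := RatFunc.algebraMap_injective K (by
    rw [map_mul, map_mul, ← hq, ← hq']
    ring)
  have e1 := congrArg (Polynomial.eval (k : K)) h1
  have e2 := congrArg (Polynomial.eval (k : K)) h2
  simp only [Polynomial.eval_mul] at e1 e2
  refine mul_left_cancel₀ (mul_ne_zero hs hs') ?_
  linear_combination Polynomial.eval (k : K) s' * hr - Polynomial.eval (k : K) s * hr' + e1 +
    (-1) ^ k * e2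

theorem zero : HasValue k (0 : RatAlt K) 0 := ⟨1, 0, 0, by simp, by simp, by simp, by simp⟩

theorem add (hf : HasValue k f r) (hg : HasValue k g t) : HasValue k (f + g) (r + t) := by
  obtain ⟨s, p, q, hs, hp, hq, hr⟩ := hf
  obtain ⟨s', p', q', hs', hp', hq', hr'⟩ := hg
  refine ⟨s * s', s' * p + s * p', s' * q + s * q', ?_, ?_, ?_, ?_⟩
  · rw [Polynomial.eval_mul]
    exact mul_ne_zero hs hs'
  · simp only [map_mul, map_add, ← hp, ← hp', QuadraticAlgebra.re_add]
    ring
  · simp only [map_mul, map_add, ← hq, ← hq', QuadraticAlgebra.im_add]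
    ring
  · simp only [Polynomial.eval_mul, Polynomial.eval_add]
    linear_combination Polynomial.eval (k : K) s' * hr + Polynomial.eval (k : K) s * hr'

theorem mul (hf : HasValue k f r) (hg : HasValue k g t) : HasValue k (f * g) (r * t) := by
  obtain ⟨s, p, q, hs, hp, hq, hr⟩ := hf
  obtain ⟨s', p', q', hs', hp', hq', hr'⟩ := hg
  have hk : ((-1 : K) ^ k) * (-1) ^ k = 1 := by rw [← mul_pow]; simp
  refine ⟨s * s', p * p' + q * q', p * q' + q * p', ?_, ?_, ?_, ?_⟩
  · rw [Polynomial.eval_mul]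
    exact mul_ne_zero hs hs'
  · have : (f * g).re = f.re * g.re + f.im * g.im := by simp
    simp only [map_mul, map_add, ← hp, ← hp', ← hq, ← hq', this]
    ring
  · have : (f * g).im = f.re * g.im + f.im * g.re := by simp
    simp only [map_mul, map_add, ← hp, ← hp', ← hq, ← hq', this]
    ring
  · simp only [Polynomial.eval_mul, Polynomial.eval_add]
    linear_combination Polynomial.eval (k : K) s' * t * hr + (Polynomial.eval (k : K) p +
      (-1) ^ k * Polynomial.eval (k : K) q) * hr' +
      Polynomial.eval (k : K) q * Polynomial.eval (k : K) q' * hk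

theorem algebraMap_scalar (c : K) : HasValue k (algebraMap K (RatAlt K) c) c := by
  rw [IsScalarTower.algebraMap_apply K (RatFunc K) (RatAlt K)]
  exact ⟨1, Polynomial.C c, 0, by simp, by simp [QuadraticAlgebra.algebraMap_eq],
    by simp [QuadraticAlgebra.algebraMap_eq], by simp⟩

theorem x : HasValue k (RatAlt.x K) ((-1) ^ k) :=
  ⟨1, 0, 1, by simp, by simp [RatAlt.x], by simp [RatAlt.x], by simp⟩

theorem inv_linForm {a b c : ℕ} (h : (a : K) * k + b ≠ 0) :
    HasValue k (algebraMap (RatFunc K) (RatAlt K) ((linForm K a b ^ c)⁻¹))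
      (((a : K) * k + b) ^ c)⁻¹ := by
  have h0 : linForm K a b ≠ 0 := by
    rw [linForm_eq, Ne, map_eq_zero_iff _ (RatFunc.algebraMap_injective K)]
    intro h'
    apply h
    simpa using congrArg (Polynomial.eval (k : K)) h'
  refine ⟨(Polynomial.C (a : K) * Polynomial.X + Polynomial.C (b : K)) ^ c, 1, 0, ?_, ?_, ?_, ?_⟩
  · simpa using fun h' => absurd h' h
  · rw [map_pow, ← linForm_eq]
    simp [QuadraticAlgebra.algebraMap_eq, h0]
  · simp [QuadraticAlgebra.algebraMap_eq]
  · have : ((a : K) * k + b) ^ c ≠ 0 := pow_ne_zero _ h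
    simp [this]

end HasValue

theorem lam_denom_ne_zero {l : Letter K} (hl : l ∈ fullAlphabet K) {i : ℕ} (hi : 1 ≤ i) :
    (l.a : K) * i + l.b ≠ 0 := by
  have h : l.a * i + l.b ≠ 0 := by
    have := Nat.mul_pos hl.1 hi
    omega
  exact_mod_cast h

theorem hasValue_lamBar {H : Alphabet} {l : Letter K} (hl : l ∈ H.letters K) {i : ℕ}
    (hi : 1 ≤ i) : HasValue i (lamBar l) (lam l i) := by
  have h1 : (-1 : K) ≠ 1 := by
    intro h
    have : (2 : K) = 0 := by linear_combination -h
    exact two_ne_zero this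
  have hs : HasValue i (signElem l.z) (l.z ^ i) := by
    rcases Alphabet.z_eq hl with h | h
    · rw [h, signElem, if_pos rfl, one_pow]
      simpa using HasValue.algebraMap_scalar (k := i) (1 : K)
    · rw [h, signElem, if_neg h1]
      exact HasValue.x
  rw [lam, div_eq_mul_inv]
  exact hs.mul (HasValue.inv_linForm (lam_denom_ne_zero (Alphabet.mem_full hl) hi))

/-- The identity is needed at every `i ≥ 1`, because nested sums start at `1`; equality of sequences
from some point on would not suffice. -/
theorem lam_mul_lam {H : Alphabet} (a b : H.letters K) {i : ℕ} (hi : 1 ≤ i) :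
    lam a.1 i * lam b.1 i = ((letterBracket K H).br a b).sum fun d k => k * lam d.1 i := by
  refine ((hasValue_lamBar a.2 hi).mul (hasValue_lamBar b.2 hi)).unique ?_
  classical
  rw [letterBracket_spec]
  simp only [Finsupp.sum]
  induction ((letterBracket K H).br a b).support using Finset.induction_on with
  | empty => exact HasValue.zero
  | insert d s hd ih =>
    rw [Finset.sum_insert hd, Finset.sum_insert hd]
    exact ((HasValue.algebraMap_scalar _).mul (hasValue_lamBar d.2 hi)).add ih

/-- The inverse of the linear form is identified by uniqueness of inverses in the ring of sequences;
a possible zero at `i = 0` is invisible there. -/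
theorem toSeqHom_lamBar {H : Alphabet} {l : Letter K} (hl : l ∈ H.letters K) :
    RatAlt.toSeqHom K (lamBar l) = toSeq (lam l) := by
  have hf := Alphabet.mem_full hl
  have h1 : (-1 : K) ≠ 1 := by
    intro h
    have : (2 : K) = 0 := by linear_combination -h
    exact two_ne_zero this
  have hlin : RatAlt.toSeqHom K (algebraMap (RatFunc K) (RatAlt K) (linForm K l.a l.b)) =
      toSeq fun i => (l.a : K) * i + l.b := by
    rw [linForm, map_add, map_mul, map_natCast, map_natCast, map_add, map_mul, map_natCast,
      map_natCast, RatAlt.toSeqHom_algebraMap_X]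
    rfl
  have hinv : RatAlt.toSeqHom K (algebraMap (RatFunc K) (RatAlt K) (linForm K l.a l.b ^ l.c)⁻¹) =
      toSeq fun i => (((l.a : K) * i + l.b) ^ l.c)⁻¹ := by
    have e1 : RatAlt.toSeqHom K (algebraMap (RatFunc K) (RatAlt K) (linForm K l.a l.b ^ l.c)) *
        RatAlt.toSeqHom K (algebraMap (RatFunc K) (RatAlt K) (linForm K l.a l.b ^ l.c)⁻¹) = 1 := by
      rw [← map_mul, ← map_mul, mul_inv_cancel₀ (pow_ne_zero _ (linForm_ne_zero hf.1)), map_one,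
        map_one]
    have e2 : RatAlt.toSeqHom K (algebraMap (RatFunc K) (RatAlt K) (linForm K l.a l.b ^ l.c)) *
        (toSeq fun i => (((l.a : K) * i + l.b) ^ l.c)⁻¹) = 1 := by
      rw [map_pow, map_pow, hlin]
      refine Filter.Germ.coe_eq.2 ?_
      filter_upwards [Filter.eventually_ge_atTop 1] with i hi
      exact mul_inv_cancel₀ (pow_ne_zero _ (lam_denom_ne_zero hf hi))
    exact left_inv_eq_right_inv ((mul_comm _ _).trans e1) e2
  have hs : RatAlt.toSeqHom K (signElem l.z) = toSeq fun i => l.z ^ i := by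
    rcases Alphabet.z_eq hl with h | h
    · rw [h, signElem, if_pos rfl, map_one]
      simp only [one_pow]
      rfl
    · rw [h, signElem, if_neg h1, RatAlt.toSeqHom_x]
  rw [lamBar, map_mul, hs, hinv, ← toSeq_mul]
  congr 1
  funext i
  exact (div_eq_mul_inv _ _).symm

end evaluation

/-! ### The embedding of the quasi-shuffle algebra into the ring of sequences. -/

section sequences

open QSh

variable {K : Type*} [Field K] [CharZero K] {H : Alphabet}

theorem nestedSum_succ (a : H.letters K) (u : List (H.letters K)) (n : ℕ) :
    nestedSum (a :: u) (n + 1) =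
      nestedSum (a :: u) n + lam a.1 (n + 1) * nestedSum u (n + 1) := by
  simp only [nestedSum]
  rw [Finset.sum_Icc_succ_top (by omega)]

/-- The value at `n` of a combination of nested sums. -/
def valueAt (n : ℕ) : QSh K (letterBracket K H) →ₗ[K] K := lift fun u => nestedSum u n

theorem valueAt_word (n : ℕ) (u : List (H.letters K)) :
    valueAt n (word K (letterBracket K H) u) = nestedSum u n := lift_word _ u

theorem valueAt_pre_zero (α : H.letters K →₀ K) (x : QSh K (letterBracket K H)) :
    valueAt 0 (pre α x) = 0 := by
  induction x using QSh.induction with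
  | h0 => simp
  | hadd x y hx hy => rw [map_add, map_add, hx, hy, add_zero]
  | hs k u =>
    simp [pre, Finsupp.sum, valueAt_word, nestedSum]

theorem valueAt_pre_succ (n : ℕ) (α : H.letters K →₀ K) (x : QSh K (letterBracket K H)) :
    valueAt (n + 1) (pre α x) = valueAt n (pre α x) +
      (α.sum fun d k => k * lam d.1 (n + 1)) * valueAt (n + 1) x := by
  induction x using QSh.induction with
  | h0 => simp
  | hadd x y hx hy => rw [map_add, map_add, hx, hy, map_add, map_add]; ring
  | hs k u =>
    simp only [map_smul, pre, lift_word, Finsupp.sum, map_sum, valueAt_word, nestedSum_succ,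
      Algebra.algebraMap_self, RingHom.id_apply, smul_eq_mul, mul_add, Finset.sum_add_distrib,
      Finset.sum_mul, Finset.mul_sum]
    congr 1
    refine Finset.sum_congr rfl fun d _ => ?_
    ring

/-- Products of nested sums are given by the quasi-shuffle product. -/
theorem valueAt_mulWord (n : ℕ) (u v : List (H.letters K)) :
    valueAt n (mulWord K (letterBracket K H) u v) = nestedSum u n * nestedSum v n := by
  induction h : u.length + v.length using Nat.strong_induction_on generalizing u v n with
  | _ N ih =>
    cases u with
    | nil => rw [mulWord, valueAt_word, nestedSum, one_mul]
    | cons a u =>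
      cases v with
      | nil => rw [mulWord, valueAt_word, nestedSum.eq_1 n, mul_one]
      | cons b v =>
        simp only [List.length_cons] at h
        have h1 : ∀ n, _ := fun n => ih _ (by simp only [List.length_cons]; omega) n u (b :: v) rfl
        have h2 : ∀ n, _ := fun n => ih _ (by simp only [List.length_cons]; omega) n (a :: u) v rfl
        have h3 : ∀ n, _ := fun n => ih _ (by omega) n u v rfl
        rw [mulWord]
        induction n with
        | zero =>
          rw [map_sub, map_add, valueAt_pre_zero, valueAt_pre_zero, valueAt_pre_zero]
          simp [nestedSum]
        | succ n ihn =>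
          rw [map_sub, map_add] at ihn ⊢
          rw [valueAt_pre_succ, valueAt_pre_succ, valueAt_pre_succ, h1, h2, h3,
            ← lam_mul_lam a b (by omega), Finsupp.sum_single_index (by simp),
            Finsupp.sum_single_index (by simp), nestedSum_succ a, nestedSum_succ b]
          -- The summation by parts behind the minus sign: with `A`, `B` the two sums at `n`, `U`,
          -- `V` the inner sums at `n + 1`, and `p`, `q` the summands of `a`, `b`, one has `(A + p
          -- U)(B + q V) = A B + p U (B + q V) + q V (A + p U) - p q U V`.
          linear_combination ihn

/-- The sequence of a combination of nested sums over `K(n)[x]`. -/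
def toSeqAdd (K : Type*) [Field K] [CharZero K] (H : Alphabet) : QShAlg K H →+ SeqRing K :=
  Finsupp.liftAddHom (α := List (H.letters K)) (M := RatAlt K) fun u =>
    (AddMonoidHom.mulRight (toSeq (nestedSum u))).comp (RatAlt.toSeqHom K).toAddMonoidHom

theorem toSeqAdd_smul_word (r : RatAlt K) (u : List (H.letters K)) :
    toSeqAdd K H (r • word _ _ u) = RatAlt.toSeqHom K r * toSeq (nestedSum u) := by
  have e : (r • word _ _ u : QShAlg K H) =
      (Finsupp.single u r : List (H.letters K) →₀ RatAlt K) := by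
    refine (Finsupp.smul_single r u (1 : RatAlt K)).trans ?_
    simp
  rw [e]
  exact Finsupp.liftAddHom_apply_single _ u r

theorem toSeqAdd_word (u : List (H.letters K)) :
    toSeqAdd K H (word _ _ u) = toSeq (nestedSum u) := by
  simpa using toSeqAdd_smul_word (1 : RatAlt K) u

theorem toSeqAdd_smul (r : RatAlt K) (x : QShAlg K H) :
    toSeqAdd K H (r • x) = RatAlt.toSeqHom K r * toSeqAdd K H x := by
  induction x using QSh.induction with
  | h0 => simp
  | hadd x y hx hy => rw [smul_add, map_add, hx, hy, map_add, mul_add]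
  | hs s u => rw [smul_smul, toSeqAdd_smul_word, toSeqAdd_smul_word, map_mul, mul_assoc]

theorem toSeqAdd_extend (y : QSh K (letterBracket K H)) :
    toSeqAdd K H (extend (RatAlt K) y) = toSeq fun n => valueAt n y := by
  induction y using QSh.induction with
  | h0 => 
    simp only [map_zero]
    rfl
  | hadd x y hx hy => simp only [map_add, hx, hy, toSeq_add]
  | hs k u =>
    rw [map_smul, extend_word, ← algebraMap_smul (RatAlt K) k, toSeqAdd_smul_word,
      RatAlt.toSeqHom_algebraMap, ← toSeq_mul]
    simp only [map_smul, valueAt_word, smul_eq_mul]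

/-- The ring homomorphism from the quasi-shuffle algebra to the ring of sequences. -/
def QShAlg.toSeqHom (K : Type*) [Field K] [CharZero K] (H : Alphabet) : QShAlg K H →+* SeqRing K where
  __ := toSeqAdd K H
  map_one' := toSeqAdd_word []
  map_mul' x y := by
    change toSeqAdd K H (x * y) = toSeqAdd K H x * toSeqAdd K H y
    induction x using QSh.induction with
    | h0 => simp
    | hadd x x' h h' => simp only [add_mul, map_add, h, h']
    | hs r u =>
    induction y using QSh.induction with
    | h0 => simp
    | hadd x x' h h' => simp only [mul_add, map_add, h, h']
    | hs s v =>
    rw [QSh.smul_mul', QSh.mul_smul', toSeqAdd_smul, toSeqAdd_smul, toSeqAdd_smul_word,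
      toSeqAdd_smul_word, word_mul, ← extend_mulWord, toSeqAdd_extend]
    simp only [valueAt_mulWord, toSeq_mul]
    ring

theorem QShAlg.toSeqHom_apply (x : QShAlg K H) : QShAlg.toSeqHom K H x = toSeqAdd K H x := rfl

theorem QShAlg.toSeqHom_algebraMap (r : RatAlt K) :
    QShAlg.toSeqHom K H (algebraMap (RatAlt K) (QShAlg K H) r) = RatAlt.toSeqHom K r := by
  rw [algebraMap_eq, toSeqHom_apply, toSeqAdd_smul, toSeqAdd_word]
  exact mul_one _

/-- The backward shift removes the last summand of the outermost sum; shifting the sequence puts it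
back. -/
theorem QShAlg.shift_toSeqHom_back (x : QShAlg K H) :
    SeqRing.shift K (QShAlg.toSeqHom K H (QShAlg.back K H x)) = QShAlg.toSeqHom K H x := by
  simp only [toSeqHom_apply]
  induction x using QSh.induction with
  | h0 => simp
  | hadd x y hx hy => simp only [map_add, hx, hy]
  | hs r u =>
    rw [back_smul_word, toSeqAdd_smul, toSeqAdd_smul_word, map_mul, ← RatAlt.toSeqHom_shift,
      RingEquiv.apply_symm_apply]
    congr 1
    cases u with
    | nil =>
      rw [backWord, toSeqAdd_word]
      rfl
    | cons a u =>
      rw [backWord, map_sub, toSeqAdd_word, toSeqAdd_smul_word, toSeqHom_lamBar a.2]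
      refine Filter.Germ.coe_eq.2 (Filter.Eventually.of_forall fun n => ?_)
      change nestedSum (a :: u) (n + 1) - lam a.1 (n + 1) * nestedSum u (n + 1) =
        nestedSum (a :: u) n
      rw [nestedSum_succ]
      ring

theorem QShAlg.toSeqHom_injective : Function.Injective (QShAlg.toSeqHom K H) := by
  -- The kernel is stable under the backward shift and contains no nonzero multiple of `1`, since
  -- evaluation is injective on `K(n)[x]`; difference simplicity applies.
  let M : Submodule (RatAlt K) (QShAlg K H) :=
    { carrier := {x | toSeqAdd K H x = 0}
      zero_mem' := map_zero _
      add_mem' := fun {x y} hx hy => by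
        rw [Set.mem_ofPred_eq] at hx hy ⊢
        rw [map_add, hx, hy, add_zero]
      smul_mem' := fun r x hx => by
        rw [Set.mem_ofPred_eq] at hx ⊢
        rw [toSeqAdd_smul, hx, mul_zero] }
  have hM := eq_bot_of_back_stable M (fun x hx => ?_) fun r hr => ?_
  · rw [injective_iff_map_eq_zero]
    intro x hx
    have : x ∈ M := hx
    rwa [hM] at this
  · change QShAlg.toSeqHom K H _ = 0
    apply (SeqRing.shift K).injective
    rw [shift_toSeqHom_back, map_zero]
    exact hx
  · apply RatAlt.toSeqHom_injective
    rw [map_zero, ← QShAlg.toSeqHom_algebraMap (H := H), Algebra.algebraMap_eq_smul_one]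
    exact hr

end sequences

/-! ### Transfer to the reduced ring, and the main theorem. -/

section reduced

open QSh

variable {K : Type*} [Field K] [CharZero K] {H : Alphabet}

/-- The embedding into the quasi-shuffle algebra that is induced by `L`. -/
def RedRing.toQSh (K : Type*) [Field K] [CharZero K] (H : Alphabet) : RedRing K H →+* QShAlg K H :=
  Ideal.Quotient.lift (relIdeal K H) (linearize K H : SumRing K H →+* QShAlg K H) fun _ h => h

theorem RedRing.toQSh_mk (f : SumRing K H) :
    RedRing.toQSh K H (Ideal.Quotient.mk _ f) = linearize K H f := rfl

theorem RedRing.toQSh_injective : Function.Injective (RedRing.toQSh K H) :=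
  RingHom.lift_injective_of_ker_le_ideal _ _ le_rfl

theorem RedRing.back_toQSh_shift (f : RedRing K H) :
    QShAlg.back K H (RedRing.toQSh K H (RedRing.shift K H f)) = RedRing.toQSh K H f := by
  obtain ⟨f, rfl⟩ := Ideal.Quotient.mk_surjective f
  rw [RedRing.shift_mk, toQSh_mk, toQSh_mk, ← linearize_back]
  exact congrArg (linearize K H) ((SumRing.shift K H).symm_apply_apply f)

theorem RedRing.toQSh_algebraMap (r : RatAlt K) :
    RedRing.toQSh K H (algebraMap (RatAlt K) (RedRing K H) r) = algebraMap _ _ r :=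
  (linearize K H).commutes r

/-- The embedding of the reduced ring into the ring of sequences. -/
def RedRing.toSeqHom (K : Type*) [Field K] [CharZero K] (H : Alphabet) :
    RedRing K H →+* SeqRing K :=
  (QShAlg.toSeqHom K H).comp (RedRing.toQSh K H)

theorem RedRing.toSeqHom_injective : Function.Injective (RedRing.toSeqHom K H) :=
  QShAlg.toSeqHom_injective.comp RedRing.toQSh_injective

theorem RedRing.toSeqHom_shift (f : RedRing K H) :
    RedRing.toSeqHom K H (RedRing.shift K H f) =
      SeqRing.shift K (RedRing.toSeqHom K H f) := by
  simp only [RedRing.toSeqHom, RingHom.comp_apply]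
  rw [← RedRing.back_toQSh_shift f, QShAlg.shift_toSeqHom_back]

theorem RedRing.toSeqHom_algebraMap (r : RatAlt K) :
    RedRing.toSeqHom K H (algebraMap (RatAlt K) (RedRing K H) r) = RatAlt.toSeqHom K r := by
  rw [RedRing.toSeqHom, RingHom.comp_apply, toQSh_algebraMap, QShAlg.toSeqHom_algebraMap]

theorem RedRing.toSeqHom_sum (w : Word K H) :
    RedRing.toSeqHom K H (RedRing.sum w) = toSeq (nestedSum w.1) := by
  rw [RedRing.toSeqHom, RingHom.comp_apply, RedRing.sum, toQSh_mk, linearize_X]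
  exact toSeqAdd_word w.1

/-- No computation in the reduced ring is needed: its embedding into sequences turns an invariant
element into a sequence that is constant from some point on. -/
theorem RedRing.constants_shift :
    constants (RedRing.shift K H) = (algebraMap K (RedRing K H)).range := by
  ext f
  rw [constants, RingHom.mem_eqLocus, RingHom.coe_coe, RingHom.id_apply, RingHom.mem_range]
  constructor
  · intro hf
    have h1 := RedRing.toSeqHom_shift f
    rw [hf] at h1
    obtain ⟨c, hc⟩ := SeqRing.eq_const_of_shift_eq h1.symm
    refine ⟨c, RedRing.toSeqHom_injective ?_⟩
    rw [IsScalarTower.algebraMap_apply K (RatAlt K) (RedRing K H), toSeqHom_algebraMap,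
      RatAlt.toSeqHom_algebraMap, hc]
  · rintro ⟨c, rfl⟩
    apply RedRing.toSeqHom_injective
    rw [toSeqHom_shift, IsScalarTower.algebraMap_apply K (RatAlt K) (RedRing K H),
      toSeqHom_algebraMap, ← RatAlt.toSeqHom_shift, RatAlt.shift_algebraMap]

/-- Independence of the words is carried over by the injective evaluation, which also identifies the
coefficient ring with its image. -/
theorem nestedSum_algebraicIndependent (ord : LinearOrder (Word K H)) :
    AlgebraicIndependent (RatAlt.toSeqHom K).range
      (fun w : basisSums ord => toSeq (nestedSum w.1.1)) := by
  have h := (basisSums_algebraicIndependent ord).ringHom_of_comp_eq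
    (RatAlt.toSeqHom K).rangeRestrict (QShAlg.toSeqHom K H)
    (RatAlt.toSeqHom K).rangeRestrict_surjective QShAlg.toSeqHom_injective
    (RingHom.ext fun r => (QShAlg.toSeqHom_algebraMap r).symm)
  convert h using 1
  funext w
  exact (toSeqAdd_word w.1.1).symm

theorem adjoin_nestedSum (ord : LinearOrder (Word K H)) :
    (Algebra.adjoin (RatAlt.toSeqHom K).range
      (Set.range fun w : basisSums ord => toSeq (nestedSum w.1.1))).toSubring =
      (RedRing.toSeqHom K H).range := by
  refine le_antisymm (fun s hs => ?_) ?_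
  · rw [Subalgebra.mem_toSubring] at hs
    induction hs using Algebra.adjoin_induction with
    | mem s hs =>
      obtain ⟨w, rfl⟩ := hs
      exact ⟨RedRing.sum w.1, RedRing.toSeqHom_sum w.1⟩
    | algebraMap r =>
      obtain ⟨_, r, rfl⟩ := r
      exact ⟨_, RedRing.toSeqHom_algebraMap r⟩
    | add s t _ _ hs ht => exact add_mem hs ht
    | mul s t _ _ hs ht => exact mul_mem hs ht
  · rintro _ ⟨f, rfl⟩
    rw [Subalgebra.mem_toSubring, RedRing.toSeqHom, RingHom.comp_apply]
    -- The irreducible words generate the whole quasi-shuffle algebra, in particular the image of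
    -- `f`.
    have hx : RedRing.toQSh K H f ∈ Algebra.adjoin (RatAlt K)
        (Set.range fun w : basisSums ord => word (RatAlt K) (letterBracket K H) w.1.1) := by
      rw [adjoin_basisSums]
      exact Algebra.mem_top
    generalize RedRing.toQSh K H f = x at hx ⊢
    induction hx using Algebra.adjoin_induction with
    | mem x hx =>
      obtain ⟨w, rfl⟩ := hx
      exact Algebra.subset_adjoin ⟨w, (toSeqAdd_word w.1.1).symm⟩
    | algebraMap r =>
      rw [QShAlg.toSeqHom_algebraMap]
      exact Subalgebra.algebraMap_mem _ (⟨_, r, rfl⟩ : (RatAlt.toSeqHom K).range)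
    | add x y _ _ hx hy => rw [map_add]; exact add_mem hx hy
    | mul x y _ _ hx hy => rw [map_mul]; exact mul_mem hx hy

end reduced

end HSum
end

theorem mainTheorem2 {K : Type*} [Field K] [CharZero K] (H : HSum.Alphabet)
    (ord : LinearOrder (HSum.Word K H)) :
    HSum.constants (HSum.RedRing.shift K H) = (algebraMap K (HSum.RedRing K H)).range ∧
    ∃ τ : HSum.RedRing K H →+* HSum.SeqRing K,
      Function.Injective τ ∧
      (∀ f, τ (HSum.RedRing.shift K H f) = HSum.SeqRing.shift K (τ f)) ∧
      (∀ r : HSum.RatAlt K,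
        τ (algebraMap (HSum.RatAlt K) (HSum.RedRing K H) r) = HSum.RatAlt.toSeqHom K r) ∧
      (∀ w : HSum.Word K H, τ (HSum.RedRing.sum w) = HSum.toSeq (HSum.nestedSum w.1)) ∧
      AlgebraicIndependent (HSum.RatAlt.toSeqHom K).range
        (fun w : HSum.basisSums ord => HSum.toSeq (HSum.nestedSum w.1.1)) ∧
      (Algebra.adjoin (HSum.RatAlt.toSeqHom K).range
        (Set.range fun w : HSum.basisSums ord =>
          HSum.toSeq (HSum.nestedSum w.1.1))).toSubring = τ.range :=
  ⟨HSum.RedRing.constants_shift, HSum.RedRing.toSeqHom K H, HSum.RedRing.toSeqHom_injective,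
    HSum.RedRing.toSeqHom_shift, HSum.RedRing.toSeqHom_algebraMap, HSum.RedRing.toSeqHom_sum,
    HSum.nestedSum_algebraicIndependent ord, HSum.adjoin_nestedSum ord⟩
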